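/- **Setting.** Let $\mathbb K=\mathbb R$ or $\mathbb C$. For $q:\mathbb Z^2\to\mathbb K$, $q_{ij}=q_{m+i,n+j}$, put $x=q-q_{-1,0}$, $y=q-q_{0,-1}$, $z=q-q_{-1,-1}$ and let $T_m,T_n$ be the shifts of $m$ and $n$. Consider the lattice $$(T_m-1)f(x)+(T_n-1)g(y)+(T_mT_n-1)h(z)=0,\qquad(1)$$ where $f,g,h$ are $\mathbb K$-valued analytic germs at points $x_0,y_0,x_0+y_0\in\mathbb K$ with $f'(x_0)\,g'(y_0)\,h'(x_0+y_0)\neq0$, and suppose that at most one of the functions $f',g',h'$ is constant (near its base point). Let $$T:(x,y)\mapsto(X,Y),\qquad X=g(y)+h(x+y),\quad Y=-f(x)-h(x+y),$$ and $(X_0,Y_0)=T(x_0,y_0)$. If $T$ is invertible near $(x_0,y_0)$ (it has an analytic local inverse), then the transformations $$T_+:\ (X,Y_{-1,0})=T(x,y_{0,1}),\qquad T_-:\ (X_{0,-1},Y)=T(x_{1,0},y)$$ define new variables $Q$ with $X=Q-Q_{-1,0}$, $Y=Q-Q_{0,-1}$, $Z=Q-Q_{-1,-1}$. Solving these relations for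 $x,y$ and substituting into the identity $(T_m-1)y_{0,1}=(T_n-1)x_{1,0}$ gives one equation for $Q$ in the case of $T_+$ and one in the case of $T_-$; both are considered near the configuration $Q_{m,n}=mX_0+nY_0$. The lattice (1) *admits duality transformations* near $(x_0,y_0)$ if $T$ is invertible near $(x_0,y_0)$ and these two equations are equivalent. A lattice $(T_m-1)F(X)+(T_n-1)G(Y)+(T_mT_n-1)H(Z)=0$, with $F,G,H$ analytic germs at $X_0,Y_0,X_0+Y_0$, is *dual* to (1) if it is equivalent to both of these equations. **List.** With complex parameters satisfying $\lambda+\mu+\nu=0$ in (A), (B), (C), $\lambda\ne0$ in (H), and $\lambda\mu\nu=-1$ in (I), and with arbitrary branches of the logarithms: - (A) $f=\mu/x$, $g=\nu/y$, $h=\lambda/z$; - (B) $f=\mu\coth x$, $g=\nu\coth y$, $h=\lambda\coth z$; - (C) $f=\frac12\log\frac{x+\mu}{x-\mu}$, $g=\frac12\log\frac{y+\nu}{y-\nu}$, $h=\frac12\log\frac{z+\lambda}{z-\lambda}$; - (D) $f=\log x$, $g=\log y$, $h=\log(1-1/z)$; - (E) $f=-e^x-1$, $g=e^{-y}$, $h=\frac1{1+e^z}$;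 - (F) $f=\log(e^x-1)$, $g=\log(e^y-1)$, $h=-\log(e^z-1)$; - (G) $f=-\log(e^{-x}-1)$, $g=\log(e^y-1)$, $h=-z$; - (H) $f=\log(\lambda^{-1}(e^x+1))$, $g=\log(e^{-y}-1)$, $h=\log\frac{e^z+\lambda}{e^z+1}$; - (I) $f=\log\frac{\mu e^x+1}{e^x+\mu}$, $g=\log\frac{\nu e^y+1}{e^y+\nu}$, $h=\log\frac{\lambda e^z+1}{e^z+\lambda}$. A lattice (1) *belongs* to a family of the list if $f,g,h$ are obtained near their base points from the functions of the family by a change $\tilde q_{m,n}=c(q_{m,n}-m\xi_0-n\xi_1)$, $c\neq0$, a permutation of the $x,y,z$ axes (the equation is symmetric under permutations of the functions $f(t)$, $g(t)$, $-h(-t)$ attached to the shifts $T_m$, $T_n$, $T_m^{-1}T_n^{-1}$), multiplication of the whole equation by a nonzero constant, and addition of constants to $f,g,h$; the last two operations do not alter the equation. All the constants may be complex, also when $\mathbb K=\mathbb R$. **Theorem.** Under these assumptions: 1. The lattice (1) admits duality transformations near $(x_0,y_0)$ if and only if $T$ is invertible near $(x_0,y_0)$ and (1) belongs to one of the families (A)–(I).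 If (1) belongs to one of the families, then every neighbourhood of $(x_0,y_0)$ contains a point near which (1) admits duality transformations. 2. If (1) admits duality transformations near $(x_0,y_0)$, then a dual lattice exists. If (1) belongs to one of the families, every lattice dual to it belongs to the corresponding family with the same parameters, where the correspondence is (B)$\leftrightarrow$(C), (D)$\leftrightarrow$(E), (F)$\leftrightarrow$(G), while (A), (H) and (I) correspond to themselves. -/

import Mathlib

open Filter Topology

/-! ### Differences on the square lattice, and the lattice equation -/

section Lattice

variable {𝕜 : Type*} [RCLike 𝕜]

/-- `x = q - q_{-1,0}` at the node `(m,n)`. -/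
def diffX (q : ℤ → ℤ → 𝕜) (m n : ℤ) : 𝕜 := q m n - q (m - 1) n

/-- `y = q - q_{0,-1}` at the node `(m,n)`. -/
def diffY (q : ℤ → ℤ → 𝕜) (m n : ℤ) : 𝕜 := q m n - q m (n - 1)

/-- `z = q - q_{-1,-1}` at the node `(m,n)`. -/
def diffZ (q : ℤ → ℤ → 𝕜) (m n : ℤ) : 𝕜 := q m n - q (m - 1) (n - 1)

/-- The equation `(T_m - 1) f(x) + (T_n - 1) g(y) + (T_m T_n - 1) h(z) = 0`
at the node `(m,n)`. -/
def LatticeEq (f g h : 𝕜 → 𝕜) (q : ℤ → ℤ → 𝕜) (m n : ℤ) : Prop :=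
  (f (diffX q (m + 1) n) - f (diffX q m n)) + (g (diffY q m (n + 1)) - g (diffY q m n)) +
    (h (diffZ q (m + 1) (n + 1)) - h (diffZ q m n)) = 0

/-- The configuration `q_{m,n} = m a + n b`, whose differences are constant:
`x = a`, `y = b`, `z = a + b`. -/
def linearConfig (a b : 𝕜) : ℤ → ℤ → 𝕜 := fun m n => (m : 𝕜) * a + (n : 𝕜) * b

/-! ### Duality transformations

The functions `f`, `g`, `h` are analytic germs at `x₀`, `y₀`, `x₀ + y₀`, so that the mapping `T`
is a germ at `(x₀, y₀)`, and the equations for the new variables are considered near the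
configuration `Q_{m,n} = m X₀ + n Y₀` with `(X₀, Y₀) = T (x₀, y₀)`. -/

/-- The mapping `T : (x, y) ↦ (X, Y)`, `X = g(y) + h(x + y)`, `Y = - f(x) - h(x + y)`. -/
def dualityMap (f g h : 𝕜 → 𝕜) (p : 𝕜 × 𝕜) : 𝕜 × 𝕜 :=
  (g p.2 + h (p.1 + p.2), -f p.1 - h (p.1 + p.2))

/-- `S` is an analytic inverse of `T` near the point `p`. -/
def IsLocalInverse (T S : 𝕜 × 𝕜 → 𝕜 × 𝕜) (p : 𝕜 × 𝕜) : Prop :=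
  AnalyticAt 𝕜 S (T p) ∧ (∀ᶠ r in 𝓝 p, S (T r) = r) ∧ ∀ᶠ R in 𝓝 (T p), T (S R) = R

/-- The mapping `T` is invertible near `(x₀, y₀)`. -/
def DualityMapInvertible (f g h : 𝕜 → 𝕜) (x₀ y₀ : 𝕜) : Prop :=
  ∃ S : 𝕜 × 𝕜 → 𝕜 × 𝕜, IsLocalInverse (dualityMap f g h) S (x₀, y₀)

/-- The equation for the variable `Q` defined by `T₊ : (X, Y_{-1,0}) = T (x, y_{0,1})`.
With `S` the inverse of `T`, one has `(x_{m,n}, y_{m,n+1}) = S (X_{m,n}, Y_{m-1,n})` at every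
node; the equation is the identity `(T_m - 1) y_{0,1} = (T_n - 1) x_{1,0}` at `(m,n)`. -/
def EqPlus (S : 𝕜 × 𝕜 → 𝕜 × 𝕜) (Q : ℤ → ℤ → 𝕜) (m n : ℤ) : Prop :=
  (S (diffX Q (m + 1) n, diffY Q m n)).2 - (S (diffX Q m n, diffY Q (m - 1) n)).2 =
    (S (diffX Q (m + 1) (n + 1), diffY Q m (n + 1))).1 - (S (diffX Q (m + 1) n, diffY Q m n)).1

/-- The equation for the variable `Q` defined by `T₋ : (X_{0,-1}, Y) = T (x_{1,0}, y)`.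
With `S` the inverse of `T`, one has `(x_{m+1,n}, y_{m,n}) = S (X_{m,n-1}, Y_{m,n})` at every
node; the equation is the identity `(T_m - 1) y_{0,1} = (T_n - 1) x_{1,0}` at `(m,n)`. -/
def EqMinus (S : 𝕜 × 𝕜 → 𝕜 × 𝕜) (Q : ℤ → ℤ → 𝕜) (m n : ℤ) : Prop :=
  (S (diffX Q (m + 1) n, diffY Q (m + 1) (n + 1))).2 - (S (diffX Q m n, diffY Q m (n + 1))).2 =
    (S (diffX Q m n, diffY Q m (n + 1))).1 - (S (diffX Q m (n - 1), diffY Q m n)).1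

/-- The lattice given by `f`, `g`, `h` admits the duality transformations near `(x₀, y₀)`: the
mapping `T` is invertible there, and the equations for the variables produced by `T₊` and by `T₋`
are equivalent. -/
def AdmitsDuality (f g h : 𝕜 → 𝕜) (x₀ y₀ : 𝕜) : Prop :=
  ∃ S : 𝕜 × 𝕜 → 𝕜 × 𝕜, IsLocalInverse (dualityMap f g h) S (x₀, y₀) ∧
    ∀ᶠ Q in 𝓝 (linearConfig (dualityMap f g h (x₀, y₀)).1 (dualityMap f g h (x₀, y₀)).2),
      EqPlus S Q 0 0 ↔ EqMinus S Q 0 0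

/-- The lattice given by `F`, `G`, `H` is dual to the lattice given by `f`, `g`, `h`: it is the
equation both for the variables produced by `T₊` and for the variables produced by `T₋`. -/
def IsDualLattice (f g h : 𝕜 → 𝕜) (x₀ y₀ : 𝕜) (F G H : 𝕜 → 𝕜) : Prop :=
  let X₀ := (dualityMap f g h (x₀, y₀)).1
  let Y₀ := (dualityMap f g h (x₀, y₀)).2
  AnalyticAt 𝕜 F X₀ ∧ AnalyticAt 𝕜 G Y₀ ∧ AnalyticAt 𝕜 H (X₀ + Y₀) ∧
    ∃ S : 𝕜 × 𝕜 → 𝕜 × 𝕜, IsLocalInverse (dualityMap f g h) S (x₀, y₀) ∧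
      ∀ᶠ Q in 𝓝 (linearConfig X₀ Y₀),
        (EqPlus S Q 0 0 ↔ LatticeEq F G H Q 0 0) ∧ (EqMinus S Q 0 0 ↔ LatticeEq F G H Q 0 0)

/-- The derivative of `f` is constant near `x₀`. -/
def HasConstDeriv (f : 𝕜 → 𝕜) (x₀ : 𝕜) : Prop := ∀ᶠ x in 𝓝 x₀, deriv f x = deriv f x₀

end Lattice

/-! ### The list -/

/-- The nine families, with their complex parameters (`l` stands for `λ`). -/
inductive LatticeFamily : Type
  | A (μ ν l : ℂ)
  | B (μ ν l : ℂ)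
  | C (μ ν l : ℂ)
  | D
  | E
  | F
  | G
  | H (l : ℂ)
  | I (μ ν l : ℂ)

namespace LatticeFamily

/-- The constraints on the parameters. -/
def Valid : LatticeFamily → Prop
  | A μ ν l => l + μ + ν = 0
  | B μ ν l => l + μ + ν = 0
  | C μ ν l => l + μ + ν = 0
  | H l => l ≠ 0
  | I μ ν l => l * μ * ν = -1
  | _ => True

/-- `w` is a value at `s` of the function `f` of the family. Values of logarithms are all the
solutions of the corresponding exponential equation; an analytic function all of whose values are
such `w` is a branch. -/
def fValue : LatticeFamily → ℂ → ℂ → Prop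
  | A μ _ _, s, w => s ≠ 0 ∧ w = μ / s
  | B μ _ _, s, w => Complex.sinh s ≠ 0 ∧ w = μ * (Complex.cosh s / Complex.sinh s)
  | C μ _ _, s, w => s ≠ μ ∧ Complex.exp (2 * w) = (s + μ) / (s - μ)
  | D, s, w => Complex.exp w = s
  | E, s, w => w = -Complex.exp s - 1
  | F, s, w => Complex.exp w = Complex.exp s - 1
  | G, s, w => Complex.exp (-w) = Complex.exp (-s) - 1
  | H l, s, w => Complex.exp w = l⁻¹ * (Complex.exp s + 1)
  | I μ _ _, s, w => Complex.exp s + μ ≠ 0 ∧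
      Complex.exp w = (μ * Complex.exp s + 1) / (Complex.exp s + μ)

/-- `w` is a value at `s` of the function `g` of the family. -/
def gValue : LatticeFamily → ℂ → ℂ → Prop
  | A _ ν _, s, w => s ≠ 0 ∧ w = ν / s
  | B _ ν _, s, w => Complex.sinh s ≠ 0 ∧ w = ν * (Complex.cosh s / Complex.sinh s)
  | C _ ν _, s, w => s ≠ ν ∧ Complex.exp (2 * w) = (s + ν) / (s - ν)
  | D, s, w => Complex.exp w = s
  | E, s, w => w = Complex.exp (-s)
  | F, s, w => Complex.exp w = Complex.exp s - 1
  | G, s, w => Complex.exp w = Complex.exp s - 1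
  | H _, s, w => Complex.exp w = Complex.exp (-s) - 1
  | I _ ν _, s, w => Complex.exp s + ν ≠ 0 ∧
      Complex.exp w = (ν * Complex.exp s + 1) / (Complex.exp s + ν)

/-- `w` is a value at `s` of the function `h` of the family. -/
def hValue : LatticeFamily → ℂ → ℂ → Prop
  | A _ _ l, s, w => s ≠ 0 ∧ w = l / s
  | B _ _ l, s, w => Complex.sinh s ≠ 0 ∧ w = l * (Complex.cosh s / Complex.sinh s)
  | C _ _ l, s, w => s ≠ l ∧ Complex.exp (2 * w) = (s + l) / (s - l)
  | D, s, w => s ≠ 0 ∧ Complex.exp w = 1 - 1 / s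
  | E, s, w => 1 + Complex.exp s ≠ 0 ∧ w = 1 / (1 + Complex.exp s)
  | F, s, w => Complex.exp (-w) = Complex.exp s - 1
  | G, s, w => w = -s
  | H l, s, w => Complex.exp s + 1 ≠ 0 ∧
      Complex.exp w = (Complex.exp s + l) / (Complex.exp s + 1)
  | I _ _ l, s, w => Complex.exp s + l ≠ 0 ∧
      Complex.exp w = (l * Complex.exp s + 1) / (Complex.exp s + l)

/-- The three functions of the family in the form symmetric in the axes, see `symmTriple`. -/
def symmValue (Φ : LatticeFamily) : Fin 3 → ℂ → ℂ → Prop :=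
  ![Φ.fValue, Φ.gValue, fun s w => Φ.hValue (-s) (-w)]

/-- The correspondence between the families given by duality. -/
def dual : LatticeFamily → LatticeFamily
  | A μ ν l => A μ ν l
  | B μ ν l => C μ ν l
  | C μ ν l => B μ ν l
  | D => E
  | E => D
  | F => G
  | G => F
  | H l => H l
  | I μ ν l => I μ ν l

end LatticeFamily

section Equivalence

variable {𝕜 : Type*} [RCLike 𝕜]

/-- The lattice equation is `∑ i, (Tᵢ - 1) fᵢ(q - Tᵢ⁻¹ q) = 0` for the three shifts
`T₀ = T_m`, `T₁ = T_n`, `T₂ = T_m⁻¹ T_n⁻¹`, whose product is the identity, and for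
`f₀ = f`, `f₁ = g`, `f₂(t) = - h(-t)`. The roles of the three axes are equal in this form, and
permutations of the axes are permutations of `f₀, f₁, f₂`. -/
def symmTriple (f g h : 𝕜 → 𝕜) : Fin 3 → 𝕜 → 𝕜 := ![f, g, fun t => -h (-t)]

/-- The base points of the germs `f₀, f₁, f₂`. -/
def symmBase (x₀ y₀ : 𝕜) : Fin 3 → 𝕜 := ![x₀, y₀, -(x₀ + y₀)]

/-- Near `(x₀, y₀)` the lattice given by `f`, `g`, `h` belongs to the family `Φ` up to
a permutation `σ` of the axes, a change `c (q_{m,n} - m ξ₀ - n ξ₁)` of the variable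
(the three differences `x, y, -z` are shifted by `ξ₀, ξ₁, ξ₂` with zero sum), and up to
multiplication of the equation by a constant `k ≠ 0` and addition of constants `a₀, a₁, a₂` to
the functions, which do not alter the equation. The constants are complex, also if `𝕜 = ℝ`. -/
def BelongsTo [NormedAlgebra 𝕜 ℂ] (f g h : 𝕜 → 𝕜) (x₀ y₀ : 𝕜) (Φ : LatticeFamily) : Prop :=
  ∃ (σ : Equiv.Perm (Fin 3)) (c k : ℂ) (ξ a : Fin 3 → ℂ),
    c ≠ 0 ∧ k ≠ 0 ∧ ξ 0 + ξ 1 + ξ 2 = 0 ∧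
      ∀ i : Fin 3, ∀ᶠ t in 𝓝 (symmBase x₀ y₀ i),
        Φ.symmValue (σ i) (c * (algebraMap 𝕜 ℂ t - ξ i))
          (k * algebraMap 𝕜 ℂ (symmTriple f g h i t) + a i)

end Equivalence

/-! ### Local coordinates for the lattice equations: six independent differences. -/

section DifferenceVariables

variable {𝕜 : Type*} [RCLike 𝕜]

/-! Let D = f'g' + f'h' + g'h' be the Jacobian determinant of T. The partial derivatives of the
inverse S are sums of f'/D, g'/D and h'/D up to sign. If these quotients, transported by S, depend
only on X, only on Y and only on X + Y, then S integrates to (c₁ - G(Y) - H(X+Y), c₂ + F(X) +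
H(X+Y)), which has the shape of T itself (`IsLocalInverse.exists_separation`), and both dual
equations turn into the lattice equation of F, G, H (`eventually_dual_iff`). The three independence
statements are one and the same differential condition `DualityPDE`. Conversely, solutions of the
first dual equation for which both of its sides vanish suffice to force this condition
(`eventually_dualityPDE`). Hence duality means invertibility of T together with the condition
(`admitsDuality_iff`).

In terms of a = 1/f', b = 1/g', c(z) = 1/h'(-z), the condition is the symmetric functional equation
(b + c)a' + (c + a)b' + (a + b)c' = 0 on x + y + z = 0. Differentiating along the plane and
eliminating second derivatives gives a'''b' = b'''a' and its rotations, so a''' = κa', b''' = κb',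
c''' = κc' with a common κ (`PlaneSolution.exists_third_eq`). Thus a, b, c are either quadratic
polynomials or combinations of 1, e^{ωs}, e^{-ωs}, and the functional equation becomes algebra in
the coefficients. Up to permutations, scalings and shifts with zero sum, the quadratic solutions are
the reciprocals of (A), (C), (D), and the exponential ones those of (B), (E)-(I)
(`JetCondition.familyForm_quad`, `familyForm_of_expCondition`). Affine solutions are excluded by D =
f'g'h'(a + b + c) ≠ 0.

In the other direction the reciprocals of each family satisfy the equation
(`LatticeFamily.recip_identity`), and D cannot vanish identically, since a + b + c = 0 on the plane
would make all three functions affine.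

A dual lattice is unique up to a common factor and additive constants
(`IsDualLattice.exists_hasDerivAt`), so that 1/F' is a constant times (a + b + c)/(bc). For each
family this is the reciprocal of the dual family at X (`LatticeFamily.dualRelation`). -/

/-- A property of the six differences that enter the equations at the node `(0, 0)` holds near the
linear configuration iff it holds for all values of the differences in a ball. -/
theorem eventually_linearConfig_iff (X₀ Y₀ : 𝕜) (p : 𝕜 → 𝕜 → 𝕜 → 𝕜 → 𝕜 → 𝕜 → Prop) :
    (∀ᶠ Q in 𝓝 (linearConfig X₀ Y₀), p (diffX Q 1 0) (diffX Q 0 0) (diffY Q 0 1) (diffY Q 0 0)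
      (diffZ Q 1 1) (diffZ Q 0 0)) ↔
    ∃ ε > 0, ∀ A ∈ Metric.ball X₀ ε, ∀ X ∈ Metric.ball X₀ ε, ∀ B ∈ Metric.ball Y₀ ε,
      ∀ Y ∈ Metric.ball Y₀ ε, ∀ C ∈ Metric.ball (X₀ + Y₀) ε, ∀ Z ∈ Metric.ball (X₀ + Y₀) ε,
        p A X B Y C Z := by
  constructor
  · intro hp
    -- Each of the six differences involves the origin and one further node, and these six nodes are
    -- distinct. Putting 0 at the origin and ± the prescribed differences at its neighbours realizes
    -- any six values.
    let q : 𝕜 × 𝕜 × 𝕜 × 𝕜 × 𝕜 × 𝕜 → ℤ → ℤ → 𝕜 := fun v m n =>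
      if m = 0 ∧ n = 0 then 0 else if m = 1 ∧ n = 0 then v.1
      else if m = -1 ∧ n = 0 then -v.2.1 else if m = 0 ∧ n = 1 then v.2.2.1
      else if m = 0 ∧ n = -1 then -v.2.2.2.1 else if m = 1 ∧ n = 1 then v.2.2.2.2.1
      else if m = -1 ∧ n = -1 then -v.2.2.2.2.2 else linearConfig X₀ Y₀ m n
    have hq : Continuous q := by
      refine continuous_pi fun m => continuous_pi fun n => ?_
      simp only [q]
      split_ifs <;> fun_prop
    have hq0 : q (X₀, X₀, Y₀, Y₀, X₀ + Y₀, X₀ + Y₀) = linearConfig X₀ Y₀ := by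
      funext m n
      simp only [q, linearConfig]
      split_ifs with h1 h2 h3 h4 h5 h6 h7
      · simp [h1.1, h1.2]
      · simp [h2.1, h2.2]
      · simp [h3.1, h3.2]
      · simp [h4.1, h4.2]
      · simp [h5.1, h5.2]
      · simp [h6.1, h6.2]
      · simp [h7.1, h7.2]; ring
      · rfl
    have h := hq.tendsto (X₀, X₀, Y₀, Y₀, X₀ + Y₀, X₀ + Y₀)
    rw [hq0] at h
    obtain ⟨ε, hε, hb⟩ := Metric.eventually_nhds_iff.1 (h.eventually hp)
    refine ⟨ε, hε, fun A hA X hX B hB Y hY C hC Z hZ => ?_⟩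
    have := hb (y := (A, X, B, Y, C, Z)) (by
      simp only [Prod.dist_eq, max_lt_iff]
      exact ⟨hA, hX, hB, hY, hC, hZ⟩)
    simpa [diffX, diffY, diffZ, q] using this
  · rintro ⟨ε, hε, hp⟩
    have key : ∀ (m n m' n' : ℤ) (c : 𝕜),
        linearConfig X₀ Y₀ m n - linearConfig X₀ Y₀ m' n' = c →
        ∀ᶠ Q : ℤ → ℤ → 𝕜 in 𝓝 (linearConfig X₀ Y₀), Q m n - Q m' n' ∈ Metric.ball c ε := by
      intro m n m' n' c hc
      have hcont : Continuous fun Q : ℤ → ℤ → 𝕜 => Q m n - Q m' n' := by fun_prop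
      have h := hcont.tendsto (linearConfig X₀ Y₀)
      simp only [hc] at h
      exact h.eventually (Metric.ball_mem_nhds _ hε)
    filter_upwards [key 1 0 (1 - 1) 0 X₀ (by simp [linearConfig]),
      key 0 0 (0 - 1) 0 X₀ (by simp [linearConfig]),
      key 0 1 0 (1 - 1) Y₀ (by simp [linearConfig]),
      key 0 0 0 (0 - 1) Y₀ (by simp [linearConfig]),
      key 1 1 (1 - 1) (1 - 1) (X₀ + Y₀) (by simp [linearConfig]),
      key 0 0 (0 - 1) (0 - 1) (X₀ + Y₀) (by simp [linearConfig]; ring)] with Q h1 h2 h3 h4 h5 h6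
    exact hp _ h1 _ h2 _ h3 _ h4 _ h5 _ h6

/-- Differences between two nodes other than the origin are eliminated along triangles: y at (-1,0)
is Z - X, and x at (1,1) is C - B with C, B the differences z at (1,1) and y at (0,1). -/
theorem eqPlus_iff (S : 𝕜 × 𝕜 → 𝕜 × 𝕜) (Q : ℤ → ℤ → 𝕜) : EqPlus S Q 0 0 ↔
    (S (diffX Q 1 0, diffY Q 0 0)).2 - (S (diffX Q 0 0, diffZ Q 0 0 - diffX Q 0 0)).2 =
      (S (diffZ Q 1 1 - diffY Q 0 1, diffY Q 0 1)).1 - (S (diffX Q 1 0, diffY Q 0 0)).1 := by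
  simp [EqPlus, diffX, diffY, diffZ]

theorem eqMinus_iff (S : 𝕜 × 𝕜 → 𝕜 × 𝕜) (Q : ℤ → ℤ → 𝕜) : EqMinus S Q 0 0 ↔
    (S (diffX Q 1 0, diffZ Q 1 1 - diffX Q 1 0)).2 - (S (diffX Q 0 0, diffY Q 0 1)).2 =
      (S (diffX Q 0 0, diffY Q 0 1)).1 - (S (diffZ Q 0 0 - diffY Q 0 0, diffY Q 0 0)).1 := by
  simp [EqMinus, diffX, diffY, diffZ]

theorem latticeEq_iff (F G H : 𝕜 → 𝕜) (Q : ℤ → ℤ → 𝕜) : LatticeEq F G H Q 0 0 ↔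
    (F (diffX Q 1 0) - F (diffX Q 0 0)) + (G (diffY Q 0 1) - G (diffY Q 0 0)) +
      (H (diffZ Q 1 1) - H (diffZ Q 0 0)) = 0 := by
  simp [LatticeEq]

end DifferenceVariables

/-! ### Functions with zero derivative on a ball. -/

section LocallyConstant

variable {𝕜 : Type*} [RCLike 𝕜] {G : Type*} [NormedAddCommGroup G] [NormedSpace 𝕜 G]

theorem eq_of_hasFDerivAt_zero_ball {E : Type*} [NormedAddCommGroup E] [NormedSpace 𝕜 E]
    {y : E → G} {c : E} {r : ℝ}
    (h : ∀ x ∈ Metric.ball c r, HasFDerivAt y (0 : E →L[𝕜] G) x) {s t : E}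
    (hs : s ∈ Metric.ball c r) (ht : t ∈ Metric.ball c r) : y s = y t := by
  let : NormedSpace ℝ E := NormedSpace.restrictScalars ℝ 𝕜 E
  have := (convex_ball c r).norm_image_sub_le_of_norm_hasFDerivWithin_le (𝕜 := 𝕜) (C := 0)
    (fun x hx => (h x hx).hasFDerivWithinAt) (by simp) ht hs
  rw [zero_mul] at this
  exact sub_eq_zero.1 (norm_le_zero_iff.1 this)

theorem eq_of_hasDerivAt_zero_ball {y : 𝕜 → G} {c : 𝕜} {r : ℝ}
    (h : ∀ x ∈ Metric.ball c r, HasDerivAt y 0 x) {s t : 𝕜}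
    (hs : s ∈ Metric.ball c r) (ht : t ∈ Metric.ball c r) : y s = y t :=
  eq_of_hasFDerivAt_zero_ball (𝕜 := 𝕜) (fun x hx => by simpa using (h x hx).hasFDerivAt) hs ht

theorem eventually_eq_of_hasDerivAt_zero {y : 𝕜 → G} {c : 𝕜}
    (h : ∀ᶠ x in 𝓝 c, HasDerivAt y 0 x) : ∀ᶠ x in 𝓝 c, y x = y c := by
  obtain ⟨ε, hε, hb⟩ := Metric.eventually_nhds_iff_ball.1 h
  filter_upwards [Metric.ball_mem_nhds c hε] with x hx
  exact eq_of_hasDerivAt_zero_ball hb hx (Metric.mem_ball_self hε)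

end LocallyConstant

/-! ### The duality mapping, its Jacobian and its local inverse. -/

section DualityMap

variable {𝕜 : Type*} [RCLike 𝕜] {f g h : 𝕜 → 𝕜} {S : 𝕜 × 𝕜 → 𝕜 × 𝕜} {p : 𝕜 × 𝕜}

/-- The functions are analytic with nonzero derivatives at the point. -/
structure NondegenerateAt (f g h : 𝕜 → 𝕜) (p : 𝕜 × 𝕜) : Prop where
  f_an : AnalyticAt 𝕜 f p.1
  g_an : AnalyticAt 𝕜 g p.2
  h_an : AnalyticAt 𝕜 h (p.1 + p.2)
  f_ne : deriv f p.1 ≠ 0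
  g_ne : deriv g p.2 ≠ 0
  h_ne : deriv h (p.1 + p.2) ≠ 0

/-- The Jacobian determinant of the duality mapping. -/
noncomputable def dualityDet (f g h : 𝕜 → 𝕜) (p : 𝕜 × 𝕜) : 𝕜 :=
  deriv f p.1 * deriv g p.2 + deriv f p.1 * deriv h (p.1 + p.2) +
    deriv g p.2 * deriv h (p.1 + p.2)

theorem NondegenerateAt.eventually (hp : NondegenerateAt f g h p) :
    ∀ᶠ q in 𝓝 p, NondegenerateAt f g h q := by
  have c1 : Tendsto (fun q : 𝕜 × 𝕜 => q.1) (𝓝 p) (𝓝 p.1) := continuous_fst.tendsto p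
  have c2 : Tendsto (fun q : 𝕜 × 𝕜 => q.2) (𝓝 p) (𝓝 p.2) := continuous_snd.tendsto p
  have c3 : Tendsto (fun q : 𝕜 × 𝕜 => q.1 + q.2) (𝓝 p) (𝓝 (p.1 + p.2)) := c1.add c2
  filter_upwards [c1.eventually hp.f_an.eventually_analyticAt,
    c2.eventually hp.g_an.eventually_analyticAt, c3.eventually hp.h_an.eventually_analyticAt,
    c1.eventually (hp.f_an.deriv.continuousAt.eventually_ne hp.f_ne),
    c2.eventually (hp.g_an.deriv.continuousAt.eventually_ne hp.g_ne),
    c3.eventually (hp.h_an.deriv.continuousAt.eventually_ne hp.h_ne)] with q h1 h2 h3 h4 h5 h6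
  exact ⟨h1, h2, h3, h4, h5, h6⟩

theorem NondegenerateAt.analyticAt_dualityMap (hp : NondegenerateAt f g h p) :
    AnalyticAt 𝕜 (dualityMap f g h) p := by
  have e1 : AnalyticAt 𝕜 (fun q : 𝕜 × 𝕜 => f q.1) p :=
    AnalyticAt.fun_comp (f := fun q : 𝕜 × 𝕜 => q.1) hp.f_an analyticAt_fst
  have e2 : AnalyticAt 𝕜 (fun q : 𝕜 × 𝕜 => g q.2) p :=
    AnalyticAt.fun_comp (f := fun q : 𝕜 × 𝕜 => q.2) hp.g_an analyticAt_snd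
  have e3 : AnalyticAt 𝕜 (fun q : 𝕜 × 𝕜 => h (q.1 + q.2)) p :=
    AnalyticAt.fun_comp (f := fun q : 𝕜 × 𝕜 => q.1 + q.2) hp.h_an (analyticAt_fst.add analyticAt_snd)
  exact (e2.add e3).prod (e1.neg.sub e3)

theorem IsLocalInverse.eventually {T S : 𝕜 × 𝕜 → 𝕜 × 𝕜} (hS : IsLocalInverse T S p)
    (hT : ContinuousAt T p) : ∀ᶠ q in 𝓝 p, IsLocalInverse T S q := by
  filter_upwards [hT.eventually hS.1.eventually_analyticAt, hS.2.1.eventually_nhds,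
    hT.eventually hS.2.2.eventually_nhds] with q h1 h2 h3
  exact ⟨h1, h2, h3⟩

theorem NondegenerateAt.hasFDerivAt_dualityMap (hp : NondegenerateAt f g h p) :
    HasFDerivAt (dualityMap f g h)
      ((deriv h (p.1 + p.2) • ContinuousLinearMap.fst 𝕜 𝕜 𝕜 +
          (deriv g p.2 + deriv h (p.1 + p.2)) • ContinuousLinearMap.snd 𝕜 𝕜 𝕜).prod
        (-(deriv f p.1 + deriv h (p.1 + p.2)) • ContinuousLinearMap.fst 𝕜 𝕜 𝕜 -
          deriv h (p.1 + p.2) • ContinuousLinearMap.snd 𝕜 𝕜 𝕜)) p := by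
  have e1 := hp.f_an.differentiableAt.hasDerivAt.comp_hasFDerivAt p
    (hasFDerivAt_fst (𝕜 := 𝕜) (p := p))
  have e2 := hp.g_an.differentiableAt.hasDerivAt.comp_hasFDerivAt p
    (hasFDerivAt_snd (𝕜 := 𝕜) (p := p))
  have e3 := hp.h_an.differentiableAt.hasDerivAt.comp_hasFDerivAt p
    ((hasFDerivAt_fst (𝕜 := 𝕜) (p := p)).add hasFDerivAt_snd)
  refine ((e2.add e3).prodMk (e1.neg.sub e3)).congr_fderiv ?_
  ext <;> simp <;> ring

/-- The derivative of the inverse of the duality mapping. -/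
theorem IsLocalInverse.hasFDerivAt (hp : NondegenerateAt f g h p)
    (hS : IsLocalInverse (dualityMap f g h) S p) :
    dualityDet f g h p ≠ 0 ∧
    HasFDerivAt (fun R => (S R).1)
      ((-deriv h (p.1 + p.2) / dualityDet f g h p) • ContinuousLinearMap.fst 𝕜 𝕜 𝕜 -
        ((deriv g p.2 + deriv h (p.1 + p.2)) / dualityDet f g h p) •
          ContinuousLinearMap.snd 𝕜 𝕜 𝕜) (dualityMap f g h p) ∧
    HasFDerivAt (fun R => (S R).2)
      (((deriv f p.1 + deriv h (p.1 + p.2)) / dualityDet f g h p) •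
          ContinuousLinearMap.fst 𝕜 𝕜 𝕜 +
        (deriv h (p.1 + p.2) / dualityDet f g h p) • ContinuousLinearMap.snd 𝕜 𝕜 𝕜)
      (dualityMap f g h p) := by
  obtain ⟨hS1, hS2, hS3⟩ := hS
  have hd := hS1.differentiableAt.hasFDerivAt
  have hc := hd.comp p hp.hasFDerivAt_dualityMap
  have hid : HasFDerivAt (S ∘ dualityMap f g h) (ContinuousLinearMap.id 𝕜 (𝕜 × 𝕜)) p :=
    (hasFDerivAt_id p).congr_of_eventuallyEq hS2
  have heq := hc.unique hid
  have hap : ∀ e : 𝕜 × 𝕜, fderiv 𝕜 S (dualityMap f g h p)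
      (deriv h (p.1 + p.2) * e.1 + (deriv g p.2 + deriv h (p.1 + p.2)) * e.2,
        -(deriv f p.1 + deriv h (p.1 + p.2)) * e.1 - deriv h (p.1 + p.2) * e.2) = e := by
    intro e
    have := congrArg (fun L : (𝕜 × 𝕜) →L[𝕜] (𝕜 × 𝕜) => L e) heq
    simpa using this
  have hD : dualityDet f g h p ≠ 0 := by
    intro hD
    -- If the determinant vanishes, this vector lies in the kernel of the derivative of T. The
    -- derivative is injective, while the second entry h' is nonzero.
    have := hap (-(deriv g p.2 + deriv h (p.1 + p.2)), deriv h (p.1 + p.2))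
    have h2 : -(deriv f p.1 + deriv h (p.1 + p.2)) * -(deriv g p.2 + deriv h (p.1 + p.2)) -
        deriv h (p.1 + p.2) * deriv h (p.1 + p.2) = 0 := by
      rw [← hD, dualityDet]; ring
    have h1 : deriv h (p.1 + p.2) * -(deriv g p.2 + deriv h (p.1 + p.2)) +
        (deriv g p.2 + deriv h (p.1 + p.2)) * deriv h (p.1 + p.2) = 0 := by ring
    simp only [h1, h2] at this
    rw [Prod.mk_zero_zero, map_zero] at this
    exact hp.h_ne (congrArg Prod.snd this).symm
  have hval : ∀ d : 𝕜 × 𝕜, fderiv 𝕜 S (dualityMap f g h p) d =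
      ((-deriv h (p.1 + p.2) * d.1 - (deriv g p.2 + deriv h (p.1 + p.2)) * d.2) /
        dualityDet f g h p,
       ((deriv f p.1 + deriv h (p.1 + p.2)) * d.1 + deriv h (p.1 + p.2) * d.2) /
        dualityDet f g h p) := by
    intro d
    -- The vector is the adjugate of the Jacobian matrix applied to `d`, divided by the determinant.
    rw [← hap ((-deriv h (p.1 + p.2) * d.1 - (deriv g p.2 + deriv h (p.1 + p.2)) * d.2) /
        dualityDet f g h p,
       ((deriv f p.1 + deriv h (p.1 + p.2)) * d.1 + deriv h (p.1 + p.2) * d.2) /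
        dualityDet f g h p)]
    congr 1
    ext
    · field_simp
      rw [dualityDet]; ring
    · field_simp
      rw [dualityDet]; ring
  refine ⟨hD, ?_, ?_⟩
  · refine (hd.fst).congr_fderiv ?_
    ext
    · simp [hval]
    · simp [hval]; ring
  · refine (hd.snd).congr_fderiv ?_
    ext <;> simp [hval]

/-- The inverse of the duality mapping along a curve. -/
theorem IsLocalInverse.hasDerivAt_curve (hp : NondegenerateAt f g h p)
    (hS : IsLocalInverse (dualityMap f g h) S p) {X Y : 𝕜 → 𝕜} {t d e : 𝕜}
    (hX : HasDerivAt X d t) (hY : HasDerivAt Y e t) (hXY : (X t, Y t) = dualityMap f g h p) :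
    HasDerivAt (fun t => (S (X t, Y t)).1)
      ((-deriv h (p.1 + p.2) * d - (deriv g p.2 + deriv h (p.1 + p.2)) * e) /
        dualityDet f g h p) t ∧
    HasDerivAt (fun t => (S (X t, Y t)).2)
      (((deriv f p.1 + deriv h (p.1 + p.2)) * d + deriv h (p.1 + p.2) * e) /
        dualityDet f g h p) t := by
  obtain ⟨-, h1, h2⟩ := hS.hasFDerivAt hp
  rw [← hXY] at h1 h2
  constructor
  · refine (h1.comp_hasDerivAt t (hX.prodMk hY)).congr_deriv ?_
    simp; ring
  · refine (h2.comp_hasDerivAt t (hX.prodMk hY)).congr_deriv ?_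
    simp; ring

/-- The inverse function theorem for the duality mapping. -/
theorem NondegenerateAt.dualityMapInvertible (hp : NondegenerateAt f g h p)
    (hD : dualityDet f g h p ≠ 0) : DualityMapInvertible f g h p.1 p.2 := by
  set u := deriv f p.1 with hu
  set v := deriv g p.2 with hv
  set w := deriv h (p.1 + p.2) with hw
  obtain ⟨d, hd⟩ : ∃ d, d = u * v + u * w + v * w := ⟨_, rfl⟩
  have hD' : d ≠ 0 := hd ▸ hD
  have hT := hp.hasFDerivAt_dualityMap
  rw [← hu, ← hv, ← hw] at hT
  let L : (𝕜 × 𝕜) ≃L[𝕜] (𝕜 × 𝕜) := ContinuousLinearEquiv.equivOfInverse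
    ((w • ContinuousLinearMap.fst 𝕜 𝕜 𝕜 + (v + w) • ContinuousLinearMap.snd 𝕜 𝕜 𝕜).prod
      (-(u + w) • ContinuousLinearMap.fst 𝕜 𝕜 𝕜 - w • ContinuousLinearMap.snd 𝕜 𝕜 𝕜))
    (((-w / d) • ContinuousLinearMap.fst 𝕜 𝕜 𝕜 -
        ((v + w) / d) • ContinuousLinearMap.snd 𝕜 𝕜 𝕜).prod
      (((u + w) / d) • ContinuousLinearMap.fst 𝕜 𝕜 𝕜 +
        (w / d) • ContinuousLinearMap.snd 𝕜 𝕜 𝕜))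
    (by intro x; ext <;> simp <;> field_simp <;> rw [hd] <;> ring)
    (by intro x; ext <;> simp <;> field_simp <;> rw [hd] <;> ring)
  have hL : HasFDerivAt (dualityMap f g h) (L : (𝕜 × 𝕜) →L[𝕜] (𝕜 × 𝕜)) p := hT
  have hs : HasStrictFDerivAt (dualityMap f g h) (L : (𝕜 × 𝕜) →L[𝕜] (𝕜 × 𝕜)) p := by
    have := hp.analyticAt_dualityMap.hasStrictFDerivAt
    rwa [hL.fderiv] at this
  let e := hs.toOpenPartialHomeomorph (dualityMap f g h)
  have hmem : p ∈ e.source := hs.mem_toOpenPartialHomeomorph_source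
  have hcoe : (e : 𝕜 × 𝕜 → 𝕜 × 𝕜) = dualityMap f g h := hs.toOpenPartialHomeomorph_coe
  refine ⟨e.symm, ?_, ?_, ?_⟩
  · have := e.analyticAt_symm' hmem (i := L) (by rw [hcoe]; exact hp.analyticAt_dualityMap)
      (by rw [hcoe]; exact hL.fderiv)
    rwa [hcoe] at this
  · have := e.eventually_left_inverse hmem
    rwa [hcoe] at this
  · have := e.eventually_right_inverse' hmem
    rwa [hcoe] at this

end DualityMap

/-! ### Necessity of the differential condition. -/

section DualCoefficients

variable {𝕜 : Type*} [RCLike 𝕜] {f g h : 𝕜 → 𝕜} {S : 𝕜 × 𝕜 → 𝕜 × 𝕜} {p : 𝕜 × 𝕜}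

/-- The differential condition for duality. -/
def DualityPDE (f g h : 𝕜 → 𝕜) (p : 𝕜 × 𝕜) : Prop :=
  (deriv f p.1 + deriv g p.2) * deriv f p.1 * deriv g p.2 * deriv (deriv h) (p.1 + p.2) =
    (deriv g p.2 + deriv h (p.1 + p.2)) * deriv g p.2 * deriv h (p.1 + p.2) *
      deriv (deriv f) p.1 +
    (deriv f p.1 + deriv h (p.1 + p.2)) * deriv f p.1 * deriv h (p.1 + p.2) *
      deriv (deriv g) p.2

/-- The logarithmic derivatives of `f'/D`, `g'/D`, `h'/D` along a curve. -/
theorem hasDerivAt_dualityDet_curve (hp : NondegenerateAt f g h p) {s₁ s₂ : 𝕜 → 𝕜} {t e₁ e₂ : 𝕜}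
    (h₁ : HasDerivAt s₁ e₁ t) (h₂ : HasDerivAt s₂ e₂ t) (hs : (s₁ t, s₂ t) = p) :
    HasDerivAt (fun t => deriv f (s₁ t)) (deriv (deriv f) p.1 * e₁) t ∧
    HasDerivAt (fun t => deriv g (s₂ t)) (deriv (deriv g) p.2 * e₂) t ∧
    HasDerivAt (fun t => deriv h (s₁ t + s₂ t)) (deriv (deriv h) (p.1 + p.2) * (e₁ + e₂)) t ∧
    HasDerivAt (fun t => dualityDet f g h (s₁ t, s₂ t))
      (deriv (deriv f) p.1 * e₁ * (deriv g p.2 + deriv h (p.1 + p.2)) +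
        deriv (deriv g) p.2 * e₂ * (deriv f p.1 + deriv h (p.1 + p.2)) +
        deriv (deriv h) (p.1 + p.2) * (e₁ + e₂) * (deriv f p.1 + deriv g p.2)) t := by
  subst hs
  have d1 : HasDerivAt (fun t => deriv f (s₁ t)) _ t :=
    HasDerivAt.comp t hp.f_an.deriv.differentiableAt.hasDerivAt h₁
  have d2 : HasDerivAt (fun t => deriv g (s₂ t)) _ t :=
    HasDerivAt.comp t hp.g_an.deriv.differentiableAt.hasDerivAt h₂
  have d3 : HasDerivAt (fun t => deriv h (s₁ t + s₂ t)) _ t :=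
    HasDerivAt.comp t (h := fun t => s₁ t + s₂ t)
      hp.h_an.deriv.differentiableAt.hasDerivAt (h₁.add h₂)
  refine ⟨d1, d2, d3, ?_⟩
  refine (((d1.mul d2).add (d1.mul d3)).add (d2.mul d3)).congr_deriv ?_
  ring

/-- Makes the pointwise formulas for the derivative of S available at every point near the image of
the base point. -/
theorem IsLocalInverse.eventually_good (hp : NondegenerateAt f g h p)
    (hS : IsLocalInverse (dualityMap f g h) S p) :
    ∀ᶠ R in 𝓝 (dualityMap f g h p), NondegenerateAt f g h (S R) ∧
      IsLocalInverse (dualityMap f g h) S (S R) ∧ dualityMap f g h (S R) = R := by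
  have hc : Tendsto S (𝓝 (dualityMap f g h p)) (𝓝 p) := by
    have := hS.1.continuousAt.tendsto
    rwa [hS.2.1.self_of_nhds] at this
  filter_upwards [hc.eventually hp.eventually,
    hc.eventually (hS.eventually hp.analyticAt_dualityMap.continuousAt), hS.2.2] with R h1 h2 h3
  exact ⟨h1, h2, h3⟩

/-- If every solution of the first dual equation near the linear configuration solves the second
one, then the differential condition holds. -/
theorem eventually_dualityPDE (hp : NondegenerateAt f g h p)
    (hS : IsLocalInverse (dualityMap f g h) S p)
    (hPM : ∀ᶠ Q in 𝓝 (linearConfig (dualityMap f g h p).1 (dualityMap f g h p).2),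
      EqPlus S Q 0 0 → EqMinus S Q 0 0) : ∀ᶠ q in 𝓝 p, DualityPDE f g h q := by
  simp only [eqPlus_iff, eqMinus_iff] at hPM
  obtain ⟨ε, hε, hb⟩ := (eventually_linearConfig_iff _ _ (fun A X B Y C Z =>
    (S (A, Y)).2 - (S (X, Z - X)).2 = (S (C - B, B)).1 - (S (A, Y)).1 →
    (S (A, C - A)).2 - (S (X, B)).2 = (S (X, B)).1 - (S (Z - Y, Y)).1)).1 hPM
  set T := dualityMap f g h with hT
  -- the solutions are parametrized by `(x, y, x', y'')`
  have hTc : Tendsto T (𝓝 p) (𝓝 (T p)) := hp.analyticAt_dualityMap.continuousAt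
  have hT1 : Tendsto (fun q => (T q).1) (𝓝 p) (𝓝 (T p).1) := (continuous_fst.tendsto _).comp hTc
  have hT2 : Tendsto (fun q => (T q).2) (𝓝 p) (𝓝 (T p).2) := (continuous_snd.tendsto _).comp hTc
  let v₀ : 𝕜 × 𝕜 × 𝕜 × 𝕜 := (p.1, p.2, p.1, p.2)
  have c1 : Tendsto (fun v : 𝕜 × 𝕜 × 𝕜 × 𝕜 => (v.1, v.2.1)) (𝓝 v₀) (𝓝 p) := by
    have : Continuous (fun v : 𝕜 × 𝕜 × 𝕜 × 𝕜 => (v.1, v.2.1)) := by fun_prop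
    exact this.tendsto v₀
  have c2 : Tendsto (fun v : 𝕜 × 𝕜 × 𝕜 × 𝕜 => (v.2.2.1, v.2.1)) (𝓝 v₀) (𝓝 p) := by
    have : Continuous (fun v : 𝕜 × 𝕜 × 𝕜 × 𝕜 => (v.2.2.1, v.2.1)) := by fun_prop
    exact this.tendsto v₀
  have c3 : Tendsto (fun v : 𝕜 × 𝕜 × 𝕜 × 𝕜 => (v.1, v.2.2.2)) (𝓝 v₀) (𝓝 p) := by
    have : Continuous (fun v : 𝕜 × 𝕜 × 𝕜 × 𝕜 => (v.1, v.2.2.2)) := by fun_prop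
    exact this.tendsto v₀
  have hgood := hS.eventually_good hp
  -- Choose (A, Y) = T(x, y), (X, Z - X) = T(x', y), (C - B, B) = T(x, y''). The first two points
  -- share y and the first and third share x, so both sides of the first dual equation are zero. The
  -- last clause below is the second dual equation for these values.
  have hev : ∀ᶠ v : 𝕜 × 𝕜 × 𝕜 × 𝕜 in 𝓝 v₀,
      (S (T (v.1, v.2.1)) = (v.1, v.2.1) ∧ S (T (v.2.2.1, v.2.1)) = (v.2.2.1, v.2.1) ∧
        S (T (v.1, v.2.2.2)) = (v.1, v.2.2.2)) ∧
      NondegenerateAt f g h (v.1, v.2.1) ∧ IsLocalInverse T S (v.1, v.2.1) ∧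
      NondegenerateAt f g h (S ((T (v.1, v.2.1)).1, (T (v.1, v.2.2.2)).2)) ∧
      IsLocalInverse T S (S ((T (v.1, v.2.1)).1, (T (v.1, v.2.2.2)).2)) ∧
      T (S ((T (v.1, v.2.1)).1, (T (v.1, v.2.2.2)).2)) =
        ((T (v.1, v.2.1)).1, (T (v.1, v.2.2.2)).2) ∧
      (S ((T (v.1, v.2.1)).1,
          (T (v.1, v.2.2.2)).2 + (T (v.1, v.2.2.2)).1 - (T (v.1, v.2.1)).1)).2 -
        (S ((T (v.2.2.1, v.2.1)).1, (T (v.1, v.2.2.2)).2)).2 =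
      (S ((T (v.2.2.1, v.2.1)).1, (T (v.1, v.2.2.2)).2)).1 -
        (S ((T (v.2.2.1, v.2.1)).1 + (T (v.2.2.1, v.2.1)).2 - (T (v.1, v.2.1)).2,
          (T (v.1, v.2.1)).2)).1 := by
    have hR : Tendsto (fun v : 𝕜 × 𝕜 × 𝕜 × 𝕜 => ((T (v.1, v.2.1)).1, (T (v.1, v.2.2.2)).2))
        (𝓝 v₀) (𝓝 (T p)) := (hT1.comp c1).prodMk_nhds (hT2.comp c3)
    have hZ : Tendsto (fun v : 𝕜 × 𝕜 × 𝕜 × 𝕜 => (T (v.2.2.1, v.2.1)).1 + (T (v.2.2.1, v.2.1)).2)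
      (𝓝 v₀) (𝓝 ((T p).1 + (T p).2)) := (hT1.comp c2).add (hT2.comp c2)
    have hC : Tendsto (fun v : 𝕜 × 𝕜 × 𝕜 × 𝕜 => (T (v.1, v.2.2.2)).2 + (T (v.1, v.2.2.2)).1)
      (𝓝 v₀) (𝓝 ((T p).1 + (T p).2)) := by
        rw [add_comm (T p).1]
        exact (hT2.comp c3).add (hT1.comp c3)
    filter_upwards [c1.eventually hS.2.1, c2.eventually hS.2.1, c3.eventually hS.2.1,
      c1.eventually hp.eventually,
      c1.eventually (hS.eventually hp.analyticAt_dualityMap.continuousAt),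
      hR.eventually hgood,
      (hT1.comp c1).eventually (Metric.ball_mem_nhds _ hε),
      (hT1.comp c2).eventually (Metric.ball_mem_nhds _ hε),
      (hT2.comp c3).eventually (Metric.ball_mem_nhds _ hε),
      (hT2.comp c1).eventually (Metric.ball_mem_nhds _ hε),
      hC.eventually (Metric.ball_mem_nhds _ hε), hZ.eventually (Metric.ball_mem_nhds _ hε)]
      with v e1 e2 e3 n1 i1 hg mA mX mB mY mC mZ
    refine ⟨⟨e1, e2, e3⟩, n1, i1, hg.1, hg.2.1, hg.2.2, ?_⟩
    refine hb _ mA _ mX _ mB _ mY _ mC _ mZ ?_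
    have r2 : ∀ R : 𝕜 × 𝕜, (R.1, R.1 + R.2 - R.1) = R := fun R => by ext <;> simp
    have r3 : ∀ R : 𝕜 × 𝕜, (R.2 + R.1 - R.2, R.2) = R := fun R => by ext <;> simp
    simp only [Function.comp, r2, r3, Prod.mk.eta, e1, e2, e3, sub_self]
  obtain ⟨δ, hδ, hball⟩ := Metric.eventually_nhds_iff_ball.1 hev
  have hmem : ∀ x ∈ Metric.ball p.1 δ, ∀ y ∈ Metric.ball p.2 δ, ∀ x' ∈ Metric.ball p.1 δ,
      ∀ y' ∈ Metric.ball p.2 δ, ((x, y, x', y') : 𝕜 × 𝕜 × 𝕜 × 𝕜) ∈ Metric.ball v₀ δ := by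
    intro x hx y hy x' hx' y' hy'
    simp only [Metric.mem_ball, Prod.dist_eq, max_lt_iff, v₀]
    exact ⟨hx, hy, hx', hy'⟩
  -- the derivative with respect to `x'`
  have key : ∀ x ∈ Metric.ball p.1 δ, ∀ y ∈ Metric.ball p.2 δ, ∀ y' ∈ Metric.ball p.2 δ,
      deriv f (S ((T (x, y)).1, (T (x, y')).2)).1 /
        dualityDet f g h (S ((T (x, y)).1, (T (x, y')).2)) =
      deriv f x / dualityDet f g h (x, y) := by
    intro x hx y hy y' hy'
    obtain ⟨⟨e1, -, -⟩, n1, i1, n2, i2, hR2, -⟩ := hball _ (hmem x hx y hy x hx y' hy')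
    simp only at e1 n1 i1 n2 i2 hR2
    have hm : ∀ᶠ t in 𝓝 x, (S ((T (x, y)).1, (T (x, y')).2 + (T (x, y')).1 - (T (x, y)).1)).2 -
        (S ((T (t, y)).1, (T (x, y')).2)).2 - (S ((T (t, y)).1, (T (x, y')).2)).1 +
        (S ((T (t, y)).1 + (T (t, y)).2 - (T (x, y)).2, (T (x, y)).2)).1 = 0 := by
      filter_upwards [Metric.isOpen_ball.mem_nhds hx] with t ht
      have := (hball _ (hmem x hx y hy t ht y' hy')).2.2.2.2.2.2
      simp only at this
      rw [this]; ring
    have dX : HasDerivAt (fun t => (T (t, y)).1) (deriv h (x + y)) x := by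
      have : HasDerivAt (fun t => h (t + y)) (deriv h (x + y)) x :=
        HasDerivAt.comp_add_const x y n1.h_an.differentiableAt.hasDerivAt
      exact this.const_add (g y)
    have dY : HasDerivAt (fun t => (T (t, y)).2) (-deriv f x - deriv h (x + y)) x := by
      have : HasDerivAt (fun t => h (t + y)) (deriv h (x + y)) x :=
        HasDerivAt.comp_add_const x y n1.h_an.differentiableAt.hasDerivAt
      exact n1.f_an.differentiableAt.hasDerivAt.neg.sub this
    -- In the sum of the two components of S the h'-terms cancel, leaving f'/D at the new point. The
    -- remaining component moves along X + Y, whose derivative is -f', and contributes f'/D at (x,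
    -- y). Both carry the factor h'(x + y).
    obtain ⟨s1, s2⟩ := i2.hasDerivAt_curve n2 dX (hasDerivAt_const x (T (x, y')).2) hR2.symm
    obtain ⟨s3, -⟩ := i1.hasDerivAt_curve n1 ((dX.add dY).sub_const (T (x, y)).2)
      (hasDerivAt_const x (T (x, y)).2) (by ext <;> simp [hT])
    have hd := (((hasDerivAt_const x (S ((T (x, y)).1,
      (T (x, y')).2 + (T (x, y')).1 - (T (x, y)).1)).2).sub s2).sub s1).add s3
    have h0 := hd.unique ((hasDerivAt_const x (0 : 𝕜)).congr_of_eventuallyEq hm)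
    have hw := n1.h_ne
    simp only at hw h0
    have h1 : deriv h (x + y) * (deriv f x / dualityDet f g h (x, y) -
      deriv f (S ((T (x, y)).1, (T (x, y')).2)).1 /
        dualityDet f g h (S ((T (x, y)).1, (T (x, y')).2))) = 0 := by
      rw [← h0]; ring
    exact (sub_eq_zero.1 ((mul_eq_zero.1 h1).resolve_left hw)).symm
  -- the derivative with respect to `y''`
  have hfin : ∀ x ∈ Metric.ball p.1 δ, ∀ y ∈ Metric.ball p.2 δ, DualityPDE f g h (x, y) := by
    intro x hx y hy
    obtain ⟨⟨e1, -, -⟩, n1, i1, -⟩ := hball _ (hmem x hx y hy x hx y hy)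
    simp only at e1 n1 i1
    have dB : HasDerivAt (fun t => (T (x, t)).2) (-deriv h (x + y)) y := by
      have : HasDerivAt (fun t => h (x + t)) (deriv h (x + y)) y :=
        HasDerivAt.comp_const_add x y n1.h_an.differentiableAt.hasDerivAt
      exact (this.const_sub (-f x))
    obtain ⟨s1, s2⟩ := i1.hasDerivAt_curve n1 (hasDerivAt_const y (T (x, y)).1) dB (by simp [hT])
    have hD := (i1.hasFDerivAt n1).1
    obtain ⟨d1, -, -, d4⟩ := hasDerivAt_dualityDet_curve n1 s1 s2 (by simp [e1])
    have hq := d1.div d4 (by simpa [e1] using hD)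
    have hev : (fun t => deriv f (S ((T (x, y)).1, (T (x, t)).2)).1 /
        dualityDet f g h (S ((T (x, y)).1, (T (x, t)).2))) =ᶠ[𝓝 y]
        fun _ => deriv f x / dualityDet f g h (x, y) := by
      filter_upwards [Metric.isOpen_ball.mem_nhds hy] with t ht
      exact key x hx y hy t ht
    have h0 := hq.unique ((hasDerivAt_const y _).congr_of_eventuallyEq hev)
    have hw := n1.h_ne
    simp only [Prod.mk.eta, e1] at h0 hw
    have hDe : dualityDet f g h (x, y) = deriv f x * deriv g y + deriv f x * deriv h (x + y) +
      deriv g y * deriv h (x + y) := rfl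
    rw [div_eq_zero_iff] at h0
    have h1 := h0.resolve_right (pow_ne_zero 2 hD)
    simp only [DualityPDE]
    field_simp at h1
    have h2 : deriv h (x + y) * ((deriv f x + deriv g y) * deriv f x * deriv g y *
        deriv (deriv h) (x + y) - ((deriv g y + deriv h (x + y)) * deriv g y * deriv h (x + y) *
      deriv (deriv f) x + (deriv f x + deriv h (x + y)) * deriv f x * deriv h (x + y) *
      deriv (deriv g) y)) = 0 := by
      rw [hDe] at h1
      linear_combination (-1 : 𝕜) * h1
    exact sub_eq_zero.1 ((mul_eq_zero.1 h2).resolve_left hw)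
  rw [show p = (p.1, p.2) from rfl, nhds_prod_eq]
  filter_upwards [Filter.prod_mem_prod (Metric.ball_mem_nhds p.1 hδ)
    (Metric.ball_mem_nhds p.2 hδ)] with q hq
  exact hfin q.1 hq.1 q.2 hq.2

end DualCoefficients

/-! ### Sufficiency: separation of the inverse mapping and existence of a dual lattice. -/

section DualLattice

variable {𝕜 : Type*} [RCLike 𝕜] {f g h : 𝕜 → 𝕜} {S : 𝕜 × 𝕜 → 𝕜 × 𝕜} {p : 𝕜 × 𝕜}

/-- The differential condition makes the three coefficients `f'/D`, `g'/D`, `h'/D` depend on `X`,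
`Y`, `X + Y` only. -/
theorem IsLocalInverse.hasDerivAt_coefficients {R : 𝕜 × 𝕜} (hp : NondegenerateAt f g h (S R))
    (hS : IsLocalInverse (dualityMap f g h) S (S R)) (hR : dualityMap f g h (S R) = R)
    (hE : DualityPDE f g h (S R)) :
    HasDerivAt (fun t => deriv f (S (R.1, t)).1 / dualityDet f g h (S (R.1, t))) 0 R.2 ∧
    HasDerivAt (fun t => deriv g (S (t, R.2)).2 / dualityDet f g h (S (t, R.2))) 0 R.1 ∧
    HasDerivAt (fun t => deriv h ((S (t, R.1 + R.2 - t)).1 + (S (t, R.1 + R.2 - t)).2) /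
      dualityDet f g h (S (t, R.1 + R.2 - t))) 0 R.1 := by
  have hD := (hS.hasFDerivAt hp).1
  have hDe : dualityDet f g h (S R) = deriv f (S R).1 * deriv g (S R).2 +
    deriv f (S R).1 * deriv h ((S R).1 + (S R).2) +
      deriv g (S R).2 * deriv h ((S R).1 + (S R).2) := rfl
  have hE' := hE
  rw [DualityPDE] at hE'
  have hRR : (R.1, R.1 + R.2 - R.1) = R := by ext <;> simp
  refine ⟨?_, ?_, ?_⟩
  · obtain ⟨s1, s2⟩ := hS.hasDerivAt_curve hp (hasDerivAt_const R.2 R.1) (hasDerivAt_id R.2) hR.symm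
    obtain ⟨d1, -, -, d4⟩ := hasDerivAt_dualityDet_curve hp s1 s2 rfl
    refine (d1.div d4 (by simpa using hD)).congr_deriv ?_
    simp only [id, Prod.mk.eta] at hD ⊢
    rw [div_eq_zero_iff]
    left
    field_simp
    rw [hDe]
    linear_combination hE'
  · obtain ⟨s1, s2⟩ := hS.hasDerivAt_curve hp (hasDerivAt_id R.1) (hasDerivAt_const R.1 R.2) hR.symm
    obtain ⟨-, d2, -, d4⟩ := hasDerivAt_dualityDet_curve hp s1 s2 rfl
    refine (d2.div d4 (by simpa using hD)).congr_deriv ?_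
    simp only [id, Prod.mk.eta] at hD ⊢
    rw [div_eq_zero_iff]
    left
    field_simp
    rw [hDe]
    linear_combination (-1 : 𝕜) * hE'
  · obtain ⟨s1, s2⟩ := hS.hasDerivAt_curve hp (hasDerivAt_id R.1)
      ((hasDerivAt_id R.1).const_sub (R.1 + R.2)) (by simp [hR])
    obtain ⟨-, -, d3, d4⟩ := hasDerivAt_dualityDet_curve hp s1 s2 (by simp)
    refine (d3.div d4 (by simpa using hD)).congr_deriv ?_
    simp only [id, hRR] at hD ⊢
    rw [div_eq_zero_iff]
    left
    field_simp
    rw [hDe]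
    linear_combination hE'

/-- Under the differential condition the inverse of the duality mapping has the same form as the
duality mapping itself. -/
theorem IsLocalInverse.exists_separation (hp : NondegenerateAt f g h p)
    (hS : IsLocalInverse (dualityMap f g h) S p) (hE : ∀ᶠ q in 𝓝 p, DualityPDE f g h q) :
    ∃ F G H : 𝕜 → 𝕜, AnalyticAt 𝕜 F (dualityMap f g h p).1 ∧
      AnalyticAt 𝕜 G (dualityMap f g h p).2 ∧
      AnalyticAt 𝕜 H ((dualityMap f g h p).1 + (dualityMap f g h p).2) ∧
      ∃ c : 𝕜 × 𝕜, ∀ᶠ R in 𝓝 (dualityMap f g h p),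
        NondegenerateAt f g h (S R) ∧ IsLocalInverse (dualityMap f g h) S (S R) ∧
        dualityMap f g h (S R) = R ∧
        S R = (c.1 - G R.2 - H (R.1 + R.2), c.2 + F R.1 + H (R.1 + R.2)) ∧
        HasDerivAt F (deriv f (S R).1 / dualityDet f g h (S R)) R.1 ∧
        HasDerivAt G (deriv g (S R).2 / dualityDet f g h (S R)) R.2 ∧
        HasDerivAt H (deriv h ((S R).1 + (S R).2) / dualityDet f g h (S R)) (R.1 + R.2) := by
  set R₀ := dualityMap f g h p with hR₀
  have hc : Tendsto S (𝓝 R₀) (𝓝 p) := by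
    have := hS.1.continuousAt.tendsto
    rwa [hS.2.1.self_of_nhds] at this
  obtain ⟨ε, hε, hb⟩ := Metric.eventually_nhds_iff_ball.1
    ((hS.eventually_good hp).and (hc.eventually hE))
  rw [← hR₀] at hb
  have hmem : ∀ {X Y : 𝕜}, X ∈ Metric.ball R₀.1 ε → Y ∈ Metric.ball R₀.2 ε →
      (X, Y) ∈ Metric.ball R₀ ε := by
    intro X Y hX hY
    simp only [Metric.mem_ball, Prod.dist_eq, max_lt_iff]
    exact ⟨hX, hY⟩
  have h1 : ∀ X ∈ Metric.ball R₀.1 ε, ∀ Y ∈ Metric.ball R₀.2 ε,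
      deriv f (S (X, Y)).1 / dualityDet f g h (S (X, Y)) =
        deriv f (S (X, R₀.2)).1 / dualityDet f g h (S (X, R₀.2)) := by
    intro X hX Y hY
    refine eq_of_hasDerivAt_zero_ball (𝕜 := 𝕜)
      (y := fun t => deriv f (S (X, t)).1 / dualityDet f g h (S (X, t))) (fun t ht => ?_) hY
      (Metric.mem_ball_self hε)
    obtain ⟨⟨n, i, e⟩, q⟩ := hb _ (hmem hX ht)
    exact (i.hasDerivAt_coefficients n e q).1
  have h2 : ∀ X ∈ Metric.ball R₀.1 ε, ∀ Y ∈ Metric.ball R₀.2 ε,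
      deriv g (S (X, Y)).2 / dualityDet f g h (S (X, Y)) =
        deriv g (S (R₀.1, Y)).2 / dualityDet f g h (S (R₀.1, Y)) := by
    intro X hX Y hY
    refine eq_of_hasDerivAt_zero_ball (𝕜 := 𝕜)
      (y := fun t => deriv g (S (t, Y)).2 / dualityDet f g h (S (t, Y))) (fun t ht => ?_) hX
      (Metric.mem_ball_self hε)
    obtain ⟨⟨n, i, e⟩, q⟩ := hb _ (hmem ht hY)
    exact (i.hasDerivAt_coefficients n e q).2.1
  -- h'/D is constant along the lines X + Y = const. The radius ε / 3 keeps the segment from X to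
  -- the base point on such a line inside the ball of radius ε.
  have h3 : ∀ X ∈ Metric.ball R₀.1 (ε / 3), ∀ Y ∈ Metric.ball R₀.2 (ε / 3),
      deriv h ((S (X, Y)).1 + (S (X, Y)).2) / dualityDet f g h (S (X, Y)) =
        deriv h ((S (R₀.1, X + Y - R₀.1)).1 + (S (R₀.1, X + Y - R₀.1)).2) /
          dualityDet f g h (S (R₀.1, X + Y - R₀.1)) := by
    intro X hX Y hY
    have := eq_of_hasDerivAt_zero_ball (𝕜 := 𝕜)
      (y := fun t => deriv h ((S (t, X + Y - t)).1 + (S (t, X + Y - t)).2) /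
        dualityDet f g h (S (t, X + Y - t))) (c := R₀.1) (r := ε / 3) (fun t ht => ?_) hX
      (Metric.mem_ball_self (by positivity))
    · simpa using this
    · have ht' : (t, X + Y - t) ∈ Metric.ball R₀ ε := by
        refine hmem (Metric.ball_subset_ball (by linarith) ht) ?_
        simp only [Metric.mem_ball, dist_eq_norm] at *
        calc ‖X + Y - t - R₀.2‖ = ‖(X - R₀.1) + (Y - R₀.2) - (t - R₀.1)‖ := by congr 1; ring
          _ ≤ ‖X - R₀.1‖ + ‖Y - R₀.2‖ + ‖t - R₀.1‖ :=
            (norm_sub_le _ _).trans (add_le_add_left (norm_add_le _ _) _)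
          _ < ε := by linarith
      obtain ⟨⟨n, i, e⟩, q⟩ := hb _ ht'
      have := (i.hasDerivAt_coefficients n e q).2.2
      simpa using this
  have hbase : R₀.1 ∈ Metric.ball R₀.1 ε ∧ R₀.2 ∈ Metric.ball R₀.2 ε :=
    ⟨Metric.mem_ball_self hε, Metric.mem_ball_self hε⟩
  have an1 : AnalyticAt 𝕜 (fun R => (S R).1) R₀ :=
    AnalyticAt.fun_comp (f := S) (g := Prod.fst) analyticAt_fst hS.1
  have an2 : AnalyticAt 𝕜 (fun R => (S R).2) R₀ :=
    AnalyticAt.fun_comp (f := S) (g := Prod.snd) analyticAt_snd hS.1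
  -- The choices come from the derivative of S: the X-derivative of S₁ + S₂ is f'/D, its
  -- Y-derivative is -g'/D, and the Y-derivative of S₂ is h'/D.
  let F : 𝕜 → 𝕜 := fun X => (S (X, R₀.2)).1 + (S (X, R₀.2)).2
  let G : 𝕜 → 𝕜 := fun Y => -((S (R₀.1, Y)).1 + (S (R₀.1, Y)).2)
  let H : 𝕜 → 𝕜 := fun Z => (S (R₀.1, Z - R₀.1)).2
  have hF : ∀ X ∈ Metric.ball R₀.1 ε, HasDerivAt F
      (deriv f (S (X, R₀.2)).1 / dualityDet f g h (S (X, R₀.2))) X := by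
    intro X hX
    obtain ⟨⟨n, i, e⟩, q⟩ := hb _ (hmem hX hbase.2)
    obtain ⟨s1, s2⟩ := i.hasDerivAt_curve n (hasDerivAt_id X) (hasDerivAt_const X R₀.2) e.symm
    refine (s1.add s2).congr_deriv ?_
    ring
  have hG : ∀ Y ∈ Metric.ball R₀.2 ε, HasDerivAt G
      (deriv g (S (R₀.1, Y)).2 / dualityDet f g h (S (R₀.1, Y))) Y := by
    intro Y hY
    obtain ⟨⟨n, i, e⟩, q⟩ := hb _ (hmem hbase.1 hY)
    obtain ⟨s1, s2⟩ := i.hasDerivAt_curve n (hasDerivAt_const Y R₀.1) (hasDerivAt_id Y) e.symm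
    refine (s1.add s2).neg.congr_deriv ?_
    ring
  have hH : ∀ Y ∈ Metric.ball R₀.2 ε, HasDerivAt H
      (deriv h ((S (R₀.1, Y)).1 + (S (R₀.1, Y)).2) / dualityDet f g h (S (R₀.1, Y)))
      (R₀.1 + Y) := by
    intro Y hY
    obtain ⟨⟨n, i, e⟩, q⟩ := hb _ (hmem hbase.1 hY)
    obtain ⟨-, s2⟩ := i.hasDerivAt_curve n (hasDerivAt_const (R₀.1 + Y) R₀.1)
      ((hasDerivAt_id (R₀.1 + Y)).sub_const R₀.1) (by simp [e])
    refine s2.congr_deriv ?_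
    ring
  have hder : ∀ R ∈ Metric.ball R₀ (ε / 3),
      HasDerivAt F (deriv f (S R).1 / dualityDet f g h (S R)) R.1 ∧
      HasDerivAt G (deriv g (S R).2 / dualityDet f g h (S R)) R.2 ∧
      HasDerivAt H (deriv h ((S R).1 + (S R).2) / dualityDet f g h (S R)) (R.1 + R.2) := by
    intro R hR
    have hR' : R.1 ∈ Metric.ball R₀.1 (ε / 3) ∧ R.2 ∈ Metric.ball R₀.2 (ε / 3) := by
      simpa only [Metric.mem_ball, Prod.dist_eq, max_lt_iff] using hR
    have hR1 : R.1 ∈ Metric.ball R₀.1 ε := Metric.ball_subset_ball (by linarith) hR'.1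
    have hR2 : R.2 ∈ Metric.ball R₀.2 ε := Metric.ball_subset_ball (by linarith) hR'.2
    have hR3 : R.1 + R.2 - R₀.1 ∈ Metric.ball R₀.2 ε := by
      simp only [Metric.mem_ball, dist_eq_norm] at *
      calc ‖R.1 + R.2 - R₀.1 - R₀.2‖ = ‖(R.1 - R₀.1) + (R.2 - R₀.2)‖ := by congr 1; ring
        _ ≤ ‖R.1 - R₀.1‖ + ‖R.2 - R₀.2‖ := norm_add_le _ _
        _ < ε := by linarith
    refine ⟨?_, ?_, ?_⟩
    · rw [h1 R.1 hR1 R.2 hR2]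
      exact hF _ hR1
    · rw [h2 R.1 hR1 R.2 hR2]
      exact hG _ hR2
    · rw [h3 R.1 hR'.1 R.2 hR'.2]
      have := hH _ hR3
      rwa [add_sub_cancel] at this
  -- The gradient of S₁ is (-h'/D, -(g' + h')/D) and that of S₂ is ((f' + h')/D, h'/D), exactly what
  -- G, H and F, H compensate.
  have hfd : ∀ R ∈ Metric.ball R₀ (ε / 3),
      HasFDerivAt (fun R => (S R).1 + G R.2 + H (R.1 + R.2)) (0 : 𝕜 × 𝕜 →L[𝕜] 𝕜) R ∧
      HasFDerivAt (fun R => (S R).2 - F R.1 - H (R.1 + R.2)) (0 : 𝕜 × 𝕜 →L[𝕜] 𝕜) R := by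
    intro R hR
    obtain ⟨⟨n, i, e⟩, q⟩ := hb _ (Metric.ball_subset_ball (by linarith) hR)
    obtain ⟨d1, d2, d3⟩ := hder R hR
    obtain ⟨-, f1, f2⟩ := i.hasFDerivAt n
    rw [e] at f1 f2
    have k1 := d1.comp_hasFDerivAt R (hasFDerivAt_fst (𝕜 := 𝕜) (p := R))
    have k2 := d2.comp_hasFDerivAt R (hasFDerivAt_snd (𝕜 := 𝕜) (p := R))
    have k3 := d3.comp_hasFDerivAt R
      ((hasFDerivAt_fst (𝕜 := 𝕜) (p := R)).add hasFDerivAt_snd)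
    constructor
    · refine ((f1.add k2).add k3).congr_fderiv ?_
      ext <;> simp <;> ring
    · refine ((f2.sub k1).sub k3).congr_fderiv ?_
      ext <;> simp <;> ring
  have hε3 : 0 < ε / 3 := by positivity
  refine ⟨F, G, H, ?_, ?_, ?_,
    ((S R₀).1 + G R₀.2 + H (R₀.1 + R₀.2), (S R₀).2 - F R₀.1 - H (R₀.1 + R₀.2)), ?_⟩
  · have hl : AnalyticAt 𝕜 (fun X : 𝕜 => (X, R₀.2)) R₀.1 := analyticAt_id.prod analyticAt_const
    exact (AnalyticAt.fun_comp (f := fun X : 𝕜 => (X, R₀.2)) an1 hl).add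
      (AnalyticAt.fun_comp (f := fun X : 𝕜 => (X, R₀.2)) an2 hl)
  · have hl : AnalyticAt 𝕜 (fun Y : 𝕜 => (R₀.1, Y)) R₀.2 := analyticAt_const.prod analyticAt_id
    exact ((AnalyticAt.fun_comp (f := fun Y : 𝕜 => (R₀.1, Y)) an1 hl).add
      (AnalyticAt.fun_comp (f := fun Y : 𝕜 => (R₀.1, Y)) an2 hl)).neg
  · have hl : AnalyticAt 𝕜 (fun Z : 𝕜 => (R₀.1, Z - R₀.1)) (R₀.1 + R₀.2) :=
      analyticAt_const.prod (analyticAt_id.sub analyticAt_const)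
    have he : (R₀.1, R₀.1 + R₀.2 - R₀.1) = R₀ := by ext <;> simp
    exact AnalyticAt.fun_comp_of_eq (f := fun Z : 𝕜 => (R₀.1, Z - R₀.1)) an2 hl he
  · filter_upwards [Metric.ball_mem_nhds R₀ hε3] with R hR
    obtain ⟨⟨n, i, e⟩, q⟩ := hb _ (Metric.ball_subset_ball (by linarith) hR)
    have e1 := eq_of_hasFDerivAt_zero_ball (𝕜 := 𝕜) (fun R hR => (hfd R hR).1)
      (Metric.mem_ball_self hε3) hR
    have e2 := eq_of_hasFDerivAt_zero_ball (𝕜 := 𝕜) (fun R hR => (hfd R hR).2)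
      (Metric.mem_ball_self hε3) hR
    refine ⟨n, i, e, ?_, hder R hR⟩
    ext
    · simp only [e1]; ring
    · simp only [e2]; ring

/-- If the inverse of the duality mapping is separated, then both dual equations are the lattice
equation. -/
theorem eventually_dual_iff {R₀ c : 𝕜 × 𝕜} {F G H : 𝕜 → 𝕜}
    (hsep : ∀ᶠ R in 𝓝 R₀,
      S R = (c.1 - G R.2 - H (R.1 + R.2), c.2 + F R.1 + H (R.1 + R.2))) :
    ∀ᶠ Q in 𝓝 (linearConfig R₀.1 R₀.2), (EqPlus S Q 0 0 ↔ LatticeEq F G H Q 0 0) ∧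
      (EqMinus S Q 0 0 ↔ LatticeEq F G H Q 0 0) := by
  simp only [eqPlus_iff, eqMinus_iff, latticeEq_iff]
  obtain ⟨ε, hε, hb⟩ := Metric.eventually_nhds_iff_ball.1 hsep
  refine (eventually_linearConfig_iff _ _ (fun A X B Y C Z =>
    ((S (A, Y)).2 - (S (X, Z - X)).2 = (S (C - B, B)).1 - (S (A, Y)).1 ↔
      (F A - F X) + (G B - G Y) + (H C - H Z) = 0) ∧
    ((S (A, C - A)).2 - (S (X, B)).2 = (S (X, B)).1 - (S (Z - Y, Y)).1 ↔
      (F A - F X) + (G B - G Y) + (H C - H Z) = 0))).2 ⟨ε / 2, by positivity, ?_⟩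
  intro A hA X hX B hB Y hY C hC Z hZ
  have hm : ∀ {X Y : 𝕜}, ‖X - R₀.1‖ < ε → ‖Y - R₀.2‖ < ε →
      S (X, Y) = (c.1 - G Y - H (X + Y), c.2 + F X + H (X + Y)) := by
    intro X Y hX hY
    refine hb (X, Y) ?_
    simp only [Metric.mem_ball, Prod.dist_eq, max_lt_iff]
    exact ⟨by rwa [dist_eq_norm], by rwa [dist_eq_norm]⟩
  simp only [Metric.mem_ball, dist_eq_norm] at hA hX hB hY hC hZ
  have h1 : ∀ {Z X : 𝕜}, ‖Z - (R₀.1 + R₀.2)‖ < ε / 2 → ‖X - R₀.1‖ < ε / 2 →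
      ‖Z - X - R₀.2‖ < ε := by
    intro Z X hZ hX
    calc ‖Z - X - R₀.2‖ = ‖(Z - (R₀.1 + R₀.2)) - (X - R₀.1)‖ := by congr 1; ring
      _ ≤ ‖Z - (R₀.1 + R₀.2)‖ + ‖X - R₀.1‖ := norm_sub_le _ _
      _ < ε := by linarith
  have h2 : ∀ {Z Y : 𝕜}, ‖Z - (R₀.1 + R₀.2)‖ < ε / 2 → ‖Y - R₀.2‖ < ε / 2 →
      ‖Z - Y - R₀.1‖ < ε := by
    intro Z Y hZ hY
    calc ‖Z - Y - R₀.1‖ = ‖(Z - (R₀.1 + R₀.2)) - (Y - R₀.2)‖ := by congr 1; ring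
      _ ≤ ‖Z - (R₀.1 + R₀.2)‖ + ‖Y - R₀.2‖ := norm_sub_le _ _
      _ < ε := by linarith
  rw [hm (by linarith) (by linarith : ‖Y - R₀.2‖ < ε), hm (by linarith) (h1 hZ hX),
    hm (h2 hC hB) (by linarith), hm (by linarith) (h1 hC hA), hm (by linarith) (by linarith),
    hm (h2 hZ hY) (by linarith)]
  -- In the first equation the terms H(A + Y) on the two sides cancel, in the second the terms H(X +
  -- B). What remains is in both cases the lattice equation.
  simp only [add_sub_cancel, sub_add_cancel]
  constructor
  · rw [← sub_eq_zero]
    refine Eq.congr ?_ rfl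
    ring
  · rw [← sub_eq_zero]
    refine Eq.congr ?_ rfl
    ring

end DualLattice

/-! ### Characterization of duality by the differential condition; uniqueness of the dual lattice.
-/

section DualLattice

variable {𝕜 : Type*} [RCLike 𝕜] {f g h : 𝕜 → 𝕜} {p : 𝕜 × 𝕜}

theorem exists_isDualLattice (hp : NondegenerateAt f g h p)
    (hT : DualityMapInvertible f g h p.1 p.2) (hE : ∀ᶠ q in 𝓝 p, DualityPDE f g h q) :
    ∃ F G H : 𝕜 → 𝕜, IsDualLattice f g h p.1 p.2 F G H := by
  obtain ⟨S, hS⟩ := hT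
  obtain ⟨F, G, H, hF, hG, hH, c, hsep⟩ := IsLocalInverse.exists_separation hp hS hE
  exact ⟨F, G, H, hF, hG, hH, S, hS, eventually_dual_iff (hsep.mono fun R hR => hR.2.2.2.1)⟩

theorem IsDualLattice.admitsDuality {F G H : 𝕜 → 𝕜} (hd : IsDualLattice f g h p.1 p.2 F G H) :
    AdmitsDuality f g h p.1 p.2 := by
  obtain ⟨-, -, -, S, hS, hQ⟩ := hd
  exact ⟨S, hS, hQ.mono fun Q hQ => hQ.1.trans hQ.2.symm⟩

theorem AdmitsDuality.eventually_dualityPDE (hp : NondegenerateAt f g h p)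
    (hd : AdmitsDuality f g h p.1 p.2) : ∀ᶠ q in 𝓝 p, DualityPDE f g h q := by
  obtain ⟨S, hS, hQ⟩ := hd
  exact _root_.eventually_dualityPDE hp hS (hQ.mono fun Q hQ => hQ.1)

/-- Sufficiency goes through the dual lattice: two equations that are both equivalent to a third are
equivalent to each other. -/
theorem admitsDuality_iff (hp : NondegenerateAt f g h p) :
    AdmitsDuality f g h p.1 p.2 ↔
      DualityMapInvertible f g h p.1 p.2 ∧ ∀ᶠ q in 𝓝 p, DualityPDE f g h q := by
  constructor
  · intro hd
    refine ⟨?_, hd.eventually_dualityPDE hp⟩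
    obtain ⟨S, hS, -⟩ := hd
    exact ⟨S, hS⟩
  · rintro ⟨hT, hE⟩
    obtain ⟨F, G, H, hd⟩ := exists_isDualLattice hp hT hE
    exact hd.admitsDuality

/-- If `F(A) + G(B)` is stationary on a level line of `F₀(A) + G₀(B)`, then the derivatives are
proportional. -/
theorem deriv_mul_deriv_eq {F₀ G₀ F G : 𝕜 → 𝕜} {A B : 𝕜} (hF₀ : AnalyticAt 𝕜 F₀ A)
    (hG₀ : AnalyticAt 𝕜 G₀ B) (hF : DifferentiableAt 𝕜 F A) (hG : DifferentiableAt 𝕜 G B)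
    (hF' : deriv F₀ A ≠ 0) (hG' : deriv G₀ B ≠ 0)
    (h : ∀ᶠ q : 𝕜 × 𝕜 in 𝓝 (A, B), (F₀ q.1 - F₀ A) + (G₀ q.2 - G₀ B) = 0 →
      (F q.1 - F A) + (G q.2 - G B) = 0) :
    deriv F A / deriv F₀ A = deriv G B / deriv G₀ B := by
  have i1 := hF₀.hasStrictDerivAt
  have i2 := hG₀.hasStrictDerivAt
  set a := i1.localInverse F₀ _ A hF' with ha
  set b := i2.localInverse G₀ _ B hG' with hb
  have da : HasDerivAt a (deriv F₀ A)⁻¹ (F₀ A) := (i1.to_localInverse hF').hasDerivAt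
  have db : HasDerivAt b (deriv G₀ B)⁻¹ (G₀ B) := (i2.to_localInverse hG').hasDerivAt
  have ea : ∀ᶠ s in 𝓝 (F₀ A), F₀ (a s) = s :=
    (i1.hasStrictFDerivAt_equiv hF').eventually_right_inverse
  have eb : ∀ᶠ s in 𝓝 (G₀ B), G₀ (b s) = s :=
    (i2.hasStrictFDerivAt_equiv hG').eventually_right_inverse
  have ea' : a (F₀ A) = A := (i1.hasStrictFDerivAt_equiv hF').localInverse_apply_image
  have eb' : b (G₀ B) = B := (i2.hasStrictFDerivAt_equiv hG').localInverse_apply_image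
  -- The level line is parametrized by letting F₀ increase by t and G₀ decrease by t, by means of
  -- the local inverses.
  have ca : HasDerivAt (fun t => a (F₀ A + t)) (deriv F₀ A)⁻¹ 0 :=
    HasDerivAt.comp_const_add (F₀ A) 0 (by simpa using da)
  have cb : HasDerivAt (fun t => b (G₀ B - t)) (-(deriv G₀ B)⁻¹) 0 :=
    HasDerivAt.comp_const_sub (G₀ B) 0 (by simpa using db)
  have dF : HasDerivAt (fun t => F (a (F₀ A + t))) (deriv F A * (deriv F₀ A)⁻¹) 0 :=
    HasDerivAt.comp_of_eq 0 hF.hasDerivAt ca (by simp [ea'])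
  have dG : HasDerivAt (fun t => G (b (G₀ B - t))) (deriv G B * -(deriv G₀ B)⁻¹) 0 :=
    HasDerivAt.comp_of_eq 0 hG.hasDerivAt cb (by simp [eb'])
  have hc : Tendsto (fun t : 𝕜 => (a (F₀ A + t), b (G₀ B - t))) (𝓝 0) (𝓝 (A, B)) := by
    have h1 := ca.continuousAt.tendsto
    have h2 := cb.continuousAt.tendsto
    simp only [add_zero, sub_zero, ea', eb'] at h1 h2
    exact h1.prodMk_nhds h2
  have t1 : Tendsto (fun t : 𝕜 => F₀ A + t) (𝓝 0) (𝓝 (F₀ A)) := by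
    have : Continuous fun t : 𝕜 => F₀ A + t := by fun_prop
    simpa using this.tendsto 0
  have t2 : Tendsto (fun t : 𝕜 => G₀ B - t) (𝓝 0) (𝓝 (G₀ B)) := by
    have : Continuous fun t : 𝕜 => G₀ B - t := by fun_prop
    simpa using this.tendsto 0
  have hz : (fun t => (F (a (F₀ A + t)) - F A) + (G (b (G₀ B - t)) - G B)) =ᶠ[𝓝 0]
      fun _ => 0 := by
    filter_upwards [hc.eventually h, t1.eventually ea, t2.eventually eb] with t ht e1 e2
    refine ht ?_
    simp only [e1, e2]
    ring
  have := ((dF.sub_const (F A)).add (dG.sub_const (G B))).unique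
    ((hasDerivAt_const 0 (0 : 𝕜)).congr_of_eventuallyEq hz)
  rw [div_eq_mul_inv, div_eq_mul_inv]
  linear_combination this

/-- The functions of a dual lattice are determined up to a common factor and additive
constants. -/
theorem IsDualLattice.exists_hasDerivAt {F G H : 𝕜 → 𝕜} (hp : NondegenerateAt f g h p)
    (hd : IsDualLattice f g h p.1 p.2 F G H) :
    ∃ (ρ : 𝕜) (S : 𝕜 × 𝕜 → 𝕜 × 𝕜), ρ ≠ 0 ∧ IsLocalInverse (dualityMap f g h) S p ∧
      ∀ᶠ R in 𝓝 (dualityMap f g h p),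
        NondegenerateAt f g h (S R) ∧ dualityDet f g h (S R) ≠ 0 ∧ dualityMap f g h (S R) = R ∧
        HasDerivAt F (ρ * (deriv f (S R).1 / dualityDet f g h (S R))) R.1 ∧
        HasDerivAt G (ρ * (deriv g (S R).2 / dualityDet f g h (S R))) R.2 ∧
        HasDerivAt H (ρ * (deriv h ((S R).1 + (S R).2) / dualityDet f g h (S R))) (R.1 + R.2) := by
  have hE := hd.admitsDuality.eventually_dualityPDE hp
  obtain ⟨hF, hG, hH, S, hS, hQ⟩ := hd
  obtain ⟨F₀, G₀, H₀, hF₀, hG₀, hH₀, c, hsep⟩ := IsLocalInverse.exists_separation hp hS hE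
  have hQ₀ := eventually_dual_iff (hsep.mono fun R hR => hR.2.2.2.1)
  set R₀ := dualityMap f g h p
  have hLL : ∀ᶠ Q in 𝓝 (linearConfig R₀.1 R₀.2),
      (LatticeEq F₀ G₀ H₀ Q 0 0 ↔ LatticeEq F G H Q 0 0) := by
    filter_upwards [hQ, hQ₀] with Q h1 h2
    exact h2.1.symm.trans h1.1
  simp only [latticeEq_iff] at hLL
  obtain ⟨ε₁, hε₁, hb⟩ := (eventually_linearConfig_iff _ _ (fun A X B Y C Z =>
    (F₀ A - F₀ X) + (G₀ B - G₀ Y) + (H₀ C - H₀ Z) = 0 ↔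
    (F A - F X) + (G B - G Y) + (H C - H Z) = 0)).1 hLL
  have t1 : Tendsto (fun R : 𝕜 × 𝕜 => R.1) (𝓝 R₀) (𝓝 R₀.1) := continuous_fst.tendsto _
  have t2 : Tendsto (fun R : 𝕜 × 𝕜 => R.2) (𝓝 R₀) (𝓝 R₀.2) := continuous_snd.tendsto _
  have t3 : Tendsto (fun R : 𝕜 × 𝕜 => R.1 + R.2) (𝓝 R₀) (𝓝 (R₀.1 + R₀.2)) := t1.add t2
  have hall : ∀ᶠ R in 𝓝 R₀,
      (NondegenerateAt f g h (S R) ∧ dualityDet f g h (S R) ≠ 0 ∧ dualityMap f g h (S R) = R) ∧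
      (HasDerivAt F₀ (deriv f (S R).1 / dualityDet f g h (S R)) R.1 ∧
      HasDerivAt G₀ (deriv g (S R).2 / dualityDet f g h (S R)) R.2 ∧
      HasDerivAt H₀ (deriv h ((S R).1 + (S R).2) / dualityDet f g h (S R)) (R.1 + R.2)) ∧
      (AnalyticAt 𝕜 F₀ R.1 ∧ AnalyticAt 𝕜 G₀ R.2 ∧ AnalyticAt 𝕜 H₀ (R.1 + R.2)) ∧
      (AnalyticAt 𝕜 F R.1 ∧ AnalyticAt 𝕜 G R.2 ∧ AnalyticAt 𝕜 H (R.1 + R.2)) ∧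
      R.1 ∈ Metric.ball R₀.1 ε₁ ∧ R.2 ∈ Metric.ball R₀.2 ε₁ ∧
        R.1 + R.2 ∈ Metric.ball (R₀.1 + R₀.2) ε₁ := by
    filter_upwards [hsep, t1.eventually hF₀.eventually_analyticAt,
      t2.eventually hG₀.eventually_analyticAt, t3.eventually hH₀.eventually_analyticAt,
      t1.eventually hF.eventually_analyticAt, t2.eventually hG.eventually_analyticAt,
      t3.eventually hH.eventually_analyticAt, t1.eventually (Metric.ball_mem_nhds _ hε₁),
      t2.eventually (Metric.ball_mem_nhds _ hε₁), t3.eventually (Metric.ball_mem_nhds _ hε₁)]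
      with R hR a1 a2 a3 a4 a5 a6 m1 m2 m3
    obtain ⟨n, i, e, -, d⟩ := hR
    exact ⟨⟨n, (i.hasFDerivAt n).1, e⟩, d, ⟨a1, a2, a3⟩, ⟨a4, a5, a6⟩, m1, m2, m3⟩
  obtain ⟨ε, hε, hball⟩ := Metric.eventually_nhds_iff_ball.1 hall
  have hmem : ∀ {X Y : 𝕜}, X ∈ Metric.ball R₀.1 ε → Y ∈ Metric.ball R₀.2 ε →
      (X, Y) ∈ Metric.ball R₀ ε := by
    intro X Y hX hY
    simp only [Metric.mem_ball, Prod.dist_eq, max_lt_iff]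
    exact ⟨hX, hY⟩
  -- Only the arguments A and B are varied. With C = Z the terms of H drop out, so the two equations
  -- compare level lines in the (A, B)-plane. The two sides of the ratio depend on independent
  -- points, hence are constant.
  have ratio : ∀ R ∈ Metric.ball R₀ ε, ∀ R' ∈ Metric.ball R₀ ε,
      deriv F R.1 / deriv F₀ R.1 = deriv G R'.2 / deriv G₀ R'.2 := by
    intro R hR R' hR'
    obtain ⟨⟨n, D, -⟩, ⟨d1, -, -⟩, ⟨a1, -, -⟩, ⟨b1, -, -⟩, m1, -, m3⟩ := hball R hR
    obtain ⟨⟨n', D', -⟩, ⟨-, d2, -⟩, ⟨-, a2, -⟩, ⟨-, b2, -⟩, -, m2, -⟩ := hball R' hR'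
    refine deriv_mul_deriv_eq a1 a2 b1.differentiableAt b2.differentiableAt ?_ ?_ ?_
    · rw [d1.deriv]; exact div_ne_zero n.f_ne D
    · rw [d2.deriv]; exact div_ne_zero n'.g_ne D'
    · have hn : Metric.ball R₀.1 ε₁ ×ˢ Metric.ball R₀.2 ε₁ ∈ 𝓝 (R.1, R'.2) :=
        prod_mem_nhds (Metric.isOpen_ball.mem_nhds m1) (Metric.isOpen_ball.mem_nhds m2)
      filter_upwards [hn] with q hq h0
      have := (hb q.1 hq.1 R.1 m1 q.2 hq.2 R'.2 m2 _ m3 _ m3).1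
      simp only [sub_self, add_zero] at this
      exact this h0
  have ratio' : ∀ R ∈ Metric.ball R₀ ε, ∀ R' ∈ Metric.ball R₀ ε,
      deriv F R.1 / deriv F₀ R.1 = deriv H (R'.1 + R'.2) / deriv H₀ (R'.1 + R'.2) := by
    intro R hR R' hR'
    obtain ⟨⟨n, D, -⟩, ⟨d1, -, -⟩, ⟨a1, -, -⟩, ⟨b1, -, -⟩, m1, m2, -⟩ := hball R hR
    obtain ⟨⟨n', D', -⟩, ⟨-, -, d3⟩, ⟨-, -, a3⟩, ⟨-, -, b3⟩, -, -, m3⟩ := hball R' hR'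
    refine deriv_mul_deriv_eq a1 a3 b1.differentiableAt b3.differentiableAt ?_ ?_ ?_
    · rw [d1.deriv]; exact div_ne_zero n.f_ne D
    · rw [d3.deriv]; exact div_ne_zero n'.h_ne D'
    · have hn : Metric.ball R₀.1 ε₁ ×ˢ Metric.ball (R₀.1 + R₀.2) ε₁ ∈ 𝓝 (R.1, R'.1 + R'.2) :=
        prod_mem_nhds (Metric.isOpen_ball.mem_nhds m1) (Metric.isOpen_ball.mem_nhds m3)
      filter_upwards [hn] with q hq h0
      have := (hb q.1 hq.1 R.1 m1 _ m2 _ m2 q.2 hq.2 _ m3).1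
      simp only [sub_self, add_zero] at this
      exact this h0
  have h0 : R₀ ∈ Metric.ball R₀ ε := Metric.mem_ball_self hε
  have hder : ∀ R ∈ Metric.ball R₀ ε,
      HasDerivAt F (deriv F R₀.1 / deriv F₀ R₀.1 *
        (deriv f (S R).1 / dualityDet f g h (S R))) R.1 ∧
      HasDerivAt G (deriv F R₀.1 / deriv F₀ R₀.1 *
        (deriv g (S R).2 / dualityDet f g h (S R))) R.2 ∧
      HasDerivAt H (deriv F R₀.1 / deriv F₀ R₀.1 *
        (deriv h ((S R).1 + (S R).2) / dualityDet f g h (S R))) (R.1 + R.2) := by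
    intro R hR
    obtain ⟨⟨n, D, -⟩, ⟨d1, d2, d3⟩, -, ⟨b1, b2, b3⟩, -⟩ := hball R hR
    refine ⟨?_, ?_, ?_⟩
    · refine b1.differentiableAt.hasDerivAt.congr_deriv ?_
      rw [ratio R₀ h0 R₀ h0, ← ratio R hR R₀ h0, d1.deriv, div_mul_cancel₀]
      exact div_ne_zero n.f_ne D
    · refine b2.differentiableAt.hasDerivAt.congr_deriv ?_
      rw [ratio R₀ h0 R hR, d2.deriv, div_mul_cancel₀]
      exact div_ne_zero n.g_ne D
    · refine b3.differentiableAt.hasDerivAt.congr_deriv ?_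
      rw [ratio' R₀ h0 R hR, d3.deriv, div_mul_cancel₀]
      exact div_ne_zero n.h_ne D
  refine ⟨deriv F R₀.1 / deriv F₀ R₀.1, S, fun hρ => ?_, hS, ?_⟩
  -- With ρ = 0 the function F is locally constant, so changing A alone preserves the equation. Then
  -- F₀ would be constant too, against F₀' = f'/D ≠ 0.
  · rw [hρ] at hder
    simp only [zero_mul] at hder
    obtain ⟨⟨n, D, -⟩, ⟨d1, -, -⟩, -, -, m1, m2, m3⟩ := hball R₀ h0
    have hconst : F₀ =ᶠ[𝓝 R₀.1] fun _ => F₀ R₀.1 := by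
      filter_upwards [Metric.ball_mem_nhds R₀.1 hε] with A hA
      have e : F A = F R₀.1 := eq_of_hasDerivAt_zero_ball (𝕜 := 𝕜)
        (fun t ht => (hder (t, R₀.2) (hmem ht (Metric.mem_ball_self hε))).1) hA
        (Metric.mem_ball_self hε)
      have mA := (hball (A, R₀.2) (hmem hA (Metric.mem_ball_self hε))).2.2.2.2.1
      have := (hb A mA _ m1 _ m2 _ m2 _ m3 _ m3).2
      simp only [e, sub_self, add_zero, true_implies, sub_eq_zero] at this
      exact this
    have := d1.unique ((hasDerivAt_const R₀.1 (F₀ R₀.1)).congr_of_eventuallyEq hconst)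
    exact div_ne_zero n.f_ne D this
  · filter_upwards [Metric.ball_mem_nhds R₀ hε] with R hR
    obtain ⟨⟨n, D, e⟩, -⟩ := hball R hR
    exact ⟨n, D, e, hder R hR⟩

end DualLattice

/-! ### The functional equation and its third order consequences. -/

section FunctionalEquation

variable {𝕜 : Type*} [RCLike 𝕜] {a b c : 𝕜 → 𝕜} {x₀ y₀ z₀ : 𝕜} {r : ℝ}

/-- Analytic functions on a connected open set have no zero divisors: u vanishes near a point with v
≠ 0, hence everywhere. -/
theorem analyticOnNhd_mul_eq_zero {E : Type*} [NormedAddCommGroup E] [NormedSpace 𝕜 E]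
    {U : Set E} (hU : IsOpen U) (hc : IsPreconnected U) {u v : E → 𝕜} (hv : AnalyticOnNhd 𝕜 v U)
    (hu : AnalyticOnNhd 𝕜 u U) (h : ∀ x ∈ U, u x * v x = 0) (hne : ∃ x ∈ U, v x ≠ 0) :
    ∀ x ∈ U, u x = 0 := by
  obtain ⟨x, hx, hvx⟩ := hne
  refine hu.eqOn_zero_of_preconnected_of_eventuallyEq_zero hc hx ?_
  filter_upwards [(hv x hx).continuousAt.eventually_ne hvx, hU.mem_nhds hx] with y h1 h2
  exact (mul_eq_zero.1 (h y h2)).resolve_right h1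

/-- The functional equation `(b + c) a' + (c + a) b' + (a + b) c' = 0` on the plane
`x + y + z = 0`. -/
structure PlaneSolution (a b c : 𝕜 → 𝕜) (x₀ y₀ z₀ : 𝕜) (r : ℝ) : Prop where
  an₁ : ∀ x ∈ Metric.ball x₀ r, AnalyticAt 𝕜 a x
  an₂ : ∀ y ∈ Metric.ball y₀ r, AnalyticAt 𝕜 b y
  an₃ : ∀ z ∈ Metric.ball z₀ r, AnalyticAt 𝕜 c z
  eq : ∀ x ∈ Metric.ball x₀ r, ∀ y ∈ Metric.ball y₀ r, ∀ z ∈ Metric.ball z₀ r, x + y + z = 0 →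
    (b y + c z) * deriv a x + (c z + a x) * deriv b y + (a x + b y) * deriv c z = 0

namespace PlaneSolution

theorem rotate (h : PlaneSolution a b c x₀ y₀ z₀ r) : PlaneSolution b c a y₀ z₀ x₀ r :=
  ⟨h.an₂, h.an₃, h.an₁, fun x hx y hy z hz hs => by
    linear_combination h.eq z hz x hx y hy (by linear_combination hs)⟩

theorem swap (h : PlaneSolution a b c x₀ y₀ z₀ r) : PlaneSolution b a c y₀ x₀ z₀ r :=
  ⟨h.an₂, h.an₁, h.an₃, fun x hx y hy z hz hs => by
    linear_combination h.eq y hy x hx z hz (by linear_combination hs)⟩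

/-- The direction (1, -1, 0) is tangent to the plane x + y + z = 0, so identities on the plane may
be differentiated along it. -/
theorem eq_zero_of_hasDerivAt {N : 𝕜 → 𝕜 → 𝕜 → 𝕜}
    (hN : ∀ x ∈ Metric.ball x₀ r, ∀ y ∈ Metric.ball y₀ r, ∀ z ∈ Metric.ball z₀ r,
      x + y + z = 0 → N x y z = 0) {x y z d : 𝕜} (hx : x ∈ Metric.ball x₀ r)
    (hy : y ∈ Metric.ball y₀ r) (hz : z ∈ Metric.ball z₀ r) (hs : x + y + z = 0)
    (hd : HasDerivAt (fun t => N (x + t) (y - t) z) d 0) : d = 0 := by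
  refine hd.unique ((hasDerivAt_const 0 (0 : 𝕜)).congr_of_eventuallyEq ?_)
  have t1 : Tendsto (fun t : 𝕜 => x + t) (𝓝 0) (𝓝 x) := by
    have : Continuous fun t : 𝕜 => x + t := by fun_prop
    simpa using this.tendsto 0
  have t2 : Tendsto (fun t : 𝕜 => y - t) (𝓝 0) (𝓝 y) := by
    have : Continuous fun t : 𝕜 => y - t := by fun_prop
    simpa using this.tendsto 0
  filter_upwards [t1.eventually (Metric.isOpen_ball.mem_nhds hx),
    t2.eventually (Metric.isOpen_ball.mem_nhds hy)] with t h1 h2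
  exact hN _ h1 _ h2 _ hz (by linear_combination hs)

theorem _root_.AnalyticAt.hasDerivAt_add {a : 𝕜 → 𝕜} {x : 𝕜} (h : AnalyticAt 𝕜 a x) :
    HasDerivAt (fun t => a (x + t)) (deriv a x) 0 :=
  HasDerivAt.comp_const_add x 0 (by simpa using h.differentiableAt.hasDerivAt)

theorem _root_.AnalyticAt.hasDerivAt_sub {a : 𝕜 → 𝕜} {x : 𝕜} (h : AnalyticAt 𝕜 a x) :
    HasDerivAt (fun t => a (x - t)) (-deriv a x) 0 :=
  HasDerivAt.comp_const_sub x 0 (by simpa using h.differentiableAt.hasDerivAt)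

/-- Derivative of the equation along (1, -1, 0); the terms with c' as a factor and no second
derivative combine with the others into a relation antisymmetric in a and b. -/
theorem second (h : PlaneSolution a b c x₀ y₀ z₀ r) : ∀ x ∈ Metric.ball x₀ r,
    ∀ y ∈ Metric.ball y₀ r, ∀ z ∈ Metric.ball z₀ r, x + y + z = 0 →
    (b y + c z) * deriv (deriv a) x + deriv a x * (deriv b y + deriv c z) =
      (c z + a x) * deriv (deriv b) y + deriv b y * (deriv a x + deriv c z) := by
  intro x hx y hy z hz hs
  have ha := h.an₁ x hx
  have hb := h.an₂ y hy
  have := eq_zero_of_hasDerivAt h.eq hx hy hz hs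
    ((((hb.hasDerivAt_sub.add_const (c z)).mul ha.deriv.hasDerivAt_add).add
      ((ha.hasDerivAt_add.const_add (c z)).mul hb.deriv.hasDerivAt_sub)).add
      ((ha.hasDerivAt_add.add hb.hasDerivAt_sub).mul_const (deriv c z)))
  simp only [add_zero, sub_zero] at this
  linear_combination this

/-- Derivative of `second` along (1, 0, -1). The second derivative of a cancels. -/
theorem third (h : PlaneSolution a b c x₀ y₀ z₀ r) : ∀ x ∈ Metric.ball x₀ r,
    ∀ y ∈ Metric.ball y₀ r, ∀ z ∈ Metric.ball z₀ r, x + y + z = 0 →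
    (b y + c z) * deriv (deriv (deriv a)) x =
      (deriv a x - deriv c z) * deriv (deriv b) y +
        (deriv a x - deriv b y) * deriv (deriv c) z := by
  intro x hx y hy z hz hs
  have ha := h.an₁ x hx
  have hb := h.an₂ y hy
  have hc := h.an₃ z hz
  have := eq_zero_of_hasDerivAt (N := fun x z y => (b y + c z) * deriv (deriv a) x +
      deriv a x * (deriv b y + deriv c z) - ((c z + a x) * deriv (deriv b) y +
      deriv b y * (deriv a x + deriv c z)))
    (fun x hx z hz y hy hs => sub_eq_zero.2
      (h.second x hx y hy z hz (by linear_combination hs))) hx hz hy (by linear_combination hs)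
    ((((hc.hasDerivAt_sub.const_add (b y)).mul ha.deriv.deriv.hasDerivAt_add).add
      (ha.deriv.hasDerivAt_add.mul (hc.deriv.hasDerivAt_sub.const_add (deriv b y)))).sub
      (((hc.hasDerivAt_sub.add ha.hasDerivAt_add).mul_const (deriv (deriv b) y)).add
        ((ha.deriv.hasDerivAt_add.add hc.deriv.hasDerivAt_sub).const_mul (deriv b y))))
  simp only [add_zero, sub_zero] at this
  linear_combination this

/-- Derivative of `third` along (1, -1, 0), with the third derivatives of a and b replaced by κa'
and κb'. It closes the system: only second order jets are left. -/
theorem fourth (h : PlaneSolution a b c x₀ y₀ z₀ r) {κ : 𝕜}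
    (ka : ∀ x ∈ Metric.ball x₀ r, deriv (deriv (deriv a)) x = κ * deriv a x)
    (kb : ∀ y ∈ Metric.ball y₀ r, deriv (deriv (deriv b)) y = κ * deriv b y) :
    ∀ x ∈ Metric.ball x₀ r, ∀ y ∈ Metric.ball y₀ r, ∀ z ∈ Metric.ball z₀ r, x + y + z = 0 →
    (b y + c z) * (κ * deriv (deriv a) x) = deriv (deriv a) x * deriv (deriv b) y +
      deriv (deriv a) x * deriv (deriv c) z + deriv (deriv b) y * deriv (deriv c) z +
      κ * (deriv b y * deriv c z) := by
  intro x hx y hy z hz hs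
  have ha := h.an₁ x hx
  have hb := h.an₂ y hy
  have := eq_zero_of_hasDerivAt (N := fun x y z => (b y + c z) * (κ * deriv a x) -
      ((deriv a x - deriv c z) * deriv (deriv b) y +
        (deriv a x - deriv b y) * deriv (deriv c) z))
    (fun x hx y hy z hz hs => by
      have := h.third x hx y hy z hz hs
      rw [ka x hx] at this
      exact sub_eq_zero.2 this) hx hy hz hs
    (((hb.hasDerivAt_sub.add_const (c z)).mul (ha.deriv.hasDerivAt_add.const_mul κ)).sub
      (((ha.deriv.hasDerivAt_add.sub_const (deriv c z)).mul hb.deriv.deriv.hasDerivAt_sub).add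
        ((ha.deriv.hasDerivAt_add.sub hb.deriv.hasDerivAt_sub).mul_const (deriv (deriv c) z))))
  simp only [add_zero, sub_zero, kb y hy] at this
  linear_combination this

/-- Multiplied by (b + c)(c + a)(a + b), the third derivative of a becomes a' times an expression
symmetric in the three functions, and likewise for b. The symmetric expression drops out of the
difference. -/
theorem third_mul (h : PlaneSolution a b c x₀ y₀ z₀ r) : ∀ x ∈ Metric.ball x₀ r,
    ∀ y ∈ Metric.ball y₀ r, ∀ z ∈ Metric.ball z₀ r, x + y + z = 0 →
    (deriv (deriv (deriv a)) x * deriv b y - deriv (deriv (deriv b)) y * deriv a x) *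
      ((b y + c z) * (c z + a x) * (a x + b y)) = 0 := by
  intro x hx y hy z hz hs
  have e := h.eq x hx y hy z hz hs
  have k1 := h.second x hx y hy z hz hs
  have k2 := h.rotate.second y hy z hz x hx (by linear_combination hs)
  have l1 := h.third x hx y hy z hz hs
  have l2 := h.rotate.third y hy z hz x hx (by linear_combination hs)
  generalize deriv (deriv (deriv a)) x = a3 at *
  generalize deriv (deriv (deriv b)) y = b3 at *
  generalize deriv (deriv a) x = a2 at *
  generalize deriv (deriv b) y = b2 at *
  generalize deriv (deriv c) z = c2 at *
  generalize deriv a x = a1 at *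
  generalize deriv b y = b1 at *
  generalize deriv c z = c1 at *
  generalize a x = a0 at *
  generalize b y = b0 at *
  generalize c z = c0 at *
  -- By `second` the quantity R is the same for the three functions, so it expresses all three
  -- second derivatives.
  obtain ⟨R, hR⟩ : ∃ R, R = (b0 + c0) * a2 + a1 * (b1 + c1) := ⟨_, rfl⟩
  have hb : (c0 + a0) * b2 = R - b1 * (a1 + c1) := by rw [hR]; linear_combination -k1
  have hc : (a0 + b0) * c2 = R - c1 * (a1 + b1) := by linear_combination hb - k2
  have ha : (b0 + c0) * a2 = R - a1 * (b1 + c1) := by rw [hR]; ring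
  have h1 : a3 * ((b0 + c0) * (c0 + a0) * (a0 + b0)) = a1 * (R * (2 * (a0 + b0 + c0)) -
      a1 * b1 * (a0 + b0) - a1 * c1 * (c0 + a0) - b1 * c1 * (b0 + c0)) := by
    linear_combination (c0 + a0) * (a0 + b0) * l1 + (a1 - c1) * (a0 + b0) * hb +
      (a1 - b1) * (c0 + a0) * hc + (b1 * c1 - R) * e
  have h2 : b3 * ((b0 + c0) * (c0 + a0) * (a0 + b0)) = b1 * (R * (2 * (a0 + b0 + c0)) -
      a1 * b1 * (a0 + b0) - a1 * c1 * (c0 + a0) - b1 * c1 * (b0 + c0)) := by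
    linear_combination (b0 + c0) * (a0 + b0) * l2 + (b1 - c1) * (a0 + b0) * ha +
      (b1 - a1) * (b0 + c0) * hc + (a1 * c1 - R) * e
  linear_combination b1 * h1 - a1 * h2

/-- If b(y) + c(z) vanished for all independent y and z, both functions would be constant. -/
theorem exists_add_ne_zero {ρ : ℝ} (hρ : 0 < ρ)
    (hbc : ¬ ((∀ᶠ y in 𝓝 y₀, deriv b y = 0) ∧ ∀ᶠ z in 𝓝 z₀, deriv c z = 0)) :
    ∃ y ∈ Metric.ball y₀ ρ, ∃ z ∈ Metric.ball z₀ ρ, b y + c z ≠ 0 := by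
  by_contra hcon
  push Not at hcon
  refine hbc ⟨?_, ?_⟩
  · filter_upwards [Metric.ball_mem_nhds y₀ hρ] with y hy
    have : b =ᶠ[𝓝 y] fun _ => -c z₀ := by
      filter_upwards [Metric.isOpen_ball.mem_nhds hy] with y' hy'
      exact eq_neg_of_add_eq_zero_left (hcon y' hy' z₀ (Metric.mem_ball_self hρ))
    rw [this.deriv_eq]; simp
  · filter_upwards [Metric.ball_mem_nhds z₀ hρ] with z hz
    have : c =ᶠ[𝓝 z] fun _ => -b y₀ := by
      filter_upwards [Metric.isOpen_ball.mem_nhds hz] with z' hz'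
      exact eq_neg_of_add_eq_zero_right (hcon y₀ (Metric.mem_ball_self hρ) z' hz')
    rw [this.deriv_eq]; simp

theorem neg_add_mem_ball {x y : 𝕜} {ρ : ℝ} (h0 : x₀ + y₀ + z₀ = 0)
    (hx : x ∈ Metric.ball x₀ (ρ / 2)) (hy : y ∈ Metric.ball y₀ (ρ / 2)) :
    -(x + y) ∈ Metric.ball z₀ ρ := by
  simp only [Metric.mem_ball, dist_eq_norm] at *
  calc ‖-(x + y) - z₀‖ = ‖(x - x₀) + (y - y₀)‖ := by
        rw [← norm_neg]; congr 1; linear_combination h0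
    _ ≤ ‖x - x₀‖ + ‖y - y₀‖ := norm_add_le _ _
    _ < ρ := by linarith

/-- The three sums in `third_mul` are analytic and none vanishes identically, because no two of the
functions are constant; they may be cancelled one after another. On balls of half the radius the
third coordinate -(x + y) stays in the domain of c. -/
theorem third_comm (h : PlaneSolution a b c x₀ y₀ z₀ r) (hr : 0 < r) (h0 : x₀ + y₀ + z₀ = 0)
    (hab : ¬ ((∀ᶠ x in 𝓝 x₀, deriv a x = 0) ∧ ∀ᶠ y in 𝓝 y₀, deriv b y = 0))
    (hbc : ¬ ((∀ᶠ y in 𝓝 y₀, deriv b y = 0) ∧ ∀ᶠ z in 𝓝 z₀, deriv c z = 0))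
    (hca : ¬ ((∀ᶠ z in 𝓝 z₀, deriv c z = 0) ∧ ∀ᶠ x in 𝓝 x₀, deriv a x = 0)) :
    ∀ x ∈ Metric.ball x₀ (r / 2), ∀ y ∈ Metric.ball y₀ (r / 2),
      deriv (deriv (deriv a)) x * deriv b y = deriv (deriv (deriv b)) y * deriv a x := by
  set U : Set (𝕜 × 𝕜) := Metric.ball (x₀, y₀) (r / 2) with hU
  have hmem : ∀ q : 𝕜 × 𝕜, q ∈ U ↔ q.1 ∈ Metric.ball x₀ (r / 2) ∧ q.2 ∈ Metric.ball y₀ (r / 2) := by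
    intro q
    simp only [hU, Metric.mem_ball, Prod.dist_eq, max_lt_iff]
  have hsub : Metric.ball x₀ (r / 2) ⊆ Metric.ball x₀ r := Metric.ball_subset_ball (by linarith)
  have hsub' : Metric.ball y₀ (r / 2) ⊆ Metric.ball y₀ r := Metric.ball_subset_ball (by linarith)
  have hpre : IsPreconnected U := (convex_ball _ _).isPreconnected
  have a1 : ∀ {k : 𝕜 → 𝕜}, (∀ x ∈ Metric.ball x₀ r, AnalyticAt 𝕜 k x) →
      AnalyticOnNhd 𝕜 (fun q : 𝕜 × 𝕜 => k q.1) U := fun hk q hq =>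
    AnalyticAt.fun_comp (f := fun q : 𝕜 × 𝕜 => q.1) (hk _ (hsub ((hmem q).1 hq).1)) analyticAt_fst
  have a2 : ∀ {k : 𝕜 → 𝕜}, (∀ y ∈ Metric.ball y₀ r, AnalyticAt 𝕜 k y) →
      AnalyticOnNhd 𝕜 (fun q : 𝕜 × 𝕜 => k q.2) U := fun hk q hq =>
    AnalyticAt.fun_comp (f := fun q : 𝕜 × 𝕜 => q.2) (hk _ (hsub' ((hmem q).1 hq).2)) analyticAt_snd
  have a3 : AnalyticOnNhd 𝕜 (fun q : 𝕜 × 𝕜 => c (-(q.1 + q.2))) U := fun q hq =>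
    AnalyticAt.fun_comp (f := fun q : 𝕜 × 𝕜 => -(q.1 + q.2))
      (h.an₃ _ (neg_add_mem_ball h0 ((hmem q).1 hq).1 ((hmem q).1 hq).2))
      (analyticAt_fst.add analyticAt_snd).neg
  have hu : AnalyticOnNhd 𝕜 (fun q : 𝕜 × 𝕜 => deriv (deriv (deriv a)) q.1 * deriv b q.2 -
      deriv (deriv (deriv b)) q.2 * deriv a q.1) U :=
    ((a1 fun x hx => (h.an₁ x hx).deriv.deriv.deriv).mul (a2 fun y hy => (h.an₂ y hy).deriv)).sub
      ((a2 fun y hy => (h.an₂ y hy).deriv.deriv.deriv).mul (a1 fun x hx => (h.an₁ x hx).deriv))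
  have hA := (a2 h.an₂).add a3
  have hB := a3.add (a1 h.an₁)
  have hC := (a1 h.an₁).add (a2 h.an₂)
  -- Halved again, since the point where b + c ≠ 0 is found in terms of y and z, and x = -(y + z)
  -- must still lie in the ball of radius r / 2.
  have hr4 : 0 < r / 2 / 2 := by positivity
  have hle : ∀ s : 𝕜, Metric.ball s (r / 2 / 2) ⊆ Metric.ball s (r / 2) := fun s =>
    Metric.ball_subset_ball (by linarith)
  have nA : ∃ q ∈ U, b q.2 + c (-(q.1 + q.2)) ≠ 0 := by
    obtain ⟨y, hy, z, hz, hne⟩ := exists_add_ne_zero hr4 hbc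
    exact ⟨(-(y + z), y), (hmem _).2 ⟨neg_add_mem_ball (by linear_combination h0) hy hz,
      hle _ hy⟩, by simpa using hne⟩
  have nB : ∃ q ∈ U, c (-(q.1 + q.2)) + a q.1 ≠ 0 := by
    obtain ⟨z, hz, x, hx, hne⟩ := exists_add_ne_zero hr4 hca
    exact ⟨(x, -(z + x)), (hmem _).2 ⟨hle _ hx, neg_add_mem_ball (by linear_combination h0) hz hx⟩,
      by simpa using hne⟩
  have nC : ∃ q ∈ U, a q.1 + b q.2 ≠ 0 := by
    obtain ⟨x, hx, y, hy, hne⟩ := exists_add_ne_zero hr4 hab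
    exact ⟨(x, y), (hmem _).2 ⟨hle _ hx, hle _ hy⟩, hne⟩
  have s3 := analyticOnNhd_mul_eq_zero Metric.isOpen_ball hpre hC ((hu.mul hA).mul hB)
    (fun q hq => by
      have hq' := (hmem q).1 hq
      have := h.third_mul q.1 (hsub hq'.1) q.2 (hsub' hq'.2) (-(q.1 + q.2))
        (neg_add_mem_ball h0 hq'.1 hq'.2) (by ring)
      simp only [Pi.add_apply]
      rw [← this]; ring) nC
  have s2 := analyticOnNhd_mul_eq_zero Metric.isOpen_ball hpre hB (hu.mul hA) s3 nB
  have s1 := analyticOnNhd_mul_eq_zero Metric.isOpen_ball hpre hA hu s2 nA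
  intro x hx y hy
  exact sub_eq_zero.1 (s1 (x, y) ((hmem _).2 ⟨hx, hy⟩))

theorem mono (h : PlaneSolution a b c x₀ y₀ z₀ r) {ρ : ℝ} (hρ : ρ ≤ r) :
    PlaneSolution a b c x₀ y₀ z₀ ρ :=
  ⟨fun x hx => h.an₁ x (Metric.ball_subset_ball hρ hx),
    fun x hx => h.an₂ x (Metric.ball_subset_ball hρ hx),
    fun x hx => h.an₃ x (Metric.ball_subset_ball hρ hx),
    fun x hx y hy z hz => h.eq x (Metric.ball_subset_ball hρ hx) y
      (Metric.ball_subset_ball hρ hy) z (Metric.ball_subset_ball hρ hz)⟩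

/-- The solutions of the functional equation satisfy linear differential equations with a common
constant. -/
theorem exists_third_eq (h : PlaneSolution a b c x₀ y₀ z₀ r) (hr : 0 < r) (h0 : x₀ + y₀ + z₀ = 0)
    (hab : ¬ ((∀ᶠ x in 𝓝 x₀, deriv a x = 0) ∧ ∀ᶠ y in 𝓝 y₀, deriv b y = 0))
    (hbc : ¬ ((∀ᶠ y in 𝓝 y₀, deriv b y = 0) ∧ ∀ᶠ z in 𝓝 z₀, deriv c z = 0))
    (hca : ¬ ((∀ᶠ z in 𝓝 z₀, deriv c z = 0) ∧ ∀ᶠ x in 𝓝 x₀, deriv a x = 0)) :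
    ∃ κ : 𝕜, (∀ x ∈ Metric.ball x₀ (r / 2), deriv (deriv (deriv a)) x = κ * deriv a x) ∧
      (∀ y ∈ Metric.ball y₀ (r / 2), deriv (deriv (deriv b)) y = κ * deriv b y) ∧
      (∀ z ∈ Metric.ball z₀ (r / 2), deriv (deriv (deriv c)) z = κ * deriv c z) := by
  -- Separation of variables: κ is the common value of a'''/a' and b'''/b', and the third function
  -- is compared with b at a point where b' ≠ 0. The equation is trivial where a derivative vanishes
  -- identically, so two nonconstant functions suffice.
  have main : ∀ {a b c : 𝕜 → 𝕜} {x₀ y₀ z₀ : 𝕜},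
      PlaneSolution a b c x₀ y₀ z₀ r → x₀ + y₀ + z₀ = 0 →
      ¬ (∀ᶠ x in 𝓝 x₀, deriv a x = 0) → ¬ (∀ᶠ y in 𝓝 y₀, deriv b y = 0) →
      ∃ κ : 𝕜, (∀ x ∈ Metric.ball x₀ (r / 2), deriv (deriv (deriv a)) x = κ * deriv a x) ∧
        (∀ y ∈ Metric.ball y₀ (r / 2), deriv (deriv (deriv b)) y = κ * deriv b y) ∧
        (∀ z ∈ Metric.ball z₀ (r / 2), deriv (deriv (deriv c)) z = κ * deriv c z) := by
    intro a b c x₀ y₀ z₀ h h0 ha hb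
    have pick : ∀ {k : 𝕜 → 𝕜} {s : 𝕜}, ¬ (∀ᶠ x in 𝓝 s, deriv k x = 0) →
        ∃ x ∈ Metric.ball s (r / 2), deriv k x ≠ 0 := by
      intro k s hk
      obtain ⟨x, hx1, hx2⟩ := ((Filter.not_eventually.1 hk).and_eventually
        (Metric.ball_mem_nhds s (by positivity : 0 < r / 2))).exists
      exact ⟨x, hx2, hx1⟩
    obtain ⟨x₁, hx₁, hax⟩ := pick ha
    obtain ⟨y₁, hy₁, hby⟩ := pick hb
    have e1 := h.third_comm hr h0 (fun q => ha q.1) (fun q => hb q.1) (fun q => ha q.2)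
    have e2 := h.rotate.third_comm hr (by linear_combination h0)
      (fun q => hb q.1) (fun q => ha q.2) (fun q => ha q.1)
    have k1 : ∀ x ∈ Metric.ball x₀ (r / 2),
        deriv (deriv (deriv a)) x = deriv (deriv (deriv b)) y₁ / deriv b y₁ * deriv a x := by
      intro x hx
      rw [div_mul_eq_mul_div, eq_div_iff hby]
      exact e1 x hx y₁ hy₁
    refine ⟨deriv (deriv (deriv b)) y₁ / deriv b y₁, k1, fun y hy => ?_, fun z hz => ?_⟩
    · have := e1 x₁ hx₁ y hy
      rw [k1 x₁ hx₁] at this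
      refine mul_right_cancel₀ hax ?_
      rw [← this]; ring
    · rw [div_mul_eq_mul_div, eq_div_iff hby]
      exact (e2 y₁ hy₁ z hz).symm
  -- At most one function is constant. A rotation moves it to the third place.
  by_cases ha : ∀ᶠ x in 𝓝 x₀, deriv a x = 0
  · obtain ⟨κ, k1, k2, k3⟩ := main h.rotate (by linear_combination h0)
      (fun q => hab ⟨ha, q⟩) (fun q => hca ⟨q, ha⟩)
    exact ⟨κ, k3, k1, k2⟩
  · by_cases hb : ∀ᶠ y in 𝓝 y₀, deriv b y = 0
    · obtain ⟨κ, k1, k2, k3⟩ := main h.rotate.rotate (by linear_combination h0)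
        (fun q => hbc ⟨hb, q⟩) ha
      exact ⟨κ, k2, k3, k1⟩
    · exact main h h0 ha hb

end PlaneSolution

end FunctionalEquation

/-! ### Normal forms of the reciprocals; exponential solutions with few terms. -/

section Families

/-- `r + m e^{ωs} + n e^{-ωs}` -/
noncomputable def expPoly (ω r m n s : ℂ) : ℂ :=
  r + m * Complex.exp (ω * s) + n * Complex.exp (-(ω * s))

/-- `p s² + q s + r` -/
noncomputable def quadPoly (p q r s : ℂ) : ℂ := p * s ^ 2 + q * s + r

/-- The reciprocals of the derivatives of the three functions of the family, in the form
symmetric in the axes. -/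
noncomputable def LatticeFamily.recip : LatticeFamily → Fin 3 → ℂ → ℂ
  | .A μ ν l => ![quadPoly (-1 / μ) 0 0, quadPoly (-1 / ν) 0 0, quadPoly (-1 / l) 0 0]
  | .B μ ν l => ![expPoly 2 (1 / (2 * μ)) (-1 / (4 * μ)) (-1 / (4 * μ)),
      expPoly 2 (1 / (2 * ν)) (-1 / (4 * ν)) (-1 / (4 * ν)),
      expPoly 2 (1 / (2 * l)) (-1 / (4 * l)) (-1 / (4 * l))]
  | .C μ ν l => ![quadPoly (-1 / μ) 0 μ, quadPoly (-1 / ν) 0 ν, quadPoly (-1 / l) 0 l]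
  | .D => ![quadPoly 0 1 0, quadPoly 0 1 0, quadPoly 1 1 0]
  | .E => ![expPoly 1 0 0 (-1), expPoly 1 0 (-1) 0, expPoly 1 (-2) (-1) (-1)]
  | .F => ![expPoly 1 1 0 (-1), expPoly 1 1 0 (-1), expPoly 1 (-1) 1 0]
  | .G => ![expPoly 1 1 (-1) 0, expPoly 1 1 0 (-1), expPoly 1 (-1) 0 0]
  | .H l => ![expPoly 1 1 0 1, expPoly 1 (-1) 1 0,
      expPoly 1 ((1 + l) / (1 - l)) (l / (1 - l)) (1 / (1 - l))]
  | .I μ ν l => ![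
      expPoly 1 ((1 + μ ^ 2) / (μ ^ 2 - 1)) (μ / (μ ^ 2 - 1)) (μ / (μ ^ 2 - 1)),
      expPoly 1 ((1 + ν ^ 2) / (ν ^ 2 - 1)) (ν / (ν ^ 2 - 1)) (ν / (ν ^ 2 - 1)),
      expPoly 1 ((1 + l ^ 2) / (l ^ 2 - 1)) (l / (l ^ 2 - 1)) (l / (l ^ 2 - 1))]

/-- The three functions are obtained from the reciprocals of a family by a permutation, scalings
and balanced shifts. -/
def FamilyForm (α : Fin 3 → ℂ → ℂ) : Prop :=
  ∃ Φ : LatticeFamily, Φ.Valid ∧ ∃ (σ : Equiv.Perm (Fin 3)) (c k : ℂ) (ξ : Fin 3 → ℂ),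
    c ≠ 0 ∧ k ≠ 0 ∧ ξ 0 + ξ 1 + ξ 2 = 0 ∧ ∀ i s, α i s = k * Φ.recip (σ i) (c * (s - ξ i))

theorem FamilyForm.of_perm {α : Fin 3 → ℂ → ℂ} (π : Equiv.Perm (Fin 3))
    (h : FamilyForm fun i => α (π i)) : FamilyForm α := by
  obtain ⟨Φ, hΦ, σ, c, k, ξ, hc, hk, hξ, hα⟩ := h
  refine ⟨Φ, hΦ, π.symm.trans σ, c, k, fun i => ξ (π.symm i), hc, hk, ?_, fun i s => ?_⟩
  · have := Equiv.sum_comp π.symm ξ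
    rw [Fin.sum_univ_three, Fin.sum_univ_three] at this
    rw [this, hξ]
  · have := hα (π.symm i) s
    simpa using this

theorem FamilyForm.shift {α : Fin 3 → ℂ → ℂ} (h : FamilyForm α) {t : Fin 3 → ℂ}
    (ht : t 0 + t 1 + t 2 = 0) : FamilyForm fun i s => α i (s - t i) := by
  obtain ⟨Φ, hΦ, σ, c, k, ξ, hc, hk, hξ, hα⟩ := h
  refine ⟨Φ, hΦ, σ, c, k, fun i => ξ i + t i, hc, hk, by linear_combination hξ + ht, fun i s => ?_⟩
  change α i (s - t i) = _
  rw [hα]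
  congr 2
  ring

theorem exists_perm_fin_three {i j k : Fin 3} (hij : i ≠ j) (hjk : j ≠ k) (hik : i ≠ k) :
    ∃ π : Equiv.Perm (Fin 3), π 0 = i ∧ π 1 = j ∧ π 2 = k := by
  revert i j k
  decide

/-- The third logarithm is taken to be minus the sum of the other two instead of a principal value,
so that the shifts have sum exactly zero. -/
theorem exists_balanced_log {ω : ℂ} (hω : ω ≠ 0) {u : Fin 3 → ℂ} (hu : u 0 * u 1 * u 2 = 1) :
    ∃ ξ : Fin 3 → ℂ, ξ 0 + ξ 1 + ξ 2 = 0 ∧ ∀ i, Complex.exp (ω * ξ i) = u i := by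
  have h01 : u 0 * u 1 ≠ 0 := left_ne_zero_of_mul_eq_one hu
  have h0 : u 0 ≠ 0 := left_ne_zero_of_mul h01
  have h1 : u 1 ≠ 0 := right_ne_zero_of_mul h01
  refine ⟨![Complex.log (u 0) / ω, Complex.log (u 1) / ω,
    -(Complex.log (u 0) / ω + Complex.log (u 1) / ω)], by simp, fun i => ?_⟩
  fin_cases i
  · simp [mul_div_cancel₀ _ hω, Complex.exp_log h0]
  · simp [mul_div_cancel₀ _ hω, Complex.exp_log h1]
  · simp only [Fin.reduceFinMk, Matrix.cons_val]
    rw [show ω * -(Complex.log (u 0) / ω + Complex.log (u 1) / ω) =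
      -(Complex.log (u 0) + Complex.log (u 1)) by field_simp, Complex.exp_neg, Complex.exp_add,
      Complex.exp_log h0, Complex.exp_log h1]
    exact inv_eq_of_mul_eq_one_right hu

/-- Scaling the exponentials by factors with unit product is a balanced shift. -/
theorem familyForm_expPoly {Φ : LatticeFamily} (hΦ : Φ.Valid) {ω ω' k : ℂ} (hω : ω ≠ 0)
    (hω' : ω' ≠ 0) (hk : k ≠ 0) {r m n r' m' n' u : Fin 3 → ℂ}
    (hrec : ∀ i, Φ.recip i = expPoly ω' (r' i) (m' i) (n' i)) (hu : u 0 * u 1 * u 2 = 1)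
    (hr : ∀ i, r i = k * r' i) (hm : ∀ i, m i * u i = k * m' i)
    (hn : ∀ i, n i = k * n' i * u i) : FamilyForm fun i => expPoly ω (r i) (m i) (n i) := by
  obtain ⟨ξ, hξ0, hξ⟩ := exists_balanced_log hω hu
  have hune : ∀ i, u i ≠ 0 := fun i => hξ i ▸ Complex.exp_ne_zero _
  refine ⟨Φ, hΦ, 1, ω / ω', k, ξ, div_ne_zero hω hω', hk, hξ0, fun i s => ?_⟩
  have e1 : ω' * (ω / ω' * (s - ξ i)) = ω * s - ω * ξ i := by field_simp
  have e2 : -(ω * s - ω * ξ i) = -(ω * s) + ω * ξ i := by ring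
  simp only [Equiv.Perm.coe_one, id, hrec, expPoly, e1, e2, Complex.exp_add, Complex.exp_sub, hξ]
  rw [hr, hn, ← mul_div_cancel_right₀ (m i) (hune i), hm]
  have := hune i
  field_simp

/-- The conditions on the coefficients of solutions with exponentials. -/
structure ExpCondition (r m n : Fin 3 → ℂ) : Prop where
  m_eq : ∀ i j k : Fin 3, i ≠ j → j ≠ k → i ≠ k → (r i + r j) * m k = 2 * (n i * n j)
  n_eq : ∀ i j k : Fin 3, i ≠ j → j ≠ k → i ≠ k → (r i + r j) * n k = 2 * (m i * m j)

theorem ExpCondition.perm {r m n : Fin 3 → ℂ} (h : ExpCondition r m n) (π : Equiv.Perm (Fin 3)) :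
    ExpCondition (fun i => r (π i)) (fun i => m (π i)) (fun i => n (π i)) :=
  ⟨fun _ _ _ hij hjk hik => h.m_eq _ _ _ (π.injective.ne hij) (π.injective.ne hjk)
      (π.injective.ne hik),
    fun _ _ _ hij hjk hik => h.n_eq _ _ _ (π.injective.ne hij) (π.injective.ne hjk)
      (π.injective.ne hik)⟩

theorem ExpCondition.symm {r m n : Fin 3 → ℂ} (h : ExpCondition r m n) : ExpCondition r n m :=
  ⟨h.n_eq, h.m_eq⟩

theorem expPoly_neg (ω r m n : ℂ) : expPoly (-ω) r m n = expPoly ω r n m := by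
  funext s
  simp only [expPoly, neg_mul, neg_neg]
  ring

variable {ω : ℂ} {r m n : Fin 3 → ℂ}

theorem forall_fin_three {P : Fin 3 → Prop} (h0 : P 0) (h1 : P 1) (h2 : P 2) : ∀ i, P i := by
  intro i
  fin_cases i
  exacts [h0, h1, h2]

/-- The family with a constant function. -/
theorem familyForm_G (hω : ω ≠ 0) (h : ExpCondition r m n) (hm0 : m 0 ≠ 0) (hn0 : n 0 = 0)
    (hn1 : n 1 ≠ 0) (hm1 : m 1 = 0) (hm2 : m 2 = 0) (hn2 : n 2 = 0) (hr : r 2 ≠ 0) :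
    FamilyForm fun i => expPoly ω (r i) (m i) (n i) := by
  have e1 := h.m_eq 1 2 0 (by decide) (by decide) (by decide)
  have e2 := h.n_eq 0 2 1 (by decide) (by decide) (by decide)
  have r1 : r 1 = -r 2 := by
    rw [hn2, mul_zero, mul_zero] at e1
    exact eq_neg_of_add_eq_zero_left ((mul_eq_zero.1 e1).resolve_right hm0)
  have r0 : r 0 = -r 2 := by
    rw [hm2, mul_zero, mul_zero] at e2
    exact eq_neg_of_add_eq_zero_left ((mul_eq_zero.1 e2).resolve_right hn1)
  refine familyForm_expPoly (Φ := .G) trivial hω one_ne_zero (neg_ne_zero.2 hr)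
    (r' := ![1, 1, -1]) (m' := ![-1, 0, 0]) (n' := ![0, -1, 0])
    (u := ![r 2 / m 0, n 1 / r 2, m 0 / n 1]) (forall_fin_three rfl rfl rfl) ?_
    (forall_fin_three ?_ ?_ ?_) (forall_fin_three ?_ ?_ ?_) (forall_fin_three ?_ ?_ ?_) <;>
  simp [r0, r1, hn0, hm1, hm2, hn2] <;> field_simp

/-- One exponential in each function, two of them e^{-ωs}. The conditions force r₀ = r₁ = -r₂ and
-r₂m₂ = n₀n₁, and scaling normalizes the rest. -/
theorem familyForm_F (hω : ω ≠ 0) (h : ExpCondition r m n) (hn0 : n 0 ≠ 0) (hm0 : m 0 = 0)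
    (hn1 : n 1 ≠ 0) (hm1 : m 1 = 0) (hm2 : m 2 ≠ 0) (hn2 : n 2 = 0) :
    FamilyForm fun i => expPoly ω (r i) (m i) (n i) := by
  have e1 := h.n_eq 1 2 0 (by decide) (by decide) (by decide)
  have e2 := h.n_eq 0 2 1 (by decide) (by decide) (by decide)
  have e3 := h.m_eq 0 1 2 (by decide) (by decide) (by decide)
  have r1 : r 1 = -r 2 := by
    rw [hm1, zero_mul, mul_zero] at e1
    exact eq_neg_of_add_eq_zero_left ((mul_eq_zero.1 e1).resolve_right hn0)
  have r0 : r 0 = -r 2 := by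
    rw [hm0, zero_mul, mul_zero] at e2
    exact eq_neg_of_add_eq_zero_left ((mul_eq_zero.1 e2).resolve_right hn1)
  have e4 : -r 2 * m 2 = n 0 * n 1 := by
    rw [r0, r1] at e3
    linear_combination e3 / 2
  have hr : r 2 ≠ 0 := by
    intro h0
    rw [h0, neg_zero, zero_mul] at e4
    exact mul_ne_zero hn0 hn1 e4.symm
  refine familyForm_expPoly (Φ := .F) trivial hω one_ne_zero (neg_ne_zero.2 hr)
    (r' := ![1, 1, -1]) (m' := ![0, 0, 1]) (n' := ![-1, -1, 0])
    (u := ![n 0 / r 2, n 1 / r 2, r 2 ^ 2 / (n 0 * n 1)]) (forall_fin_three rfl rfl rfl) ?_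
    (forall_fin_three ?_ ?_ ?_) (forall_fin_three ?_ ?_ ?_) (forall_fin_three ?_ ?_ ?_)
  -- u₀ and u₁ normalize n₀ and n₁, and u₂ is then fixed by the unit product. That m₂ is normalized
  -- as well is the relation `e4`.
  case refine_7 =>
    simp only [Matrix.cons_val]
    rw [← e4]
    field_simp
  all_goals
    simp [r0, r1, hm0, hm1, hn2]
  all_goals field_simp

/-- Opposite single exponentials in two functions and both exponentials in the third. Then r₁ = -r₀,
and m₂, n₂ are determined by the other coefficients, leaving the ratio of r₀ and r₂ as the only
parameter. -/
theorem familyForm_H (hω : ω ≠ 0) (h : ExpCondition r m n) (hn0 : n 0 ≠ 0) (hm0 : m 0 = 0)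
    (hm1 : m 1 ≠ 0) (hn1 : n 1 = 0) (hm2 : m 2 ≠ 0) (hn2 : n 2 ≠ 0) :
    FamilyForm fun i => expPoly ω (r i) (m i) (n i) := by
  have e1 := h.m_eq 0 1 2 (by decide) (by decide) (by decide)
  have e2 := h.n_eq 1 2 0 (by decide) (by decide) (by decide)
  have e3 := h.m_eq 0 2 1 (by decide) (by decide) (by decide)
  have r1 : r 1 = -r 0 := by
    rw [hn1, mul_zero, mul_zero] at e1
    exact eq_neg_of_add_eq_zero_right ((mul_eq_zero.1 e1).resolve_right hm2)
  rw [r1] at e2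
  have hs : r 0 + r 2 ≠ 0 := by
    intro h0
    rw [h0, zero_mul] at e3
    exact mul_ne_zero two_ne_zero (mul_ne_zero hn0 hn2) e3.symm
  have hd : -r 0 + r 2 ≠ 0 := by
    intro h0
    rw [h0, zero_mul] at e2
    exact mul_ne_zero two_ne_zero (mul_ne_zero hm1 hm2) e2.symm
  have q1 : m 2 = (-r 0 + r 2) * n 0 / (2 * m 1) := by
    field_simp
    linear_combination -e2
  have q2 : n 2 = (r 0 + r 2) * m 1 / (2 * n 0) := by
    field_simp
    linear_combination -e3
  -- The limiting ratio r₀ = 0 is (E). Otherwise λ = (r₂ - r₀)/(r₂ + r₀) in (H).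
  by_cases hr : r 0 = 0
  · have hr2 : r 2 ≠ 0 := by simpa [hr] using hs
    refine familyForm_expPoly (Φ := .E) trivial hω one_ne_zero (k := -(r 2 / 2)) (by simpa using hr2)
      (r' := ![0, 0, -2]) (m' := ![0, -1, -1]) (n' := ![-1, 0, -1])
      (u := ![2 * n 0 / r 2, r 2 / (2 * m 1), m 1 / n 0]) (forall_fin_three rfl rfl rfl) ?_
      (forall_fin_three ?_ ?_ ?_) (forall_fin_three ?_ ?_ ?_) (forall_fin_three ?_ ?_ ?_)
    all_goals
      simp [r1, hr, hm0, hn1, q1, q2]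
    all_goals field_simp
  · have hl : 1 - (-r 0 + r 2) / (r 0 + r 2) = 2 * r 0 / (r 0 + r 2) := by
      field_simp
      ring
    refine familyForm_expPoly (Φ := .H ((-r 0 + r 2) / (r 0 + r 2))) (div_ne_zero hd hs) hω
      one_ne_zero hr
      (r' := ![1, -1, r 2 / r 0]) (m' := ![0, 1, (-r 0 + r 2) / (2 * r 0)])
      (n' := ![1, 0, (r 0 + r 2) / (2 * r 0)])
      (u := ![n 0 / r 0, r 0 / m 1, m 1 / n 0]) (forall_fin_three rfl rfl ?_) ?_
      (forall_fin_three ?_ ?_ ?_) (forall_fin_three ?_ ?_ ?_) (forall_fin_three ?_ ?_ ?_)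
    · simp only [LatticeFamily.recip, Matrix.cons_val, hl]
      congr 1
      · field_simp
        ring
      · field_simp
      · field_simp
    all_goals
      simp [r1, hm0, hn1, q1, q2]
    all_goals field_simp

end Families

/-! ### Exponential solutions with all terms present: families (B) and (I). -/

section Classification

variable {ω : ℂ} {r m n : Fin 3 → ℂ}

theorem fin_three_prod_eq {u : Fin 3 → ℂ} (hu : u 0 * u 1 * u 2 = 1) {i j k : Fin 3} (hij : i ≠ j)
    (hjk : j ≠ k) (hik : i ≠ k) : u i * u j * u k = 1 := by
  obtain ⟨π, rfl, rfl, rfl⟩ := exists_perm_fin_three hij hjk hik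
  rw [← hu]
  simpa [Fin.prod_univ_three] using Equiv.prod_comp π u

/-- This is the effect of balanced shifts on the coefficients, used to normalize them. -/
theorem ExpCondition.scale (h : ExpCondition r m n) {u : Fin 3 → ℂ} (hu : u 0 * u 1 * u 2 = 1) :
    ExpCondition r (fun i => m i * u i) (fun i => n i / u i) := by
  constructor
  · intro i j k hij hjk hik
    have e := fin_three_prod_eq hu hij hjk hik
    have h01 : u i * u j ≠ 0 := left_ne_zero_of_mul_eq_one e
    have h0 : u i ≠ 0 := left_ne_zero_of_mul h01
    have h1 : u j ≠ 0 := right_ne_zero_of_mul h01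
    have := h.m_eq i j k hij hjk hik
    field_simp
    linear_combination u i * u j * u k * this + 2 * n i * n j * e
  · intro i j k hij hjk hik
    have e := fin_three_prod_eq hu hij hjk hik
    have h2 : u k ≠ 0 := right_ne_zero_of_mul_eq_one e
    have := h.n_eq i j k hij hjk hik
    field_simp
    linear_combination this - 2 * m i * m j * e

theorem FamilyForm.of_scale (hω : ω ≠ 0) {u : Fin 3 → ℂ} (hu : u 0 * u 1 * u 2 = 1)
    (h : FamilyForm fun i => expPoly ω (r i) (m i * u i) (n i / u i)) :
    FamilyForm fun i => expPoly ω (r i) (m i) (n i) := by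
  obtain ⟨ξ, hξ0, hξ⟩ := exists_balanced_log hω hu
  have hune : ∀ i, u i ≠ 0 := fun i => hξ i ▸ Complex.exp_ne_zero _
  have := h.shift hξ0
  convert this using 3 with i s
  have e2 : -(ω * s - ω * ξ i) = -(ω * s) + ω * ξ i := by ring
  have := hune i
  simp only [expPoly, mul_sub, e2, Complex.exp_add, Complex.exp_sub, hξ]
  field_simp

/-- Solving the conditions for the r's under the relation on the inverses gives r i = -2 m i. The
parameters are then -1/(4 m i), and the relation says that their sum is zero. -/
theorem familyForm_B (hω : ω ≠ 0) (h : ExpCondition r m m) (hm : ∀ i, m i ≠ 0)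
    (hs : (m 0)⁻¹ + (m 1)⁻¹ + (m 2)⁻¹ = 0) : FamilyForm fun i => expPoly ω (r i) (m i) (m i) := by
  have h0 := hm 0
  have h1 := hm 1
  have h2 := hm 2
  have e1 := h.m_eq 0 1 2 (by decide) (by decide) (by decide)
  have e2 := h.m_eq 1 2 0 (by decide) (by decide) (by decide)
  have e3 := h.m_eq 0 2 1 (by decide) (by decide) (by decide)
  have q1 : r 0 + r 1 = 2 * (m 0 * m 1) / m 2 := by rw [eq_div_iff h2, e1]
  have q2 : r 1 + r 2 = 2 * (m 1 * m 2) / m 0 := by rw [eq_div_iff h0, e2]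
  have q3 : r 0 + r 2 = 2 * (m 0 * m 2) / m 1 := by rw [eq_div_iff h1, e3]
  have hs' : m 1 * m 2 + m 0 * m 2 + m 0 * m 1 = 0 := by
    field_simp at hs
    linear_combination hs
  have r0 : r 0 = -2 * m 0 := by
    have : r 0 = m 0 * m 1 / m 2 + m 0 * m 2 / m 1 - m 1 * m 2 / m 0 := by
      linear_combination (q1 + q3 - q2) / 2
    rw [this]
    field_simp
    linear_combination (-m 1 * m 2 + m 0 * m 2 + m 0 * m 1) * hs'
  have r1 : r 1 = -2 * m 1 := by
    have : r 1 = m 0 * m 1 / m 2 - m 0 * m 2 / m 1 + m 1 * m 2 / m 0 := by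
      linear_combination (q1 - q3 + q2) / 2
    rw [this]
    field_simp
    linear_combination (m 1 * m 2 - m 0 * m 2 + m 0 * m 1) * hs'
  have r2 : r 2 = -2 * m 2 := by
    have : r 2 = -(m 0 * m 1 / m 2) + m 0 * m 2 / m 1 + m 1 * m 2 / m 0 := by
      linear_combination (-q1 + q3 + q2) / 2
    rw [this]
    field_simp
    linear_combination (m 1 * m 2 + m 0 * m 2 - m 0 * m 1) * hs'
  have hval : (LatticeFamily.B (-(m 0)⁻¹ / 4) (-(m 1)⁻¹ / 4) (-(m 2)⁻¹ / 4)).Valid := by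
    simp only [LatticeFamily.Valid]
    linear_combination -hs / 4
  have hrec : ∀ {x : ℂ}, x ≠ 0 → expPoly 2 (1 / (2 * (-x⁻¹ / 4))) (-1 / (4 * (-x⁻¹ / 4)))
      (-1 / (4 * (-x⁻¹ / 4))) = expPoly 2 (-2 * x) x x := by
    intro x hx
    congr 1 <;> field_simp
    norm_num
  refine familyForm_expPoly hval hω two_ne_zero one_ne_zero (r' := fun i => -2 * m i) (m' := m)
    (n' := m) (u := fun _ => 1) (forall_fin_three (hrec h0) (hrec h1) (hrec h2)) (by simp)
    (forall_fin_three ?_ ?_ ?_) (by simp) (by simp)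
  · simpa using r0
  · simpa using r1
  · simpa using r2

/-- The numbers w i behave as the sides of a complex triangle, nondegenerate by `hs` (Heron's
formula). With angles θ i, the parameters are e^{iθ}: the cosine comes from the law of cosines, and
by the law of sines i sin θ is δ times the side. The constraint λμν = -1 says that the angles add up
to π. -/
theorem familyForm_I (hω : ω ≠ 0) (h : ExpCondition r m m) (hm : ∀ i, m i ≠ 0)
    {w : Fin 3 → ℂ} (hw : ∀ i, w i = (m i)⁻¹)
    (hs : w 0 ^ 4 + w 1 ^ 4 + w 2 ^ 4 - 2 * (w 0 ^ 2 * w 1 ^ 2 + w 1 ^ 2 * w 2 ^ 2 +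
      w 2 ^ 2 * w 0 ^ 2) ≠ 0) : FamilyForm fun i => expPoly ω (r i) (m i) (m i) := by
  have hwne : ∀ i, w i ≠ 0 := fun i => hw i ▸ inv_ne_zero (hm i)
  have h0 := hwne 0
  have h1 := hwne 1
  have h2 := hwne 2
  have hmw : ∀ i, m i = (w i)⁻¹ := fun i => by rw [hw, inv_inv]
  have e1 := h.m_eq 0 1 2 (by decide) (by decide) (by decide)
  have e2 := h.m_eq 1 2 0 (by decide) (by decide) (by decide)
  have e3 := h.m_eq 0 2 1 (by decide) (by decide) (by decide)
  simp only [hmw] at e1 e2 e3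
  have q1 : r 0 + r 1 = 2 * w 2 / (w 0 * w 1) := by
    field_simp at e1 ⊢
    linear_combination e1
  have q2 : r 1 + r 2 = 2 * w 0 / (w 1 * w 2) := by
    field_simp at e2 ⊢
    linear_combination e2
  have q3 : r 0 + r 2 = 2 * w 1 / (w 0 * w 2) := by
    field_simp at e3 ⊢
    linear_combination e3
  -- δ is the common ratio in the law of sines, multiplied by the imaginary unit. Its sign is
  -- immaterial.
  obtain ⟨δ, hδ⟩ := IsAlgClosed.exists_pow_nat_eq ((w 0 ^ 4 + w 1 ^ 4 + w 2 ^ 4 -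
    2 * (w 0 ^ 2 * w 1 ^ 2 + w 1 ^ 2 * w 2 ^ 2 + w 2 ^ 2 * w 0 ^ 2)) /
    (4 * (w 0 * w 1 * w 2) ^ 2)) (n := 2) two_pos
  have hP : 4 * (w 0 * w 1 * w 2) ^ 2 ≠ 0 :=
    mul_ne_zero (by norm_num) (pow_ne_zero 2 (mul_ne_zero (mul_ne_zero h0 h1) h2))
  have hδ0 : δ ≠ 0 := by
    rintro rfl
    rw [zero_pow two_ne_zero, eq_comm, div_eq_zero_iff] at hδ
    refine hδ.elim hs fun h => ?_
    exact hP h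
  rw [eq_div_iff hP] at hδ
  have key : ∀ {C W : ℂ}, W ≠ 0 → C ^ 2 - (δ * W) ^ 2 = 1 →
      expPoly 1 ((1 + (C + δ * W) ^ 2) / ((C + δ * W) ^ 2 - 1))
        ((C + δ * W) / ((C + δ * W) ^ 2 - 1)) ((C + δ * W) / ((C + δ * W) ^ 2 - 1)) =
      expPoly 1 (C / (δ * W)) (1 / (2 * δ * W)) (1 / (2 * δ * W)) := by
    intro C W hW hC
    have hμ : C + δ * W ≠ 0 := by
      intro h0
      apply one_ne_zero (α := ℂ)
      rw [← hC]
      linear_combination (C - δ * W) * h0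
    have hden : (C + δ * W) ^ 2 - 1 = 2 * δ * W * (C + δ * W) := by linear_combination hC
    have hnum : 1 + (C + δ * W) ^ 2 = 2 * C * (C + δ * W) := by linear_combination -hC
    rw [hden, hnum]
    congr 1 <;> field_simp
  have c0 : ((w 1 ^ 2 + w 2 ^ 2 - w 0 ^ 2) / (2 * w 1 * w 2)) ^ 2 - (δ * w 0) ^ 2 = 1 := by
    field_simp
    linear_combination -hδ
  have c1 : ((w 0 ^ 2 + w 2 ^ 2 - w 1 ^ 2) / (2 * w 0 * w 2)) ^ 2 - (δ * w 1) ^ 2 = 1 := by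
    field_simp
    linear_combination -hδ
  have c2 : ((w 0 ^ 2 + w 1 ^ 2 - w 2 ^ 2) / (2 * w 0 * w 1)) ^ 2 - (δ * w 2) ^ 2 = 1 := by
    field_simp
    linear_combination -hδ
  have hval : (LatticeFamily.I ((w 1 ^ 2 + w 2 ^ 2 - w 0 ^ 2) / (2 * w 1 * w 2) + δ * w 0)
      ((w 0 ^ 2 + w 2 ^ 2 - w 1 ^ 2) / (2 * w 0 * w 2) + δ * w 1)
      ((w 0 ^ 2 + w 1 ^ 2 - w 2 ^ 2) / (2 * w 0 * w 1) + δ * w 2)).Valid := by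
    simp only [LatticeFamily.Valid]
    field_simp
    linear_combination (w 0 ^ 2 + w 1 ^ 2 + w 2 ^ 2 + 2 * δ * w 0 * w 1 * w 2) * hδ
  refine familyForm_expPoly hval hω one_ne_zero (k := 2 * δ) (by simpa using hδ0)
    (r' := ![(w 1 ^ 2 + w 2 ^ 2 - w 0 ^ 2) / (2 * w 1 * w 2) / (δ * w 0),
      (w 0 ^ 2 + w 2 ^ 2 - w 1 ^ 2) / (2 * w 0 * w 2) / (δ * w 1),
      (w 0 ^ 2 + w 1 ^ 2 - w 2 ^ 2) / (2 * w 0 * w 1) / (δ * w 2)])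
    (m' := fun i => 1 / (2 * δ * w i)) (n' := fun i => 1 / (2 * δ * w i)) (u := fun _ => 1)
    (forall_fin_three (key h0 c0) (key h1 c1) (key h2 c2)) (by simp)
    (forall_fin_three ?_ ?_ ?_) (fun i => ?_) (fun i => ?_)
  · have : r 0 = w 2 / (w 0 * w 1) + w 1 / (w 0 * w 2) - w 0 / (w 1 * w 2) := by
      linear_combination (q1 + q3 - q2) / 2
    simp only [this, Matrix.cons_val]
    field_simp
    ring
  · have : r 1 = w 2 / (w 0 * w 1) - w 1 / (w 0 * w 2) + w 0 / (w 1 * w 2) := by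
      linear_combination (q1 - q3 + q2) / 2
    simp only [this, Matrix.cons_val]
    field_simp
    ring
  · have : r 2 = -w 2 / (w 0 * w 1) + w 1 / (w 0 * w 2) + w 0 / (w 1 * w 2) := by
      linear_combination (-q1 + q3 + q2) / 2
    simp only [this, Matrix.cons_val]
    field_simp
    ring
  · have := hwne i
    rw [hmw]
    field_simp
  · have := hwne i
    rw [hmw]
    field_simp

end Classification

/-! ### Completion of the classification of exponential solutions. -/

section Classification

variable {ω : ℂ} {r m n : Fin 3 → ℂ}

/-- Heron's polynomial in the inverses 1/m i is a product of four linear factors. If one vanishes,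
sign changes with product 1, which preserve m = n, bring it to the form 1/m₀ + 1/m₁ + 1/m₂ = 0 of
(B). -/
theorem familyForm_of_eq (hω : ω ≠ 0) (h : ExpCondition r m m) (hm : ∀ i, m i ≠ 0) :
    FamilyForm fun i => expPoly ω (r i) (m i) (m i) := by
  by_cases hs : (m 0)⁻¹ ^ 4 + (m 1)⁻¹ ^ 4 + (m 2)⁻¹ ^ 4 - 2 * ((m 0)⁻¹ ^ 2 * (m 1)⁻¹ ^ 2 +
      (m 1)⁻¹ ^ 2 * (m 2)⁻¹ ^ 2 + (m 2)⁻¹ ^ 2 * (m 0)⁻¹ ^ 2) = 0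
  · have hfac : ((m 0)⁻¹ + (m 1)⁻¹ + (m 2)⁻¹) * ((m 0)⁻¹ - (m 1)⁻¹ - (m 2)⁻¹) *
        ((-(m 0)⁻¹ + (m 1)⁻¹ - (m 2)⁻¹) * (-(m 0)⁻¹ - (m 1)⁻¹ + (m 2)⁻¹)) = 0 := by
      linear_combination hs
    have main : ∀ u : Fin 3 → ℂ, u 0 * u 1 * u 2 = 1 → (∀ i, u i * u i = 1) →
        u 0 * (m 0)⁻¹ + u 1 * (m 1)⁻¹ + u 2 * (m 2)⁻¹ = 0 →
        FamilyForm fun i => expPoly ω (r i) (m i) (m i) := by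
      intro u hu hu2 hsum
      have hinv : ∀ i, (u i)⁻¹ = u i := fun i => inv_eq_of_mul_eq_one_right (hu2 i)
      have hne : ∀ i, u i ≠ 0 := fun i => left_ne_zero_of_mul_eq_one (hu2 i)
      refine FamilyForm.of_scale hω hu ?_
      have h' := h.scale hu
      simp only [div_eq_mul_inv, hinv] at h' ⊢
      refine familyForm_B hω h' (fun i => mul_ne_zero (hm i) (hne i)) ?_
      simp only [mul_inv, hinv]
      linear_combination hsum
    rcases mul_eq_zero.1 hfac with h1 | h1
    · rcases mul_eq_zero.1 h1 with h2 | h2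
      · exact main (fun _ => 1) (by simp) (by simp) (by linear_combination h2)
      · refine main ![1, -1, -1] (by simp) (forall_fin_three ?_ ?_ ?_) ?_ <;> simp
        linear_combination h2
    · rcases mul_eq_zero.1 h1 with h2 | h2
      · refine main ![-1, 1, -1] (by simp) (forall_fin_three ?_ ?_ ?_) ?_ <;> simp
        linear_combination h2
      · refine main ![-1, -1, 1] (by simp) (forall_fin_three ?_ ?_ ?_) ?_ <;> simp
        linear_combination h2
  · exact familyForm_I hω h hm (w := fun i => (m i)⁻¹) (fun _ => rfl) hs

/-- Shifts by square roots of n/m make m and n equal. Two roots may be chosen freely, and the unit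
product makes the third correct because m₀m₁m₂ = n₀n₁n₂. -/
theorem familyForm_of_forall_ne_zero (hω : ω ≠ 0) (h : ExpCondition r m n) (hm : ∀ i, m i ≠ 0)
    (hn : ∀ i, n i ≠ 0) : FamilyForm fun i => expPoly ω (r i) (m i) (n i) := by
  have e1 := h.m_eq 0 1 2 (by decide) (by decide) (by decide)
  have e2 := h.n_eq 0 1 2 (by decide) (by decide) (by decide)
  have hMN : m 0 * m 1 * m 2 = n 0 * n 1 * n 2 := by
    linear_combination (m 2 * -e2 + n 2 * e1) / 2
  have h0 := hm 0
  have h1 := hm 1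
  have h2 := hm 2
  have k0 := hn 0
  have k1 := hn 1
  have k2 := hn 2
  obtain ⟨u, hu⟩ := IsAlgClosed.exists_pow_nat_eq (n 0 / m 0) (n := 2) two_pos
  obtain ⟨v, hv⟩ := IsAlgClosed.exists_pow_nat_eq (n 1 / m 1) (n := 2) two_pos
  have hu0 : u ≠ 0 := by
    rintro rfl
    exact div_ne_zero k0 h0 (by rw [← hu]; simp)
  have hv0 : v ≠ 0 := by
    rintro rfl
    exact div_ne_zero k1 h1 (by rw [← hv]; simp)
  rw [eq_div_iff h0] at hu
  rw [eq_div_iff h1] at hv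
  have hU : (![u, v, (u * v)⁻¹] : Fin 3 → ℂ) 0 * (![u, v, (u * v)⁻¹] : Fin 3 → ℂ) 1 *
      (![u, v, (u * v)⁻¹] : Fin 3 → ℂ) 2 = 1 := by
    simp
    field_simp
  refine FamilyForm.of_scale hω hU ?_
  have h' := h.scale hU
  have heq : ∀ i, n i / (![u, v, (u * v)⁻¹] : Fin 3 → ℂ) i =
      m i * (![u, v, (u * v)⁻¹] : Fin 3 → ℂ) i := by
    refine forall_fin_three ?_ ?_ ?_
    · simp only [Matrix.cons_val]
      rw [div_eq_iff hu0]
      linear_combination -hu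
    · simp only [Matrix.cons_val]
      rw [div_eq_iff hv0]
      linear_combination -hv
    · simp only [Matrix.cons_val]
      field_simp
      refine mul_left_cancel₀ (mul_ne_zero h0 h1) ?_
      linear_combination n 2 * m 1 * v ^ 2 * hu + n 2 * n 0 * hv - hMN
  simp only [heq] at h' ⊢
  refine familyForm_of_eq hω h' fun i => mul_ne_zero (hm i) ?_
  refine forall_fin_three (P := fun i => (![u, v, (u * v)⁻¹] : Fin 3 → ℂ) i ≠ 0) ?_ ?_ ?_ i
  · simpa using hu0
  · simpa using hv0
  · simpa using ⟨hv0, hu0⟩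

/-- Classification of the solutions with exponentials. -/
theorem familyForm_of_expCondition (hω : ω ≠ 0) (h : ExpCondition r m n)
    (hne : ∀ i j, i ≠ j → ¬ (m i = 0 ∧ n i = 0 ∧ m j = 0 ∧ n j = 0))
    (hr : ∀ i, m i = 0 → n i = 0 → r i ≠ 0) :
    FamilyForm fun i => expPoly ω (r i) (m i) (n i) := by
  -- two functions with one exponential each
  have split : ∀ i j k : Fin 3, i ≠ j → j ≠ k → i ≠ k → n i * n j = 0 → m i * m j = 0 →
      (m i ≠ 0 ∨ n i ≠ 0) → (m j ≠ 0 ∨ n j ≠ 0) →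
      ∃ π : Equiv.Perm (Fin 3), π 2 = k ∧ m (π 0) = 0 ∧ n (π 0) ≠ 0 ∧ m (π 1) ≠ 0 ∧
        n (π 1) = 0 := by
    intro i j k hij hjk hik hN hM hi hj
    by_cases hmi : m i = 0
    · have hni : n i ≠ 0 := hi.resolve_left (not_not.2 hmi)
      have hnj : n j = 0 := (mul_eq_zero.1 hN).resolve_left hni
      have hmj : m j ≠ 0 := hj.resolve_right (not_not.2 hnj)
      obtain ⟨π, h0, h1, h2⟩ := exists_perm_fin_three hij hjk hik
      exact ⟨π, h2, by rwa [h0], by rwa [h0], by rwa [h1], by rwa [h1]⟩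
    · have hmj : m j = 0 := (mul_eq_zero.1 hM).resolve_left hmi
      have hnj : n j ≠ 0 := hj.resolve_left (not_not.2 hmj)
      have hni : n i = 0 := (mul_eq_zero.1 hN).resolve_right hnj
      obtain ⟨π, h0, h1, h2⟩ := exists_perm_fin_three hij.symm hik hjk
      exact ⟨π, h2, by rwa [h0], by rwa [h0], by rwa [h1], by rwa [h1]⟩
  have others : ∀ k : Fin 3, ∃ i j, i ≠ j ∧ j ≠ k ∧ i ≠ k := by decide
  -- A constant function leads to (G).
  by_cases hz : ∃ k, m k = 0 ∧ n k = 0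
  · obtain ⟨k, hmk, hnk⟩ := hz
    obtain ⟨i, j, hij, hjk, hik⟩ := others k
    have e1 := h.m_eq i j k hij hjk hik
    have e2 := h.n_eq i j k hij hjk hik
    rw [hmk, mul_zero, eq_comm, mul_eq_zero] at e1
    rw [hnk, mul_zero, eq_comm, mul_eq_zero] at e2
    obtain ⟨π, p2, p0, p0', p1, p1'⟩ := split j i k hij.symm hik hjk
      (by linear_combination e1.resolve_left two_ne_zero)
      (by linear_combination e2.resolve_left two_ne_zero)
      (by by_contra! hc; exact hne j k hjk ⟨hc.1, hc.2, hmk, hnk⟩)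
      (by by_contra! hc; exact hne i k hik ⟨hc.1, hc.2, hmk, hnk⟩)
    refine FamilyForm.of_perm (π * Equiv.swap 0 1) ?_
    refine familyForm_G hω (h.perm (π * Equiv.swap 0 1)) ?_ ?_ ?_ ?_ ?_ ?_ ?_
    · simpa using p1
    · simpa using p1'
    · simpa using p0'
    · simpa using p0
    · simpa [Equiv.swap_apply_of_ne_of_ne, p2] using hmk
    · simpa [Equiv.swap_apply_of_ne_of_ne, p2] using hnk
    · simpa [Equiv.swap_apply_of_ne_of_ne, p2] using hr k hmk hnk
  push Not at hz
  have hor : ∀ i, m i ≠ 0 ∨ n i ≠ 0 := fun i => by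
    by_cases hi : m i = 0
    · exact Or.inr (hz i hi)
    · exact Or.inl hi
  -- If some function has both exponentials, either all have, which gives (B) or (I), or the other
  -- two have one each, which gives (E) or (H).
  by_cases hk : ∃ k, m k ≠ 0 ∧ n k ≠ 0
  · obtain ⟨k, hmk, hnk⟩ := hk
    by_cases hall : ∀ i, m i ≠ 0 ∧ n i ≠ 0
    · exact familyForm_of_forall_ne_zero hω h (fun i => (hall i).1) fun i => (hall i).2
    push Not at hall
    obtain ⟨i, hi⟩ := hall
    have hmn : m i * n i = 0 := by
      by_cases hmi : m i = 0
      · rw [hmi, zero_mul]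
      · rw [hi hmi, mul_zero]
    have hik : i ≠ k := by
      rintro rfl
      exact mul_ne_zero hmk hnk hmn
    obtain ⟨j, hij, hjk⟩ : ∃ j, i ≠ j ∧ j ≠ k := by
      revert hik
      clear * -
      revert i k
      decide
    have e1 := h.m_eq i j k hij hjk hik
    have e2 := h.n_eq i j k hij hjk hik
    have e3 := h.m_eq j k i hjk hik.symm hij.symm
    have e4 := h.n_eq j k i hjk hik.symm hij.symm
    -- Since function i lacks an exponential, r i + r j = 0. The conditions for k then give m i m j
    -- = n i n j = 0, so function j lacks the opposite one.
    have hN : m k * (n i * n j) * n k = 0 := by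
      linear_combination (-m k * e3 * n i + (r j + r k) * m k * hmn) / 2
    have hrr : (r i + r j) * (m k * m k * n k) = 0 := by
      linear_combination (m k * n k) * e1 + 2 * hN
    have hsum : r i + r j = 0 := (mul_eq_zero.1 hrr).resolve_right (by simp [hmk, hnk])
    rw [hsum, zero_mul, eq_comm, mul_eq_zero] at e1 e2
    obtain ⟨π, p2, p0, p0', p1, p1'⟩ := split i j k hij hjk hik (e1.resolve_left two_ne_zero)
      (e2.resolve_left two_ne_zero) (hor i) (hor j)
    exact FamilyForm.of_perm π (familyForm_H hω (h.perm π) p0' p0 p1 p1' (by rwa [p2])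
      (by rwa [p2]))
  · push Not at hk
    -- every function has exactly one exponential
    have two : ∀ {m n : Fin 3 → ℂ}, ExpCondition r m n → (∀ k, m k ≠ 0 → n k = 0) →
        (∀ i, m i ≠ 0 ∨ n i ≠ 0) → (∃ i j, i ≠ j ∧ m i = 0 ∧ m j = 0) → ∀ {ω : ℂ}, ω ≠ 0 →
        FamilyForm fun i => expPoly ω (r i) (m i) (n i) := by
      rintro m n h hk hor ⟨i, j, hij, hmi, hmj⟩ ω hω
      obtain ⟨k, hjk, hik⟩ : ∃ k, j ≠ k ∧ i ≠ k := by
        revert hij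
        clear * -
        revert i j
        decide
      have hni := (hor i).resolve_left (not_not.2 hmi)
      have hnj := (hor j).resolve_left (not_not.2 hmj)
      have e1 := h.m_eq i j k hij hjk hik
      have hmk : m k ≠ 0 := by
        intro h0
        rw [h0, mul_zero] at e1
        exact mul_ne_zero two_ne_zero (mul_ne_zero hni hnj) e1.symm
      obtain ⟨π, rfl, rfl, rfl⟩ := exists_perm_fin_three hij hjk hik
      exact FamilyForm.of_perm π (familyForm_F hω (h.perm π) hni hmi hnj hmj hmk (hk _ hmk))
    -- Two of the three functions contain the same exponential.
    have hpig : (∃ i j, i ≠ j ∧ m i = 0 ∧ m j = 0) ∨ ∃ i j, i ≠ j ∧ n i = 0 ∧ n j = 0 := by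
      have hmn : ∀ i, m i = 0 ∨ n i = 0 := fun i => by
        by_cases hi : m i = 0
        · exact Or.inl hi
        · exact Or.inr (hk i hi)
      rcases hmn 0 with h0 | h0 <;> rcases hmn 1 with h1 | h1 <;> rcases hmn 2 with h2 | h2
      · exact Or.inl ⟨0, 1, by decide, h0, h1⟩
      · exact Or.inl ⟨0, 1, by decide, h0, h1⟩
      · exact Or.inl ⟨0, 2, by decide, h0, h2⟩
      · exact Or.inr ⟨1, 2, by decide, h1, h2⟩
      · exact Or.inl ⟨1, 2, by decide, h1, h2⟩
      · exact Or.inr ⟨0, 2, by decide, h0, h2⟩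
      · exact Or.inr ⟨0, 1, by decide, h0, h1⟩
      · exact Or.inr ⟨0, 1, by decide, h0, h1⟩
    rcases hpig with hp | hp
    · exact two h hk hor hp hω
    · have hk' : ∀ k, n k ≠ 0 → m k = 0 := fun k hn => by
        by_contra hm
        exact hn (hk k hm)
      -- The sign of ω is changed to exchange the two exponentials.
      have := two h.symm hk' (fun i => (hor i).symm) hp (neg_ne_zero.2 hω)
      simpa only [expPoly_neg] using this

end Classification

/-! ### From second order jets to normal forms; families (A), (C), (D). -/

section Jets

/-- The conditions on the second order jets of a solution of the functional equation. -/
structure JetCondition (κ : ℂ) (A B C : Fin 3 → ℂ) : Prop where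
  first : (A 1 + A 2) * B 0 + (A 2 + A 0) * B 1 + (A 0 + A 1) * B 2 = 0
  second : ∀ i j k : Fin 3, i ≠ j → j ≠ k → i ≠ k →
    (A j + A k) * C i + B i * (B j + B k) = (A k + A i) * C j + B j * (B i + B k)
  third : ∀ i j k : Fin 3, i ≠ j → j ≠ k → i ≠ k →
    (A j + A k) * (κ * B i) = (B i - B k) * C j + (B i - B j) * C k
  fourth : ∀ i j k : Fin 3, i ≠ j → j ≠ k → i ≠ k →
    (A j + A k) * (κ * C i) = C i * C j + C i * C k + C j * C k + κ * (B j * B k)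

variable {κ : ℂ} {A B C : Fin 3 → ℂ}

theorem JetCondition.perm (h : JetCondition κ A B C) (π : Equiv.Perm (Fin 3)) :
    JetCondition κ (fun i => A (π i)) (fun i => B (π i)) (fun i => C (π i)) where
  first := by
    have hA := Equiv.sum_comp π A
    have hB := Equiv.sum_comp π B
    have hAB := Equiv.sum_comp π (fun i => A i * B i)
    simp only [Fin.sum_univ_three] at hA hB hAB
    have h1 := h.first
    have h2 : (A 0 + A 1 + A 2) * (B 0 + B 1 + B 2) -
      (A 0 * B 0 + A 1 * B 1 + A 2 * B 2) = 0 := by linear_combination h1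
    rw [← hA, ← hB, ← hAB] at h2
    linear_combination h2
  second _ _ _ hij hjk hik := h.second _ _ _ (π.injective.ne hij) (π.injective.ne hjk)
    (π.injective.ne hik)
  third _ _ _ hij hjk hik := h.third _ _ _ (π.injective.ne hij) (π.injective.ne hjk)
    (π.injective.ne hik)
  fourth _ _ _ hij hjk hik := h.fourth _ _ _ (π.injective.ne hij) (π.injective.ne hjk)
    (π.injective.ne hik)

/-- The jet of r + m e^{ωs} + n e^{-ωs} at 0 is A = r + m + n, B = ω(m - n), C = ω²(m + n). The
combinations `fourth` ± ω `third` separate the two exponentials. -/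
theorem JetCondition.familyForm_exp {ω : ℂ} (h : JetCondition (ω ^ 2) A B C) (hω : ω ≠ 0)
    (hA : ∀ i, A i ≠ 0) (hne : ∀ i j, i ≠ j → ¬ (B i = 0 ∧ C i = 0 ∧ B j = 0 ∧ C j = 0)) :
    FamilyForm fun i => expPoly ω (A i - C i / ω ^ 2) ((C i / ω ^ 2 + B i / ω) / 2)
      ((C i / ω ^ 2 - B i / ω) / 2) := by
  have hzero : ∀ i, (C i / ω ^ 2 + B i / ω) / 2 = 0 → (C i / ω ^ 2 - B i / ω) / 2 = 0 →
      B i = 0 ∧ C i = 0 := by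
    intro i h1 h2
    have hB : B i / ω = 0 := by linear_combination h1 - h2
    have hC : C i / ω ^ 2 = 0 := by linear_combination h1 + h2
    exact ⟨(div_eq_zero_iff.1 hB).resolve_right hω,
      (div_eq_zero_iff.1 hC).resolve_right (pow_ne_zero 2 hω)⟩
  refine familyForm_of_expCondition hω ⟨?_, ?_⟩ ?_ ?_
  · intro i j k hij hjk hik
    have e3 := h.third k i j hik.symm hij hjk.symm
    have e4 := h.fourth k i j hik.symm hij hjk.symm
    field_simp
    linear_combination ω * e3 + e4
  · intro i j k hij hjk hik
    have e3 := h.third k i j hik.symm hij hjk.symm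
    have e4 := h.fourth k i j hik.symm hij hjk.symm
    field_simp
    linear_combination -ω * e3 + e4
  · rintro i j hij ⟨h1, h2, h3, h4⟩
    obtain ⟨e1, e2⟩ := hzero i h1 h2
    obtain ⟨e3, e4⟩ := hzero j h3 h4
    exact hne i j hij ⟨e1, e2, e3, e4⟩
  · intro i h1 h2
    obtain ⟨-, e2⟩ := hzero i h1 h2
    simpa [e2] using hA i

/-- The families with quadratic reciprocals of the derivatives. -/
theorem JetCondition.familyForm_AC (h : JetCondition 0 A B C) (hC : ∀ i, C i ≠ 0) :
    FamilyForm fun i => quadPoly (C i / 2) (B i) (A i) := by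
  have h0 := hC 0
  have h1 := hC 1
  have h2 := hC 2
  have f := h.fourth 0 1 2 (by decide) (by decide) (by decide)
  have t0 := h.third 0 1 2 (by decide) (by decide) (by decide)
  have t1 := h.third 1 2 0 (by decide) (by decide) (by decide)
  have s01 := h.second 0 1 2 (by decide) (by decide) (by decide)
  have s12 := h.second 1 2 0 (by decide) (by decide) (by decide)
  simp only [zero_mul, mul_zero, add_zero] at f t0 t1
  -- completing the squares
  obtain ⟨e, he⟩ : ∃ e : Fin 3 → ℂ, ∀ i, B i = -(C i * e i) :=
    ⟨fun i => -(B i / C i), fun i => by have := hC i; field_simp⟩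
  obtain ⟨R, hR⟩ : ∃ R : Fin 3 → ℂ, ∀ i, A i = R i + C i * e i ^ 2 / 2 :=
    ⟨fun i => A i - C i * e i ^ 2 / 2, fun i => by ring⟩
  simp only [he, hR] at t0 t1 s01 s12
  -- The vertices e i of the parabolas have zero sum, so they can serve as the balanced shift.
  have hsum : e 0 + e 1 + e 2 = 0 := by
    refine (mul_eq_zero.1 (?_ : C 1 * C 2 * (e 0 + e 1 + e 2) = 0)).resolve_left
      (mul_ne_zero h1 h2)
    linear_combination -t0 - e 0 * f
  have he2 : e 2 = -(e 0 + e 1) := by linear_combination hsum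
  have hf : C 0 * C 1 = -(C 2 * (C 0 + C 1)) := by linear_combination -f
  have g01 : (R 1 + R 2) * C 0 = (R 2 + R 0) * C 1 := by
    rw [he2] at s01
    linear_combination s01 + (e 1 ^ 2 - e 0 ^ 2) / 2 * f
  have g12 : (R 2 + R 0) * C 1 = (R 0 + R 1) * C 2 := by
    rw [he2] at s12
    linear_combination s12 + ((e 0 + e 1) ^ 2 - e 1 ^ 2) / 2 * f
  have hμ : (-2 / C 2) + (-2 / C 0) + (-2 / C 1) = 0 := by
    field_simp
    linear_combination 2 * f
  -- The common value of the products in `g01` and `g12`. With the zero sum of the -2/C i it makes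
  -- the minimal values R i proportional to -2/C i.
  obtain ⟨τ, hτ⟩ : ∃ τ, (R 1 + R 2) * C 0 = 2 * τ := ⟨(R 1 + R 2) * C 0 / 2, by ring⟩
  have q0 : R 1 + R 2 = 2 * τ / C 0 := by rw [eq_div_iff h0, hτ]
  have q1 : R 2 + R 0 = 2 * τ / C 1 := by rw [eq_div_iff h1, ← g01, hτ]
  have q2 : R 0 + R 1 = 2 * τ / C 2 := by rw [eq_div_iff h2, ← g12, ← g01, hτ]
  have hRτ : ∀ i, R i = τ * (-2 / C i) := by
    refine forall_fin_three ?_ ?_ ?_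
    · linear_combination (q1 + q2 - q0 - τ * hμ) / 2
    · linear_combination (q0 + q2 - q1 - τ * hμ) / 2
    · linear_combination (q0 + q1 - q2 - τ * hμ) / 2
  -- Pure squares give (A). Otherwise rescaling the variable by c with c² = 1/τ gives (C).
  by_cases hτ0 : τ = 0
  · refine ⟨.A (-2 / C 0) (-2 / C 1) (-2 / C 2), hμ, 1, 1, 1, e, one_ne_zero, one_ne_zero, hsum,
      forall_fin_three ?_ ?_ ?_⟩ <;> intro s <;>
    simp [LatticeFamily.recip, quadPoly, he, hR, hRτ, hτ0] <;> field_simp <;> ring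
  · obtain ⟨c, hc⟩ := IsAlgClosed.exists_pow_nat_eq τ⁻¹ (n := 2) two_pos
    have hc0 : c ≠ 0 := by
      rintro rfl
      exact inv_ne_zero hτ0 (by rw [← hc]; simp)
    have hc' : τ * c ^ 2 = 1 := by rw [hc, mul_inv_cancel₀ hτ0]
    have key : ∀ i s, quadPoly (C i / 2) (B i) (A i) s =
        τ * quadPoly (-1 / (-2 / C i)) 0 (-2 / C i) (c * (s - e i)) := by
      intro i s
      have := hC i
      simp only [quadPoly, he, hR, hRτ]
      field_simp
      linear_combination -(C i) ^ 2 * (s - e i) ^ 2 * hc'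
    exact ⟨.C (-2 / C 0) (-2 / C 1) (-2 / C 2), hμ, 1, c, τ, e, hc0, hτ0, hsum,
      forall_fin_three (key 0) (key 1) (key 2)⟩

/-- The two affine functions have the same slope by `third`. The remaining conditions determine the
coefficients B 2 and A 2 of the quadratic function. -/
theorem JetCondition.familyForm_D (h : JetCondition 0 A B C) (h0 : C 0 = 0) (h1 : C 1 = 0)
    (h2 : C 2 ≠ 0) (hne : ¬ (B 0 = 0 ∧ B 1 = 0)) :
    FamilyForm fun i => quadPoly (C i / 2) (B i) (A i) := by
  have f := h.first
  have t0 := h.third 0 1 2 (by decide) (by decide) (by decide)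
  have s02 := h.second 0 2 1 (by decide) (by decide) (by decide)
  have hB : B 1 = B 0 := by
    rw [h1, zero_mul, mul_zero, mul_zero, zero_add] at t0
    linear_combination -(mul_eq_zero.1 t0.symm).resolve_right h2
  have hq : B 0 ≠ 0 := fun hq => hne ⟨hq, hB.trans hq⟩
  rw [h0, hB] at s02
  rw [hB] at f
  have hB2 : B 2 = B 0 - C 2 * (A 0 + A 1) / B 0 := by
    field_simp
    linear_combination -s02
  have hA2 : A 2 = C 2 / 2 * ((A 0 + A 1) / B 0) ^ 2 - (A 0 + A 1) := by
    rw [hB2] at f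
    field_simp at f ⊢
    linear_combination f
  refine ⟨.D, trivial, 1, C 2 / (2 * B 0), 2 * B 0 ^ 2 / C 2,
    ![-(A 0 / B 0), -(A 1 / B 0), (A 0 + A 1) / B 0],
    div_ne_zero h2 (mul_ne_zero two_ne_zero hq),
    div_ne_zero (mul_ne_zero two_ne_zero (pow_ne_zero 2 hq)) h2, ?_, forall_fin_three ?_ ?_ ?_⟩
  · simp
    field_simp
    ring
  · intro s
    simp [LatticeFamily.recip, quadPoly, h0]
    field_simp
  · intro s
    simp [LatticeFamily.recip, quadPoly, h1, hB]
    field_simp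
  · intro s
    simp only [LatticeFamily.recip, quadPoly, hA2, hB2, Equiv.Perm.coe_one, id, Matrix.cons_val]
    field_simp
    ring

/-- For κ = 0 the relation `fourth` says that the pairwise products of the C's have sum zero. Hence
either no C vanishes, or exactly two do, or all do. -/
theorem JetCondition.familyForm_quad (h : JetCondition 0 A B C)
    (hne : ∀ i j, i ≠ j → ¬ (B i = 0 ∧ C i = 0 ∧ B j = 0 ∧ C j = 0))
    (hs : A 0 + A 1 + A 2 ≠ 0) : FamilyForm fun i => quadPoly (C i / 2) (B i) (A i) := by
  have others : ∀ k : Fin 3, ∃ i j, i ≠ j ∧ j ≠ k ∧ i ≠ k := by decide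
  by_cases hall : ∀ i, C i ≠ 0
  · exact h.familyForm_AC hall
  push Not at hall
  obtain ⟨i, hi⟩ := hall
  by_cases hex : ∃ k, C k ≠ 0
  · obtain ⟨k, hk⟩ := hex
    have hik : i ≠ k := by
      rintro rfl
      exact hk hi
    obtain ⟨j, hij, hjk⟩ : ∃ j, i ≠ j ∧ j ≠ k := by
      clear hi hk
      revert hik
      clear * -
      revert i k
      decide
    have f := h.fourth i j k hij hjk hik
    have hj : C j = 0 := by
      simp only [hi, zero_mul, mul_zero, zero_add, add_zero] at f
      exact (mul_eq_zero.1 f.symm).resolve_right hk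
    obtain ⟨π, rfl, rfl, rfl⟩ := exists_perm_fin_three hij hjk hik
    exact FamilyForm.of_perm π ((h.perm π).familyForm_D hi hj hk
      fun hB => hne _ _ hij ⟨hB.1, hi, hB.2, hj⟩)
  · push Not at hex
    exfalso
    -- All three functions are affine. Their slopes turn out nonzero and equal, and `first` reduces
    -- to 2B(A₀ + A₁ + A₂) = 0, against `hs`.
    have e : ∀ i j k : Fin 3, i ≠ j → j ≠ k → i ≠ k → B k * (B i - B j) = 0 := by
      intro i j k hij hjk hik
      have := h.second i j k hij hjk hik
      simp only [hex, mul_zero, zero_add] at this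
      linear_combination this
    have hB : ∀ k, B k ≠ 0 := by
      intro k hk
      obtain ⟨i, j, hij, hjk, hik⟩ := others k
      have := e i k j hik hjk.symm hij
      rw [hk, sub_zero, mul_eq_zero] at this
      rcases this with h1 | h1
      · exact hne j k hjk ⟨h1, hex j, hk, hex k⟩
      · exact hne i k hik ⟨h1, hex i, hk, hex k⟩
    have e1 := (mul_eq_zero.1 (e 0 1 2 (by decide) (by decide) (by decide))).resolve_left (hB 2)
    have e2 := (mul_eq_zero.1 (e 0 2 1 (by decide) (by decide) (by decide))).resolve_left (hB 1)
    refine mul_ne_zero (mul_ne_zero two_ne_zero (hB 0)) hs ?_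
    linear_combination h.first + (A 2 + A 0) * e1 + (A 0 + A 1) * e2

end Jets

/-! ### Functions recovered from the reciprocals of their derivatives. -/

section Primitives

/-- The analytic functions with values in `V` are the functions whose derivative is `1 / r`. -/
structure IsPrimitiveOf (𝕜 : Type*) [RCLike 𝕜] [NormedAlgebra 𝕜 ℂ] (V : ℂ → ℂ → Prop)
    (r : ℂ → ℂ) : Prop where
  differentiate : ∀ (s w : 𝕜 → ℂ) (t : 𝕜) (s' w' : ℂ), HasDerivAt s s' t → HasDerivAt w w' t →
    w' ≠ 0 → (∀ᶠ t in 𝓝 t, V (s t) (w t)) → r (s t) * w' = s'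
  integrate : ∀ (s w s' w' : 𝕜 → ℂ) (t : 𝕜), (∀ᶠ t in 𝓝 t, HasDerivAt s (s' t) t) →
    (∀ᶠ t in 𝓝 t, HasDerivAt w (w' t) t) →
    (∀ᶠ t in 𝓝 t, r (s t) ≠ 0 ∧ r (s t) * w' t = s' t) → ∃ a, ∀ᶠ t in 𝓝 t, V (s t) (w t + a)

variable {𝕜 : Type*} [RCLike 𝕜] [NormedAlgebra 𝕜 ℂ] {V : ℂ → ℂ → Prop} {r : ℂ → ℂ}

theorem isPrimitiveOf_explicit {dom : ℂ → Prop} {R R' : ℂ → ℂ}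
    (hV : ∀ s w, V s w ↔ dom s ∧ w = R s) (hR : ∀ s, dom s → HasDerivAt R (R' s) s)
    (h1 : ∀ s, dom s → R' s ≠ 0 → r s * R' s = 1) (h2 : ∀ s, r s ≠ 0 → dom s ∧ r s * R' s = 1) :
    IsPrimitiveOf 𝕜 V r where
  differentiate s w t s' w' hs hw hne hv := by
    have hd := (hV _ _).1 hv.self_of_nhds
    have hc := (hR _ hd.1).comp t hs
    have he : w' = R' (s t) * s' :=
      hw.unique (hc.congr_of_eventuallyEq (hv.mono fun t ht => ((hV _ _).1 ht).2))
    rw [he, ← mul_assoc, h1 _ hd.1 (left_ne_zero_of_mul (he ▸ hne)), one_mul]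
  integrate s w s' w' t hs hw hr := by
    have hd : ∀ᶠ t in 𝓝 t, HasDerivAt (fun t => R (s t) - w t) 0 t := by
      filter_upwards [hs, hw, hr] with t hs hw hr
      obtain ⟨hd, he⟩ := h2 _ hr.1
      refine (((hR _ hd).comp t hs).sub hw).congr_deriv ?_
      rw [← hr.2, ← mul_assoc, mul_comm (R' _), he, one_mul, sub_self]
    refine ⟨R (s t) - w t, ?_⟩
    filter_upwards [eventually_eq_of_hasDerivAt_zero hd, hr] with t' ht' hr'
    exact (hV _ _).2 ⟨(h2 _ hr'.1).1, by rw [← ht']; ring⟩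

/-- Logarithms are handled through e^{δw} = R(s), so that no branch has to be chosen: δw' = R's'/R,
hence r = δR/R'. -/
theorem isPrimitiveOf_exp {dom : ℂ → Prop} {R R' : ℂ → ℂ} {δ : ℂ} (hδ : δ ≠ 0)
    (hV : ∀ s w, V s w ↔ dom s ∧ Complex.exp (δ * w) = R s)
    (hR : ∀ s, dom s → HasDerivAt R (R' s) s)
    (h1 : ∀ s, dom s → R s ≠ 0 → R' s ≠ 0 → r s * R' s = δ * R s)
    (h2 : ∀ s, r s ≠ 0 → dom s ∧ R s ≠ 0 ∧ r s * R' s = δ * R s) : IsPrimitiveOf 𝕜 V r where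
  differentiate s w t s' w' hs hw hne hv := by
    have hd := (hV _ _).1 hv.self_of_nhds
    have hc := (hR _ hd.1).comp t hs
    have hR0 : R (s t) ≠ 0 := hd.2 ▸ Complex.exp_ne_zero _
    have he : Complex.exp (δ * w t) * (δ * w') = R' (s t) * s' :=
      (hw.const_mul δ).cexp.unique
        (hc.congr_of_eventuallyEq (hv.mono fun t ht => ((hV _ _).1 ht).2))
    have hne' : R' (s t) * s' ≠ 0 := he ▸ mul_ne_zero (Complex.exp_ne_zero _) (mul_ne_zero hδ hne)
    have := h1 _ hd.1 hR0 (left_ne_zero_of_mul hne')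
    rw [hd.2] at he
    refine mul_left_cancel₀ (mul_ne_zero hδ hR0) ?_
    linear_combination r (s t) * he + s' * this
  integrate s w s' w' t hs hw hr := by
    have hd : ∀ᶠ t in 𝓝 t, HasDerivAt (fun t => R (s t) * Complex.exp (δ * -w t)) 0 t := by
      filter_upwards [hs, hw, hr] with t hs hw hr
      obtain ⟨hd, -, he⟩ := h2 _ hr.1
      refine (((hR _ hd).comp t hs).mul (hw.neg.const_mul δ).cexp).congr_deriv ?_
      rw [← hr.2]
      simp only [Function.comp]
      linear_combination (w' t * Complex.exp (δ * -w t)) * he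
    obtain ⟨-, hR0, -⟩ := h2 _ hr.self_of_nhds.1
    have hne : R (s t) * Complex.exp (δ * -w t) ≠ 0 := mul_ne_zero hR0 (Complex.exp_ne_zero _)
    -- R e^{-δw} is locally constant. A logarithm of its value, divided by δ, is the constant of
    -- integration.
    refine ⟨Complex.log (R (s t) * Complex.exp (δ * -w t)) / δ, ?_⟩
    filter_upwards [eventually_eq_of_hasDerivAt_zero hd, hr] with t' ht' hr'
    refine (hV _ _).2 ⟨(h2 _ hr'.1).1, ?_⟩
    rw [mul_add, mul_div_cancel₀ _ hδ, Complex.exp_add, Complex.exp_log hne, ← ht', mul_left_comm,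
      ← Complex.exp_add]
    simp

end Primitives

/-! ### The functions of each family as primitives. -/

section FamilyPrimitives

variable {𝕜 : Type*} [RCLike 𝕜] [NormedAlgebra 𝕜 ℂ]

theorem isPrimitiveOf_div (μ : ℂ) :
    IsPrimitiveOf 𝕜 (fun s w => s ≠ 0 ∧ w = μ / s) (quadPoly (-1 / μ) 0 0) := by
  refine isPrimitiveOf_explicit (dom := fun s => s ≠ 0) (R := fun s => μ / s)
    (R' := fun s => -(μ / s ^ 2)) (fun s w => Iff.rfl) (fun s hs => ?_) (fun s hs h => ?_)
    (fun s hr => ?_)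
  · refine ((hasDerivAt_const s μ).div (hasDerivAt_id s) hs).congr_deriv ?_
    simp [neg_div]
  · have hμ : μ ≠ 0 := by rintro rfl; simp at h
    simp only [quadPoly]
    field_simp
    ring
  · have hμ : μ ≠ 0 := by rintro rfl; simp [quadPoly] at hr
    have hs : s ≠ 0 := by rintro rfl; simp [quadPoly] at hr
    refine ⟨hs, ?_⟩
    simp only [quadPoly]
    field_simp
    ring

theorem expPoly_two_eq {μ : ℂ} (hμ : μ ≠ 0) (s : ℂ) :
    expPoly 2 (1 / (2 * μ)) (-1 / (4 * μ)) (-1 / (4 * μ)) s = -(Complex.sinh s) ^ 2 / μ := by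
  have h : Complex.cosh (2 * s) = 1 + 2 * Complex.sinh s ^ 2 := by
    rw [Complex.cosh_two_mul, Complex.cosh_sq]; ring
  have h' : Complex.exp (2 * s) + Complex.exp (-(2 * s)) = 2 + 4 * Complex.sinh s ^ 2 := by
    rw [Complex.cosh] at h
    linear_combination 2 * h
  simp only [expPoly]
  field_simp
  linear_combination -2 * h'

theorem isPrimitiveOf_coth (μ : ℂ) :
    IsPrimitiveOf 𝕜
      (fun s w => Complex.sinh s ≠ 0 ∧ w = μ * (Complex.cosh s / Complex.sinh s))
      (expPoly 2 (1 / (2 * μ)) (-1 / (4 * μ)) (-1 / (4 * μ))) := by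
  refine isPrimitiveOf_explicit (dom := fun s => Complex.sinh s ≠ 0)
    (R := fun s => μ * (Complex.cosh s / Complex.sinh s))
    (R' := fun s => -(μ / Complex.sinh s ^ 2)) (fun s w => Iff.rfl) (fun s hs => ?_)
    (fun s hs h => ?_) (fun s hr => ?_)
  · refine (((Complex.hasDerivAt_cosh s).div (Complex.hasDerivAt_sinh s) hs).const_mul
      μ).congr_deriv ?_
    have := Complex.cosh_sq s
    field_simp
    linear_combination -μ * this
  · have hμ : μ ≠ 0 := by rintro rfl; simp at h
    rw [expPoly_two_eq hμ]
    field_simp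
  · have hμ : μ ≠ 0 := by rintro rfl; simp [expPoly] at hr
    rw [expPoly_two_eq hμ] at hr ⊢
    have hs : Complex.sinh s ≠ 0 := by intro h; simp [h] at hr
    refine ⟨hs, ?_⟩
    field_simp

theorem isPrimitiveOf_log_div (μ : ℂ) :
    IsPrimitiveOf 𝕜 (fun s w => s ≠ μ ∧ Complex.exp (2 * w) = (s + μ) / (s - μ))
      (quadPoly (-1 / μ) 0 μ) := by
  refine isPrimitiveOf_exp (dom := fun s => s ≠ μ) (R := fun s => (s + μ) / (s - μ))
    (R' := fun s => -(2 * μ) / (s - μ) ^ 2) two_ne_zero (fun s w => Iff.rfl) (fun s hs => ?_)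
    (fun s hs h0 h => ?_) (fun s hr => ?_)
  · refine (((hasDerivAt_id s).add_const μ).div ((hasDerivAt_id s).sub_const μ)
      (sub_ne_zero.2 hs)).congr_deriv ?_
    simp only [id]
    congr 1
    ring
  · have hμ : μ ≠ 0 := by rintro rfl; simp at h
    have := sub_ne_zero.2 hs
    simp only [quadPoly]
    field_simp
    ring
  · have hμ : μ ≠ 0 := by rintro rfl; simp [quadPoly] at hr
    have e : quadPoly (-1 / μ) 0 μ s = -((s - μ) * (s + μ)) / μ := by
      simp only [quadPoly]
      field_simp
      ring
    rw [e] at hr ⊢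
    have h1 : s - μ ≠ 0 := by intro h; simp [h] at hr
    have h2 : s + μ ≠ 0 := by intro h; simp [h] at hr
    refine ⟨sub_ne_zero.1 h1, div_ne_zero h2 h1, ?_⟩
    field_simp

theorem IsPrimitiveOf.congr {V V' : ℂ → ℂ → Prop} {r : ℂ → ℂ} (h : IsPrimitiveOf 𝕜 V r)
    (hV : ∀ s w, V' s w ↔ V s w) : IsPrimitiveOf 𝕜 V' r := by
  have : V' = V := by
    funext s w
    exact propext (hV s w)
  rwa [this]

theorem isPrimitiveOf_D₀ : IsPrimitiveOf 𝕜 (fun s w => Complex.exp w = s) (quadPoly 0 1 0) := by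
  refine isPrimitiveOf_exp (dom := fun _ => True) (R := fun s => s) (R' := fun _ => 1)
    one_ne_zero (fun s w => by simp) (fun s hs => hasDerivAt_id s)
    (fun s hs h0 h => by simp [quadPoly]) (fun s hr => ⟨trivial, ?_, by simp [quadPoly]⟩)
  simpa [quadPoly] using hr

theorem isPrimitiveOf_D₂ : IsPrimitiveOf 𝕜
    (fun s w => -s ≠ 0 ∧ Complex.exp (-w) = 1 - 1 / -s) (quadPoly 1 1 0) := by
  refine isPrimitiveOf_exp (dom := fun s => s ≠ 0) (R := fun s => 1 - 1 / -s)
    (R' := fun s => -1 / s ^ 2) (δ := -1) (by simp) (fun s w => by simp) (fun s hs => ?_)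
    (fun s hs h0 h => ?_) (fun s hr => ?_)
  · refine ((hasDerivAt_const s 1).sub ((hasDerivAt_const s 1).div (hasDerivAt_neg s)
      (neg_ne_zero.2 hs))).congr_deriv ?_
    field_simp
    ring
  · simp only [quadPoly]
    field_simp
    ring
  · have e : quadPoly 1 1 0 s = s * (s + 1) := by simp only [quadPoly]; ring
    rw [e] at hr ⊢
    have hs : s ≠ 0 := left_ne_zero_of_mul hr
    have h1 : s + 1 ≠ 0 := right_ne_zero_of_mul hr
    refine ⟨hs, ?_, ?_⟩
    · have : 1 - 1 / -s = (s + 1) / s := by field_simp; ring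
      rw [this]
      exact div_ne_zero h1 hs
    · field_simp
      ring

theorem isPrimitiveOf_E₀ :
    IsPrimitiveOf 𝕜 (fun s w => w = -Complex.exp s - 1) (expPoly 1 0 0 (-1)) := by
  have key : ∀ s, expPoly 1 0 0 (-1) s * -Complex.exp s = 1 := fun s => by
    simp [expPoly, ← Complex.exp_add]
  exact isPrimitiveOf_explicit (dom := fun _ => True) (R := fun s => -Complex.exp s - 1)
    (R' := fun s => -Complex.exp s) (fun s w => by simp)
    (fun s _ => (Complex.hasDerivAt_exp s).neg.sub_const 1) (fun s _ _ => key s)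
    (fun s _ => ⟨trivial, key s⟩)

theorem isPrimitiveOf_E₁ :
    IsPrimitiveOf 𝕜 (fun s w => w = Complex.exp (-s)) (expPoly 1 0 (-1) 0) := by
  have key : ∀ s, expPoly 1 0 (-1) 0 s * -Complex.exp (-s) = 1 := fun s => by
    simp [expPoly, ← Complex.exp_add]
  exact isPrimitiveOf_explicit (dom := fun _ => True) (R := fun s => Complex.exp (-s))
    (R' := fun s => -Complex.exp (-s)) (fun s w => by simp)
    (fun s _ => (hasDerivAt_neg s).cexp.congr_deriv (by ring)) (fun s _ _ => key s)
    (fun s _ => ⟨trivial, key s⟩)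

theorem isPrimitiveOf_E₂ : IsPrimitiveOf 𝕜
    (fun s w => 1 + Complex.exp (-s) ≠ 0 ∧ -w = 1 / (1 + Complex.exp (-s)))
    (expPoly 1 (-2) (-1) (-1)) := by
  have e : ∀ s, expPoly 1 (-2) (-1) (-1) s * Complex.exp (-s) = -(1 + Complex.exp (-s)) ^ 2 := by
    intro s
    have := Complex.exp_ne_zero s
    simp only [expPoly, one_mul, Complex.exp_neg]
    field_simp
    ring
  have key : ∀ s, 1 + Complex.exp (-s) ≠ 0 → expPoly 1 (-2) (-1) (-1) s *
      -(Complex.exp (-s) / (1 + Complex.exp (-s)) ^ 2) = 1 := by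
    intro s hs
    rw [mul_neg, ← mul_div_assoc, e]
    field_simp
  refine isPrimitiveOf_explicit (dom := fun s => 1 + Complex.exp (-s) ≠ 0)
    (R := fun s => -(1 / (1 + Complex.exp (-s))))
    (R' := fun s => -(Complex.exp (-s) / (1 + Complex.exp (-s)) ^ 2))
    (fun s w => by rw [neg_eq_iff_eq_neg]) (fun s hs => ?_) (fun s hs _ => key s hs)
    (fun s hr => ?_)
  · refine ((hasDerivAt_const s 1).div ((hasDerivAt_neg s).cexp.const_add 1) hs).neg.congr_deriv ?_
    ring
  · have hs : 1 + Complex.exp (-s) ≠ 0 := by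
      intro h
      have := e s
      rw [h] at this
      exact mul_ne_zero hr (Complex.exp_ne_zero (-s)) (this.trans (by simp))
    exact ⟨hs, key s hs⟩

theorem isPrimitiveOf_exp_sub_one : IsPrimitiveOf 𝕜
    (fun s w => Complex.exp w = Complex.exp s - 1) (expPoly 1 1 0 (-1)) := by
  have key : ∀ s, expPoly 1 1 0 (-1) s * Complex.exp s = Complex.exp s - 1 := fun s => by
    simp [expPoly, add_mul, ← Complex.exp_add, sub_eq_add_neg]
  refine isPrimitiveOf_exp (dom := fun _ => True) (R := fun s => Complex.exp s - 1)
    (R' := fun s => Complex.exp s) one_ne_zero (fun s w => by simp)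
    (fun s _ => (Complex.hasDerivAt_exp s).sub_const 1) (fun s _ _ _ => by rw [key, one_mul])
    (fun s hr => ⟨trivial, ?_, by rw [key, one_mul]⟩)
  rw [← key]
  exact mul_ne_zero hr (Complex.exp_ne_zero s)

/-- Used for three functions: m = 1 for the third function of (F) and for g in (H), m = -1 for f in
(G). -/
theorem isPrimitiveOf_exp_neg_sub_one {δ m : ℂ} (hm : m * m = 1) (hδ : δ = m) :
    IsPrimitiveOf 𝕜 (fun s w => Complex.exp (δ * w) = Complex.exp (-s) - 1)
      (expPoly 1 (-m) m 0) := by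
  have hδ0 : δ ≠ 0 := hδ ▸ left_ne_zero_of_mul_eq_one hm
  have key : ∀ s, expPoly 1 (-m) m 0 s * -Complex.exp (-s) = δ * (Complex.exp (-s) - 1) := by
    intro s
    have := Complex.exp_ne_zero s
    simp only [expPoly, one_mul, Complex.exp_neg, hδ]
    field_simp
    ring
  refine isPrimitiveOf_exp (dom := fun _ => True) (R := fun s => Complex.exp (-s) - 1)
    (R' := fun s => -Complex.exp (-s)) hδ0 (fun s w => by simp)
    (fun s _ => ((hasDerivAt_neg s).cexp.sub_const 1).congr_deriv (by ring))
    (fun s _ _ _ => key s) (fun s hr => ⟨trivial, ?_, key s⟩)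
  refine right_ne_zero_of_mul (a := δ) ?_
  rw [← key]
  exact mul_ne_zero hr (neg_ne_zero.2 (Complex.exp_ne_zero _))

theorem isPrimitiveOf_G₂ : IsPrimitiveOf 𝕜 (fun s w => -w = - -s) (expPoly 1 (-1) 0 0) :=
  isPrimitiveOf_explicit (dom := fun _ => True) (R := fun s => -s) (R' := fun _ => -1)
    (fun s w => by rw [neg_neg, neg_eq_iff_eq_neg]; simp) (fun s _ => hasDerivAt_neg s)
    (fun s _ _ => by simp [expPoly]) (fun s _ => ⟨trivial, by simp [expPoly]⟩)

theorem isPrimitiveOf_H₀ {l : ℂ} (hl : l ≠ 0) : IsPrimitiveOf 𝕜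
    (fun s w => Complex.exp w = l⁻¹ * (Complex.exp s + 1)) (expPoly 1 1 0 1) := by
  have key : ∀ s, expPoly 1 1 0 1 s * (l⁻¹ * Complex.exp s) =
      1 * (l⁻¹ * (Complex.exp s + 1)) := by
    intro s
    have := Complex.exp_ne_zero s
    simp only [expPoly, one_mul, Complex.exp_neg]
    field_simp
    ring
  refine isPrimitiveOf_exp (dom := fun _ => True) (R := fun s => l⁻¹ * (Complex.exp s + 1))
    (R' := fun s => l⁻¹ * Complex.exp s) one_ne_zero (fun s w => by simp)
    (fun s _ => ((Complex.hasDerivAt_exp s).add_const 1).const_mul _) (fun s _ _ _ => key s)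
    (fun s hr => ⟨trivial, ?_, key s⟩)
  rw [← one_mul (_ * _), ← key]
  exact mul_ne_zero hr (mul_ne_zero (inv_ne_zero hl) (Complex.exp_ne_zero s))

theorem isPrimitiveOf_H₂ (l : ℂ) : IsPrimitiveOf 𝕜
    (fun s w => Complex.exp (-s) + 1 ≠ 0 ∧
      Complex.exp (-w) = (Complex.exp (-s) + l) / (Complex.exp (-s) + 1))
    (expPoly 1 ((1 + l) / (1 - l)) (l / (1 - l)) (1 / (1 - l))) := by
  have e : ∀ s, 1 - l ≠ 0 → expPoly 1 ((1 + l) / (1 - l)) (l / (1 - l)) (1 / (1 - l)) s *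
      (Complex.exp (-s) * (1 - l)) = (Complex.exp (-s) + l) * (Complex.exp (-s) + 1) := by
    intro s hl
    have := Complex.exp_ne_zero s
    simp only [expPoly, one_mul, Complex.exp_neg]
    field_simp
    ring
  have key : ∀ s, 1 - l ≠ 0 → Complex.exp (-s) + 1 ≠ 0 →
      expPoly 1 ((1 + l) / (1 - l)) (l / (1 - l)) (1 / (1 - l)) s *
      (-(Complex.exp (-s) * (1 - l)) / (Complex.exp (-s) + 1) ^ 2) =
      -1 * ((Complex.exp (-s) + l) / (Complex.exp (-s) + 1)) := by
    intro s hl hs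
    rw [← mul_div_assoc, mul_neg, e s hl]
    field_simp
  refine isPrimitiveOf_exp (dom := fun s => Complex.exp (-s) + 1 ≠ 0)
    (R := fun s => (Complex.exp (-s) + l) / (Complex.exp (-s) + 1))
    (R' := fun s => -(Complex.exp (-s) * (1 - l)) / (Complex.exp (-s) + 1) ^ 2) (δ := -1)
    (by simp) (fun s w => by simp) (fun s hs => ?_) (fun s hs _ h => key s ?_ hs) (fun s hr => ?_)
  · refine (((hasDerivAt_neg s).cexp.add_const l).div
      ((hasDerivAt_neg s).cexp.add_const 1) hs).congr_deriv ?_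
    congr 1
    ring
  · intro hl
    simp [hl] at h
  · have hl : 1 - l ≠ 0 := by
      intro hl
      simp [expPoly, hl] at hr
    have h := mul_ne_zero hr (mul_ne_zero (Complex.exp_ne_zero (-s)) hl)
    rw [e s hl] at h
    have hs := right_ne_zero_of_mul h
    exact ⟨hs, div_ne_zero (left_ne_zero_of_mul h) hs, key s hl hs⟩

theorem expPoly_I_mul {μ : ℂ} (hμ : μ ^ 2 - 1 ≠ 0) (s : ℂ) :
    expPoly 1 ((1 + μ ^ 2) / (μ ^ 2 - 1)) (μ / (μ ^ 2 - 1)) (μ / (μ ^ 2 - 1)) s *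
      (Complex.exp s * (μ ^ 2 - 1)) = (μ * Complex.exp s + 1) * (Complex.exp s + μ) := by
  have := Complex.exp_ne_zero s
  simp only [expPoly, one_mul, Complex.exp_neg]
  field_simp
  ring

theorem isPrimitiveOf_I (μ : ℂ) : IsPrimitiveOf 𝕜
    (fun s w => Complex.exp s + μ ≠ 0 ∧
      Complex.exp w = (μ * Complex.exp s + 1) / (Complex.exp s + μ))
    (expPoly 1 ((1 + μ ^ 2) / (μ ^ 2 - 1)) (μ / (μ ^ 2 - 1)) (μ / (μ ^ 2 - 1))) := by
  have key : ∀ s, μ ^ 2 - 1 ≠ 0 → Complex.exp s + μ ≠ 0 →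
      expPoly 1 ((1 + μ ^ 2) / (μ ^ 2 - 1)) (μ / (μ ^ 2 - 1)) (μ / (μ ^ 2 - 1)) s *
      ((Complex.exp s * (μ ^ 2 - 1)) / (Complex.exp s + μ) ^ 2) =
      1 * ((μ * Complex.exp s + 1) / (Complex.exp s + μ)) := by
    intro s hl hs
    rw [← mul_div_assoc, expPoly_I_mul hl]
    field_simp
  refine isPrimitiveOf_exp (dom := fun s => Complex.exp s + μ ≠ 0)
    (R := fun s => (μ * Complex.exp s + 1) / (Complex.exp s + μ))
    (R' := fun s => (Complex.exp s * (μ ^ 2 - 1)) / (Complex.exp s + μ) ^ 2) one_ne_zero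
    (fun s w => by simp) (fun s hs => ?_) (fun s hs _ h => key s ?_ hs) (fun s hr => ?_)
  · refine ((((Complex.hasDerivAt_exp s).const_mul μ).add_const 1).div
      ((Complex.hasDerivAt_exp s).add_const μ) hs).congr_deriv ?_
    congr 1
    ring
  · intro hl
    simp [hl] at h
  · have hl : μ ^ 2 - 1 ≠ 0 := by
      intro hl
      simp [expPoly, hl] at hr
    have h := mul_ne_zero hr (mul_ne_zero (Complex.exp_ne_zero s) hl)
    rw [expPoly_I_mul hl] at h
    have hs := right_ne_zero_of_mul h
    exact ⟨hs, div_ne_zero (left_ne_zero_of_mul h) hs, key s hl hs⟩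

/-- Replacing e^s by e^{-s} inverts the fraction, so the function is odd up to the choice of the
branch and -h(-t) has the same form as h. -/
theorem symmValue_I_two_iff (l s w : ℂ) :
    (Complex.exp (-s) + l ≠ 0 ∧
      Complex.exp (-w) = (l * Complex.exp (-s) + 1) / (Complex.exp (-s) + l)) ↔
    Complex.exp s + l ≠ 0 ∧ Complex.exp w = (l * Complex.exp s + 1) / (Complex.exp s + l) := by
  have h0 := Complex.exp_ne_zero s
  have e1 : l * (Complex.exp s)⁻¹ + 1 = (Complex.exp s + l) / Complex.exp s := by
    field_simp
    ring
  have e2 : (Complex.exp s)⁻¹ + l = (l * Complex.exp s + 1) / Complex.exp s := by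
    field_simp
    ring
  simp only [Complex.exp_neg, e1, e2, div_div_div_cancel_right₀ h0, inv_eq_iff_eq_inv, inv_div, Ne,
    div_eq_zero_iff, h0, or_false]
  refine and_congr_left fun h => ?_
  have := h ▸ Complex.exp_ne_zero w
  exact iff_of_true (fun h => this (by simp [h])) (fun h => this (by simp [h]))

/-- The functions of a family are the primitives of the reciprocals of its coefficients. -/
theorem LatticeFamily.isPrimitiveOf {Φ : LatticeFamily} (hΦ : Φ.Valid) :
    ∀ i, IsPrimitiveOf 𝕜 (Φ.symmValue i) (Φ.recip i) := by
  cases Φ with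
  | A μ ν l =>
    refine forall_fin_three (isPrimitiveOf_div μ) (isPrimitiveOf_div ν)
      ((isPrimitiveOf_div l).congr fun s w => ?_)
    simp [symmValue, hValue, div_neg]
  | B μ ν l =>
    refine forall_fin_three (isPrimitiveOf_coth μ) (isPrimitiveOf_coth ν)
      ((isPrimitiveOf_coth l).congr fun s w => ?_)
    simp [symmValue, hValue, div_neg]
  | C μ ν l =>
    refine forall_fin_three (isPrimitiveOf_log_div μ) (isPrimitiveOf_log_div ν)
      ((isPrimitiveOf_log_div l).congr fun s w => ?_)
    have e1 : -s + l = -(s - l) := by ring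
    have e2 : -s - l = -(s + l) := by ring
    simp only [symmValue, hValue, Matrix.cons_val, mul_neg, Complex.exp_neg, e1, e2, neg_div_neg_eq,
      inv_eq_iff_eq_inv, inv_div, Ne, neg_eq_iff_add_eq_zero, ← sub_eq_zero (a := s) (b := l)]
    refine and_congr_left fun h => ?_
    have := h ▸ Complex.exp_ne_zero (2 * w)
    exact iff_of_true (fun h => this (by simp [h])) (fun h => this (by simp [h]))
  | D => exact forall_fin_three isPrimitiveOf_D₀ isPrimitiveOf_D₀ isPrimitiveOf_D₂
  | E => exact forall_fin_three isPrimitiveOf_E₀ isPrimitiveOf_E₁ isPrimitiveOf_E₂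
  | F =>
    refine forall_fin_three isPrimitiveOf_exp_sub_one isPrimitiveOf_exp_sub_one
      ?_
    have := (isPrimitiveOf_exp_neg_sub_one (𝕜 := 𝕜) (δ := 1) (m := 1) (by simp) rfl)
    refine this.congr fun s w => ?_
    simp [symmValue, hValue]
  | G =>
    refine forall_fin_three ?_ isPrimitiveOf_exp_sub_one isPrimitiveOf_G₂
    have := (isPrimitiveOf_exp_neg_sub_one (𝕜 := 𝕜) (δ := -1) (m := -1) (by simp) rfl)
    rw [neg_neg] at this
    refine this.congr fun s w => ?_
    simp [symmValue, fValue]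
  | H l =>
    refine forall_fin_three (isPrimitiveOf_H₀ hΦ) ?_ (isPrimitiveOf_H₂ l)
    have := (isPrimitiveOf_exp_neg_sub_one (𝕜 := 𝕜) (δ := 1) (m := 1) (by simp) rfl)
    refine this.congr fun s w => ?_
    simp [symmValue, gValue]
  | I μ ν l =>
    exact forall_fin_three (isPrimitiveOf_I μ) (isPrimitiveOf_I ν)
      ((isPrimitiveOf_I l).congr (symmValue_I_two_iff l))

end FamilyPrimitives

/-! ### Algebraic identities between each family and its dual. -/

section DualFamilies

theorem expPoly_one_sub (r m n a b : ℂ) : expPoly 1 r m n (a - b) =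
    r + m * (Complex.exp a / Complex.exp b) + n * (Complex.exp b / Complex.exp a) := by
  rw [expPoly, one_mul, neg_sub, Complex.exp_sub, Complex.exp_sub]

theorem expPoly_one (r m n s : ℂ) :
    expPoly 1 r m n s = r + m * Complex.exp s + n * (Complex.exp s)⁻¹ := by
  rw [expPoly, one_mul, Complex.exp_neg]

/-- Since F' = f'/D, the reciprocal of F' is the sum of the three reciprocals divided by the product
of those of g and h. The identities of this kind show that, up to the sign, it is the reciprocal of
the dual family at a difference of two functions. The remaining axes follow by rotation. -/
theorem dual_recip_A {a b c s t u : ℂ} (h : a + b + c = 0) (hs : s + t + u = 0) (ha : a ≠ 0)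
    (hb : b ≠ 0) (hc : c ≠ 0) (ht : t ≠ 0) (hu : u ≠ 0) :
    quadPoly (-1 / a) 0 0 (b / t - c / u) * (quadPoly (-1 / b) 0 0 t * quadPoly (-1 / c) 0 0 u) =
      -(quadPoly (-1 / a) 0 0 s + quadPoly (-1 / b) 0 0 t + quadPoly (-1 / c) 0 0 u) := by
  obtain rfl : s = -(t + u) := by linear_combination hs
  obtain rfl : a = -(b + c) := by linear_combination h
  have hbc : b + c ≠ 0 := neg_ne_zero.1 ha
  simp only [quadPoly]
  field_simp
  ring

theorem sinh_eq_of_add_eq_zero {s t u : ℂ} (hs : s + t + u = 0) :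
    Complex.sinh s =
      -(Complex.sinh t * Complex.cosh u + Complex.cosh t * Complex.sinh u) := by
  rw [← Complex.sinh_add, ← Complex.sinh_neg]
  congr 1
  linear_combination hs

theorem dual_recip_B {a b c s t u : ℂ} (h : a + b + c = 0) (hs : s + t + u = 0) (ha : a ≠ 0)
    (hb : b ≠ 0) (hc : c ≠ 0) (ht : Complex.sinh t ≠ 0) (hu : Complex.sinh u ≠ 0) :
    quadPoly (-1 / a) 0 a
        (b * (Complex.cosh t / Complex.sinh t) - c * (Complex.cosh u / Complex.sinh u)) *
      (-Complex.sinh t ^ 2 / b * (-Complex.sinh u ^ 2 / c)) =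
      -(-Complex.sinh s ^ 2 / a + -Complex.sinh t ^ 2 / b + -Complex.sinh u ^ 2 / c) := by
  rw [sinh_eq_of_add_eq_zero hs]
  have h1 := Complex.cosh_sq t
  have h2 := Complex.cosh_sq u
  obtain rfl : a = -(b + c) := by linear_combination h
  have hbc : b + c ≠ 0 := neg_ne_zero.1 ha
  simp only [quadPoly]
  field_simp
  rw [← sub_eq_zero]
  ring_nf
  rw [h1, h2]
  ring

theorem dual_recip_C {a b c s t u v w : ℂ} (h : a + b + c = 0) (hs : s + t + u = 0) (ha : a ≠ 0)
    (hb : b ≠ 0) (hc : c ≠ 0) (hr : quadPoly (-1 / b) 0 b t ≠ 0)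
    (hr' : quadPoly (-1 / c) 0 c u ≠ 0) (hv : Complex.exp (2 * v) = (t + b) / (t - b))
    (hw : Complex.exp (2 * w) = (u + c) / (u - c)) :
    expPoly 2 (1 / (2 * a)) (-1 / (4 * a)) (-1 / (4 * a)) (v - w) *
        (quadPoly (-1 / b) 0 b t * quadPoly (-1 / c) 0 c u) =
      -(quadPoly (-1 / a) 0 a s + quadPoly (-1 / b) 0 b t + quadPoly (-1 / c) 0 c u) := by
  have e : ∀ b t : ℂ, b ≠ 0 → quadPoly (-1 / b) 0 b t = -((t - b) * (t + b)) / b := by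
    intro b t hb
    simp only [quadPoly]
    field_simp
    ring
  rw [e b t hb] at hr
  rw [e c u hc] at hr'
  have h1 : t - b ≠ 0 := by rintro h; simp [h] at hr
  have h2 : t + b ≠ 0 := by rintro h; simp [h] at hr
  have h3 : u - c ≠ 0 := by rintro h; simp [h] at hr'
  have h4 : u + c ≠ 0 := by rintro h; simp [h] at hr'
  obtain rfl : s = -(t + u) := by linear_combination hs
  obtain rfl : a = -(b + c) := by linear_combination h
  have hbc : b + c ≠ 0 := neg_ne_zero.1 ha
  rw [e _ _ ha, e b t hb, e c u hc, expPoly, mul_sub, neg_sub, Complex.exp_sub, Complex.exp_sub,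
    hv, hw]
  field_simp
  ring

theorem dual_recip_I {a b c s t u v w : ℂ} (h : a * b * c = -1) (hs : s + t + u = 0)
    (ha : a ^ 2 - 1 ≠ 0) (hb : b ^ 2 - 1 ≠ 0) (hc : c ^ 2 - 1 ≠ 0)
    (ht : Complex.exp t + b ≠ 0) (hu : Complex.exp u + c ≠ 0)
    (hv : Complex.exp v = (b * Complex.exp t + 1) / (Complex.exp t + b))
    (hw : Complex.exp w = (c * Complex.exp u + 1) / (Complex.exp u + c)) :
    expPoly 1 ((1 + a ^ 2) / (a ^ 2 - 1)) (a / (a ^ 2 - 1)) (a / (a ^ 2 - 1)) (v - w) *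
        (expPoly 1 ((1 + b ^ 2) / (b ^ 2 - 1)) (b / (b ^ 2 - 1)) (b / (b ^ 2 - 1)) t *
          expPoly 1 ((1 + c ^ 2) / (c ^ 2 - 1)) (c / (c ^ 2 - 1)) (c / (c ^ 2 - 1)) u) =
      -(expPoly 1 ((1 + a ^ 2) / (a ^ 2 - 1)) (a / (a ^ 2 - 1)) (a / (a ^ 2 - 1)) s +
        expPoly 1 ((1 + b ^ 2) / (b ^ 2 - 1)) (b / (b ^ 2 - 1)) (b / (b ^ 2 - 1)) t +
        expPoly 1 ((1 + c ^ 2) / (c ^ 2 - 1)) (c / (c ^ 2 - 1)) (c / (c ^ 2 - 1)) u) := by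
  have e : ∀ {a : ℂ} (_ : a ^ 2 - 1 ≠ 0) (s : ℂ),
      expPoly 1 ((1 + a ^ 2) / (a ^ 2 - 1)) (a / (a ^ 2 - 1)) (a / (a ^ 2 - 1)) s =
        (a * Complex.exp s + 1) * (Complex.exp s + a) / (Complex.exp s * (a ^ 2 - 1)) := by
    intro a ha s
    rw [eq_div_iff (mul_ne_zero (Complex.exp_ne_zero s) ha), expPoly_I_mul ha]
  have hE : Complex.exp s = (Complex.exp t * Complex.exp u)⁻¹ := by
    rw [← Complex.exp_add, ← Complex.exp_neg]
    congr 1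
    linear_combination hs
  have hv0 := hv ▸ Complex.exp_ne_zero v
  have hw0 := hw ▸ Complex.exp_ne_zero w
  have h1 : b * Complex.exp t + 1 ≠ 0 := fun h => hv0 (by simp [h])
  have h2 : c * Complex.exp u + 1 ≠ 0 := fun h => hw0 (by simp [h])
  have hb0 : b ≠ 0 := by rintro rfl; simp at h
  have hc0 : c ≠ 0 := by rintro rfl; simp at h
  obtain rfl : a = -1 / (b * c) := by
    field_simp
    linear_combination h
  have ha' : 1 - (b * c) ^ 2 ≠ 0 := by
    intro h0
    apply ha
    field_simp
    linear_combination h0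
  have q : (-1 / (b * c)) ^ 2 - 1 = (1 - (b * c) ^ 2) / (b * c) ^ 2 := by field_simp
  rw [e hb t, e hc u, e ha s, hE, expPoly_one_sub, hv, hw, q]
  have := Complex.exp_ne_zero t
  have := Complex.exp_ne_zero u
  generalize Complex.exp t = x at *
  generalize Complex.exp u = y at *
  -- The nonzero factors are treated as independent variables while denominators are cleared, and
  -- expanded only at the end.
  generalize hd : b ^ 2 - 1 = d at *
  generalize he : c ^ 2 - 1 = d' at *
  generalize hg : 1 - (b * c) ^ 2 = d'' at *
  generalize hx : x + b = x1 at *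
  generalize hx' : b * x + 1 = x2 at *
  generalize hy : y + c = y1 at *
  generalize hy' : c * y + 1 = y2 at *
  field_simp
  subst hd he hg hx hx' hy hy'
  ring

theorem exp_eq_of_add_eq_zero {s t u : ℂ} (h : s + t + u = 0) :
    Complex.exp u = (Complex.exp s * Complex.exp t)⁻¹ := by
  rw [← Complex.exp_add, ← Complex.exp_neg]
  congr 1
  linear_combination h

/-- The products `Φ.recip j (s j) * Φ.recip k (s k)` relate the coefficients of a family to those
of the dual family. -/
def LatticeFamily.DualRelation (Φ : LatticeFamily) (s w : Fin 3 → ℂ) : Prop :=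
  ∀ i, Φ.dual.recip i (w (i + 1) - w (i + 2)) *
      (Φ.recip (i + 1) (s (i + 1)) * Φ.recip (i + 2) (s (i + 2))) =
    -(Φ.recip 0 (s 0) + Φ.recip 1 (s 1) + Φ.recip 2 (s 2))

variable {s w : Fin 3 → ℂ}

theorem dualRelation_D (hs : s 0 + s 1 + s 2 = 0)
    (hV : ∀ i, LatticeFamily.D.symmValue i (s i) (w i)) : LatticeFamily.D.DualRelation s w := by
  obtain ⟨v0, v1, v2, v3⟩ : Complex.exp (w 0) = s 0 ∧ Complex.exp (w 1) = s 1 ∧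
    -s 2 ≠ 0 ∧ Complex.exp (-w 2) = 1 - 1 / -s 2 := ⟨hV 0, hV 1, hV 2⟩
  have h0 := v0 ▸ Complex.exp_ne_zero (w 0)
  have h1 := v1 ▸ Complex.exp_ne_zero (w 1)
  have h2 : s 2 ≠ 0 := neg_ne_zero.1 v2
  have h3 : s 2 + 1 ≠ 0 := by
    intro h
    refine (v3 ▸ Complex.exp_ne_zero (-w 2)) ?_
    rw [eq_neg_of_add_eq_zero_left h]
    norm_num
  rw [Complex.exp_neg, inv_eq_iff_eq_inv] at v3
  have h4 : 1 - 1 / -s 2 = (s 2 + 1) / s 2 := by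
    field_simp
    ring
  rw [h4, inv_div] at v3
  have hE : s 0 = -(s 1 + s 2) := by linear_combination hs
  refine forall_fin_three ?_ ?_ ?_
  all_goals
    simp only [LatticeFamily.recip, LatticeFamily.dual, Fin.isValue, Fin.reduceAdd, Matrix.cons_val,
      expPoly_one_sub, v0, v1, v3, quadPoly]
    field_simp
    rw [hE]
    ring

theorem dualRelation_E (hs : s 0 + s 1 + s 2 = 0)
    (hV : ∀ i, LatticeFamily.E.symmValue i (s i) (w i)) : LatticeFamily.E.DualRelation s w := by
  obtain ⟨v0, v1, v2, v3⟩ : w 0 = -Complex.exp (s 0) - 1 ∧ w 1 = Complex.exp (-s 1) ∧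
    1 + Complex.exp (-s 2) ≠ 0 ∧ -w 2 = 1 / (1 + Complex.exp (-s 2)) := ⟨hV 0, hV 1, hV 2⟩
  rw [neg_eq_iff_eq_neg] at v3
  have hE := exp_eq_of_add_eq_zero hs
  have h0 := Complex.exp_ne_zero (s 0)
  have h1 := Complex.exp_ne_zero (s 1)
  rw [Complex.exp_neg] at v1
  rw [Complex.exp_neg (s 2), hE, inv_inv] at v2 v3
  refine forall_fin_three ?_ ?_ ?_
  all_goals
    simp only [LatticeFamily.recip, LatticeFamily.dual, Fin.isValue, Fin.reduceAdd, Matrix.cons_val,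
      expPoly_one, v0, v1, v3, quadPoly, hE]
    generalize hd : 1 + Complex.exp (s 0) * Complex.exp (s 1) = d at v2 ⊢
    field_simp
    subst hd
    ring

theorem dualRelation_F (hs : s 0 + s 1 + s 2 = 0)
    (hV : ∀ i, LatticeFamily.F.symmValue i (s i) (w i)) : LatticeFamily.F.DualRelation s w := by
  obtain ⟨v0, v1, v2⟩ : Complex.exp (w 0) = Complex.exp (s 0) - 1 ∧
    Complex.exp (w 1) = Complex.exp (s 1) - 1 ∧ Complex.exp (- -w 2) = Complex.exp (-s 2) - 1 :=
      ⟨hV 0, hV 1, hV 2⟩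
  have hE := exp_eq_of_add_eq_zero hs
  have h0 := Complex.exp_ne_zero (s 0)
  have h1 := Complex.exp_ne_zero (s 1)
  rw [neg_neg, Complex.exp_neg, hE, inv_inv] at v2
  have d0 := v0 ▸ Complex.exp_ne_zero (w 0)
  have d1 := v1 ▸ Complex.exp_ne_zero (w 1)
  have d2 := v2 ▸ Complex.exp_ne_zero (w 2)
  refine forall_fin_three ?_ ?_ ?_
  all_goals
    simp only [LatticeFamily.recip, LatticeFamily.dual, Fin.isValue, Fin.reduceAdd, Matrix.cons_val,
      expPoly_one, Complex.exp_sub, v0, v1, v2, hE]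
    generalize hd : Complex.exp (s 0) * Complex.exp (s 1) - 1 = d at d2 ⊢
    field_simp
    subst hd
    ring

theorem dualRelation_G (hs : s 0 + s 1 + s 2 = 0)
    (hV : ∀ i, LatticeFamily.G.symmValue i (s i) (w i)) : LatticeFamily.G.DualRelation s w := by
  obtain ⟨v0, v1, v2⟩ : Complex.exp (-w 0) = Complex.exp (-s 0) - 1 ∧
    Complex.exp (w 1) = Complex.exp (s 1) - 1 ∧ -w 2 = - -s 2 := ⟨hV 0, hV 1, hV 2⟩
  have hE := exp_eq_of_add_eq_zero hs
  have h0 := Complex.exp_ne_zero (s 0)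
  have h1 := Complex.exp_ne_zero (s 1)
  have d0 := v0 ▸ Complex.exp_ne_zero (-w 0)
  have d1 := v1 ▸ Complex.exp_ne_zero (w 1)
  rw [Complex.exp_neg, Complex.exp_neg] at v0
  have e0 : (Complex.exp (s 0))⁻¹ - 1 = (1 - Complex.exp (s 0)) / Complex.exp (s 0) := by
    field_simp
  rw [Complex.exp_neg, e0] at d0
  have d2 : 1 - Complex.exp (s 0) ≠ 0 := fun h => d0 (by simp [h])
  rw [e0, inv_eq_iff_eq_inv, inv_div] at v0
  have v3 : Complex.exp (w 2) = Complex.exp (s 0) * Complex.exp (s 1) := by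
    rw [← Complex.exp_add]
    congr 1
    linear_combination -v2 - hs
  refine forall_fin_three ?_ ?_ ?_
  all_goals
    simp only [LatticeFamily.recip, LatticeFamily.dual, Fin.isValue, Fin.reduceAdd, Matrix.cons_val,
      expPoly_one, Complex.exp_sub, v0, v1, v3, hE]
    field_simp
    ring

theorem dualRelation_H {l : ℂ} (hl : l ≠ 0) (hs : s 0 + s 1 + s 2 = 0)
    (hV : ∀ i, (LatticeFamily.H l).symmValue i (s i) (w i))
    (hr : ∀ i, (LatticeFamily.H l).recip i (s i) ≠ 0) :
    (LatticeFamily.H l).DualRelation s w := by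
  obtain ⟨v0, v1, v2, v3⟩ : Complex.exp (w 0) = l⁻¹ * (Complex.exp (s 0) + 1) ∧
    Complex.exp (w 1) = Complex.exp (-s 1) - 1 ∧ Complex.exp (-s 2) + 1 ≠ 0 ∧
      Complex.exp (-w 2) = (Complex.exp (-s 2) + l) / (Complex.exp (-s 2) + 1) :=
    ⟨hV 0, hV 1, hV 2⟩
  have hl1 : 1 - l ≠ 0 := by
    intro h
    apply hr 2
    simp [LatticeFamily.recip, expPoly, h]
  have hE := exp_eq_of_add_eq_zero hs
  have h0 := Complex.exp_ne_zero (s 0)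
  have h1 := Complex.exp_ne_zero (s 1)
  rw [Complex.exp_neg (s 2), hE, inv_inv] at v2 v3
  have d0 : Complex.exp (s 0) + 1 ≠ 0 := right_ne_zero_of_mul (v0 ▸ Complex.exp_ne_zero (w 0))
  have d3 : Complex.exp (s 0) * Complex.exp (s 1) + l ≠ 0 := fun h =>
    (v3 ▸ Complex.exp_ne_zero (-w 2)) (by simp [h])
  rw [Complex.exp_neg, inv_eq_iff_eq_inv, inv_div] at v3
  have d1 := v1 ▸ Complex.exp_ne_zero (w 1)
  have e1 : (Complex.exp (s 1))⁻¹ - 1 = (1 - Complex.exp (s 1)) / Complex.exp (s 1) := by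
    field_simp
  rw [Complex.exp_neg, e1] at d1 v1
  have d2 : 1 - Complex.exp (s 1) ≠ 0 := fun h => d1 (by simp [h])
  refine forall_fin_three ?_ ?_ ?_
  all_goals
    simp only [LatticeFamily.recip, LatticeFamily.dual, Fin.isValue, Fin.reduceAdd, Matrix.cons_val,
      expPoly_one, Complex.exp_sub, v0, v1, v3, hE]
    generalize hd : Complex.exp (s 0) * Complex.exp (s 1) + 1 = d at v2 ⊢
    generalize hd' : Complex.exp (s 0) * Complex.exp (s 1) + l = d' at d3 ⊢
    field_simp
    subst hd hd'
    ring

theorem LatticeFamily.dualRelation {Φ : LatticeFamily} (hΦ : Φ.Valid) (hs : s 0 + s 1 + s 2 = 0)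
    (hV : ∀ i, Φ.symmValue i (s i) (w i)) (hr : ∀ i, Φ.recip i (s i) ≠ 0) :
    Φ.DualRelation s w := by
  cases Φ with
  | A μ ν l =>
    obtain ⟨⟨u0, v0⟩, ⟨u1, v1⟩, ⟨u2, v2⟩⟩ : (s 0 ≠ 0 ∧ w 0 = μ / s 0) ∧ (s 1 ≠ 0 ∧ w 1 = ν / s 1) ∧
      (-s 2 ≠ 0 ∧ -w 2 = l / -s 2) := ⟨hV 0, hV 1, hV 2⟩
    rw [div_neg, neg_inj] at v2
    rw [neg_ne_zero] at u2
    have hμ : μ ≠ 0 := by rintro rfl; exact hr 0 (by simp [recip, quadPoly])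
    have hν : ν ≠ 0 := by rintro rfl; exact hr 1 (by simp [recip, quadPoly])
    have hl : l ≠ 0 := by rintro rfl; exact hr 2 (by simp [recip, quadPoly])
    have h : l + μ + ν = 0 := hΦ
    have e0 := dual_recip_A (by linear_combination h) hs hμ hν hl u1 u2
    have e1 := dual_recip_A (by linear_combination h) (by linear_combination hs) hν hl hμ u2 u0
      (s := s 1)
    have e2 := dual_recip_A (by linear_combination h) (by linear_combination hs) hl hμ hν u0 u1
      (s := s 2)
    rw [← v0, ← v1, ← v2] at *
    exact forall_fin_three e0 (e1.trans (by simp only [recip, Matrix.cons_val]; ring))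
      (e2.trans (by simp only [recip, Matrix.cons_val]; ring))
  | B μ ν l =>
    obtain ⟨⟨u0, v0⟩, ⟨u1, v1⟩, ⟨u2, v2⟩⟩ :
      (Complex.sinh (s 0) ≠ 0 ∧ w 0 = μ * (Complex.cosh (s 0) / Complex.sinh (s 0))) ∧
      (Complex.sinh (s 1) ≠ 0 ∧ w 1 = ν * (Complex.cosh (s 1) / Complex.sinh (s 1))) ∧
      (Complex.sinh (-s 2) ≠ 0 ∧ -w 2 = l * (Complex.cosh (-s 2) / Complex.sinh (-s 2))) :=
        ⟨hV 0, hV 1, hV 2⟩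
    rw [Complex.sinh_neg, Complex.cosh_neg, div_neg, mul_neg, neg_inj] at v2
    rw [Complex.sinh_neg, neg_ne_zero] at u2
    have hμ : μ ≠ 0 := by rintro rfl; exact hr 0 (by simp [recip, expPoly])
    have hν : ν ≠ 0 := by rintro rfl; exact hr 1 (by simp [recip, expPoly])
    have hl : l ≠ 0 := by rintro rfl; exact hr 2 (by simp [recip, expPoly])
    have h : l + μ + ν = 0 := hΦ
    have e0 := dual_recip_B (by linear_combination h) hs hμ hν hl u1 u2
    have e1 := dual_recip_B (by linear_combination h) (by linear_combination hs) hν hl hμ u2 u0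
      (s := s 1)
    have e2 := dual_recip_B (by linear_combination h) (by linear_combination hs) hl hμ hν u0 u1
      (s := s 2)
    simp only [← v0, ← v1, ← v2, ← expPoly_two_eq hμ, ← expPoly_two_eq hν, ← expPoly_two_eq hl]
      at e0 e1 e2
    exact forall_fin_three e0 (e1.trans (by simp only [recip, Matrix.cons_val]; ring))
      (e2.trans (by simp only [recip, Matrix.cons_val]; ring))
  | C μ ν l =>
    obtain ⟨⟨u0, v0⟩, ⟨u1, v1⟩, ⟨u2, v2⟩⟩ :
      (s 0 ≠ μ ∧ Complex.exp (2 * w 0) = (s 0 + μ) / (s 0 - μ)) ∧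
      (s 1 ≠ ν ∧ Complex.exp (2 * w 1) = (s 1 + ν) / (s 1 - ν)) ∧
      (-s 2 ≠ l ∧ Complex.exp (2 * -w 2) = (-s 2 + l) / (-s 2 - l)) := ⟨hV 0, hV 1, hV 2⟩
    rw [mul_neg, Complex.exp_neg, inv_eq_iff_eq_inv, inv_div, show -s 2 + l = -(s 2 - l) by ring,
      show -s 2 - l = -(s 2 + l) by ring, neg_div_neg_eq] at v2
    have hμ : μ ≠ 0 := by rintro rfl; exact hr 0 (by simp [recip, quadPoly])
    have hν : ν ≠ 0 := by rintro rfl; exact hr 1 (by simp [recip, quadPoly])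
    have hl : l ≠ 0 := by rintro rfl; exact hr 2 (by simp [recip, quadPoly])
    have h : l + μ + ν = 0 := hΦ
    have e0 := dual_recip_C (by linear_combination h) hs hμ hν hl (hr 1) (hr 2) v1 v2
    have e1 := dual_recip_C (by linear_combination h) (by linear_combination hs) hν hl hμ (hr 2)
      (hr 0) v2 v0 (s := s 1)
    have e2 := dual_recip_C (by linear_combination h) (by linear_combination hs) hl hμ hν (hr 0)
      (hr 1) v0 v1 (s := s 2)
    exact forall_fin_three e0 (e1.trans (by simp only [recip, Matrix.cons_val]; ring))
      (e2.trans (by simp only [recip, Matrix.cons_val]; ring))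
  | D => exact dualRelation_D hs hV
  | E => exact dualRelation_E hs hV
  | F => exact dualRelation_F hs hV
  | G => exact dualRelation_G hs hV
  | H l => exact dualRelation_H hΦ hs hV hr
  | I μ ν l =>
    obtain ⟨⟨u0, v0⟩, ⟨u1, v1⟩, ⟨u2, v2⟩⟩ :
      (Complex.exp (s 0) + μ ≠ 0 ∧
        Complex.exp (w 0) = (μ * Complex.exp (s 0) + 1) / (Complex.exp (s 0) + μ)) ∧
      (Complex.exp (s 1) + ν ≠ 0 ∧
        Complex.exp (w 1) = (ν * Complex.exp (s 1) + 1) / (Complex.exp (s 1) + ν)) ∧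
      (Complex.exp (-s 2) + l ≠ 0 ∧
        Complex.exp (-w 2) = (l * Complex.exp (-s 2) + 1) / (Complex.exp (-s 2) + l)) :=
          ⟨hV 0, hV 1, hV 2⟩
    obtain ⟨u2, v2⟩ := (symmValue_I_two_iff l (s 2) (w 2)).1 ⟨u2, v2⟩
    have hμ : μ ^ 2 - 1 ≠ 0 := fun h => hr 0 (by simp [recip, expPoly, h])
    have hν : ν ^ 2 - 1 ≠ 0 := fun h => hr 1 (by simp [recip, expPoly, h])
    have hl : l ^ 2 - 1 ≠ 0 := fun h => hr 2 (by simp [recip, expPoly, h])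
    have h : l * μ * ν = -1 := hΦ
    have e0 := dual_recip_I (by linear_combination h) hs hμ hν hl u1 u2 v1 v2
    have e1 := dual_recip_I (by linear_combination h) (by linear_combination hs) hν hl hμ u2 u0 v2
      v0 (s := s 1)
    have e2 := dual_recip_I (by linear_combination h) (by linear_combination hs) hl hμ hν u0 u1 v0
      v1 (s := s 2)
    exact forall_fin_three e0 (e1.trans (by simp only [recip, Matrix.cons_val]; ring))
      (e2.trans (by simp only [recip, Matrix.cons_val]; ring))

end DualFamilies

/-! ### The families satisfy the functional equation. -/

section FamilyIdentity

theorem hasDerivAt_expPoly (ω r m n s : ℂ) :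
    HasDerivAt (expPoly ω r m n) (expPoly ω 0 (ω * m) (-(ω * n)) s) s := by
  have h := (hasDerivAt_id s).const_mul ω
  refine (((h.cexp.const_mul m).const_add r).add (h.fun_neg.cexp.const_mul n)).congr_deriv ?_
  simp only [expPoly, id]
  ring

theorem hasDerivAt_quadPoly (p q r s : ℂ) :
    HasDerivAt (quadPoly p q r) (quadPoly 0 (2 * p) q s) s := by
  have h := hasDerivAt_id s
  refine ((((h.pow 2).const_mul p).add (h.const_mul q)).add_const r).congr_deriv ?_
  simp only [quadPoly, id]
  ring

theorem deriv_expPoly (ω r m n : ℂ) :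
    deriv (expPoly ω r m n) = expPoly ω 0 (ω * m) (-(ω * n)) :=
  funext fun s => (hasDerivAt_expPoly ω r m n s).deriv

theorem deriv_quadPoly (p q r : ℂ) : deriv (quadPoly p q r) = quadPoly 0 (2 * p) q :=
  funext fun s => (hasDerivAt_quadPoly p q r s).deriv

theorem expPoly_eq_zero {ω m n s : ℂ} (hω : ω ≠ 0) (h1 : expPoly ω 0 m n s = 0)
    (h2 : expPoly ω 0 (ω * m) (-(ω * n)) s = 0) : m = 0 ∧ n = 0 := by
  simp only [expPoly] at h1 h2
  constructor
  · have : 2 * ω * Complex.exp (ω * s) * m = 0 := by linear_combination ω * h1 + h2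
    exact (mul_eq_zero.1 this).resolve_left (by simp [hω, Complex.exp_ne_zero])
  · have : 2 * ω * Complex.exp (-(ω * s)) * n = 0 := by linear_combination ω * h1 - h2
    exact (mul_eq_zero.1 this).resolve_left (by simp [hω, Complex.exp_ne_zero])

/-- The second and third derivatives have no common zeros. -/
def NonAffine (r : ℂ → ℂ) : Prop :=
  ∀ s, ¬ (deriv (deriv r) s = 0 ∧ deriv (deriv (deriv r)) s = 0)

/-- The second derivative alone may have zeros. Together with the third it determines m and n, so
failure at a single point is already contradictory. -/
theorem nonAffine_expPoly {ω r m n : ℂ} (hω : ω ≠ 0) (h : ¬ (m = 0 ∧ n = 0)) :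
    NonAffine (expPoly ω r m n) := by
  rintro s ⟨h1, h2⟩
  simp only [deriv_expPoly] at h1 h2
  obtain ⟨e1, e2⟩ := expPoly_eq_zero hω h1 h2
  simp only [mul_eq_zero, hω, false_or, neg_eq_zero] at e1 e2
  exact h ⟨e1, e2⟩

theorem nonAffine_quadPoly {p q r : ℂ} (h : p ≠ 0) : NonAffine (quadPoly p q r) := by
  rintro s ⟨h1, -⟩
  simp only [deriv_quadPoly, quadPoly] at h1
  exact h (by linear_combination h1 / 2)

/-- Needed to rule out that the determinant vanishes identically. The nonzero value of the
reciprocal excludes degenerate parameters. -/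
theorem LatticeFamily.exists_nonAffine {Φ : LatticeFamily} (hΦ : Φ.Valid) {s : ℂ}
    (hr : Φ.recip 0 s ≠ 0) : ∃ i, NonAffine (Φ.recip i) := by
  cases Φ with
  | A μ ν l =>
    have hμ : μ ≠ 0 := by rintro rfl; exact hr (by simp [recip, quadPoly])
    exact ⟨0, nonAffine_quadPoly (by simpa using hμ)⟩
  | B μ ν l =>
    have hμ : μ ≠ 0 := by rintro rfl; exact hr (by simp [recip, expPoly])
    exact ⟨0, nonAffine_expPoly two_ne_zero (by simp [hμ])⟩
  | C μ ν l =>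
    have hμ : μ ≠ 0 := by rintro rfl; exact hr (by simp [recip, quadPoly])
    exact ⟨0, nonAffine_quadPoly (by simpa using hμ)⟩
  | D => exact ⟨2, nonAffine_quadPoly one_ne_zero⟩
  | E => exact ⟨0, nonAffine_expPoly one_ne_zero (by simp)⟩
  | F => exact ⟨0, nonAffine_expPoly one_ne_zero (by simp)⟩
  | G => exact ⟨0, nonAffine_expPoly one_ne_zero (by simp)⟩
  | H l => exact ⟨0, nonAffine_expPoly one_ne_zero (by simp)⟩
  | I μ ν l =>
    have h : l * μ * ν = -1 := hΦ
    have hμ : μ ≠ 0 := by rintro rfl; simp at h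
    have hμ' : μ ^ 2 - 1 ≠ 0 := fun h => hr (by simp [recip, expPoly, h])
    exact ⟨0, nonAffine_expPoly one_ne_zero (by simp [hμ, hμ'])⟩

theorem LatticeFamily.differentiable_recip (Φ : LatticeFamily) (i : Fin 3) :
    Differentiable ℂ (Φ.recip i) := by
  have h1 : ∀ ω r m n, Differentiable ℂ (expPoly ω r m n) :=
    fun ω r m n s => (hasDerivAt_expPoly ω r m n s).differentiableAt
  have h2 : ∀ p q r, Differentiable ℂ (quadPoly p q r) :=
    fun p q r s => (hasDerivAt_quadPoly p q r s).differentiableAt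
  revert i
  cases Φ <;> refine forall_fin_three ?_ ?_ ?_ <;> first | exact h1 _ _ _ _ | exact h2 _ _ _

theorem expPoly_eq_one (ω r m n s : ℂ) : expPoly ω r m n s = expPoly 1 r m n (ω * s) := by
  simp only [expPoly, one_mul]

/-- With x = e^{ωs₀}, y = e^{ωs₁} the left side is a Laurent polynomial, and each of the six
coefficient relations removes one of its monomials; all others cancel. -/
theorem ExpCondition.identity {r m n s : Fin 3 → ℂ} (h : ExpCondition r m n) (ω : ℂ)
    (hs : s 0 + s 1 + s 2 = 0) :
    (expPoly ω (r 1) (m 1) (n 1) (s 1) + expPoly ω (r 2) (m 2) (n 2) (s 2)) *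
        expPoly ω 0 (ω * m 0) (-(ω * n 0)) (s 0) +
      (expPoly ω (r 2) (m 2) (n 2) (s 2) + expPoly ω (r 0) (m 0) (n 0) (s 0)) *
        expPoly ω 0 (ω * m 1) (-(ω * n 1)) (s 1) +
      (expPoly ω (r 0) (m 0) (n 0) (s 0) + expPoly ω (r 1) (m 1) (n 1) (s 1)) *
        expPoly ω 0 (ω * m 2) (-(ω * n 2)) (s 2) = 0 := by
  have hE : Complex.exp (ω * s 2) = (Complex.exp (ω * s 0) * Complex.exp (ω * s 1))⁻¹ :=
    exp_eq_of_add_eq_zero (by linear_combination ω * hs)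
  simp only [expPoly_eq_one ω, expPoly_one, hE]
  have h0 := Complex.exp_ne_zero (ω * s 0)
  have h1 := Complex.exp_ne_zero (ω * s 1)
  generalize Complex.exp (ω * s 0) = x at *
  generalize Complex.exp (ω * s 1) = y at *
  have m0 := h.m_eq 1 2 0 (by decide) (by decide) (by decide)
  have m1 := h.m_eq 2 0 1 (by decide) (by decide) (by decide)
  have m2 := h.m_eq 0 1 2 (by decide) (by decide) (by decide)
  have n0 := h.n_eq 1 2 0 (by decide) (by decide) (by decide)
  have n1 := h.n_eq 2 0 1 (by decide) (by decide) (by decide)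
  have n2 := h.n_eq 0 1 2 (by decide) (by decide) (by decide)
  simp only [inv_inv]
  field_simp
  linear_combination ω * x * y * (x ^ 2 * y * m0 + x * y ^ 2 * m1 + m2 - y * n0 - x * n1 -
    x ^ 2 * y ^ 2 * n2)

theorem ExpCondition.of_cyclic {r m n : Fin 3 → ℂ} (m0 : (r 1 + r 2) * m 0 = 2 * (n 1 * n 2))
    (m1 : (r 2 + r 0) * m 1 = 2 * (n 2 * n 0)) (m2 : (r 0 + r 1) * m 2 = 2 * (n 0 * n 1))
    (n0 : (r 1 + r 2) * n 0 = 2 * (m 1 * m 2)) (n1 : (r 2 + r 0) * n 1 = 2 * (m 2 * m 0))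
    (n2 : (r 0 + r 1) * n 2 = 2 * (m 0 * m 1)) : ExpCondition r m n := by
  constructor
  · refine forall_fin_three (forall_fin_three ?_ ?_ ?_) (forall_fin_three ?_ ?_ ?_)
      (forall_fin_three ?_ ?_ ?_) <;> refine forall_fin_three ?_ ?_ ?_ <;> intro h1 h2 h3 <;>
    first
      | exact absurd rfl h1
      | exact absurd rfl h2
      | exact absurd rfl h3
      | linear_combination m0
      | linear_combination m1
      | linear_combination m2
  · refine forall_fin_three (forall_fin_three ?_ ?_ ?_) (forall_fin_three ?_ ?_ ?_)
      (forall_fin_three ?_ ?_ ?_) <;> refine forall_fin_three ?_ ?_ ?_ <;> intro h1 h2 h3 <;>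
    first
      | exact absurd rfl h1
      | exact absurd rfl h2
      | exact absurd rfl h3
      | linear_combination n0
      | linear_combination n1
      | linear_combination n2

/-- δ = 0 is used for (A), δ = 1 for (C). -/
theorem quad_identity {a b c s t u : ℂ} (δ : ℂ) (h : a + b + c = 0) (hs : s + t + u = 0)
    (ha : a ≠ 0) (hb : b ≠ 0) (hc : c ≠ 0) :
    (quadPoly (-1 / b) 0 (δ * b) t + quadPoly (-1 / c) 0 (δ * c) u) *
        quadPoly 0 (2 * (-1 / a)) 0 s +
      (quadPoly (-1 / c) 0 (δ * c) u + quadPoly (-1 / a) 0 (δ * a) s) *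
        quadPoly 0 (2 * (-1 / b)) 0 t +
      (quadPoly (-1 / a) 0 (δ * a) s + quadPoly (-1 / b) 0 (δ * b) t) *
        quadPoly 0 (2 * (-1 / c)) 0 u = 0 := by
  obtain rfl : s = -(t + u) := by linear_combination hs
  obtain rfl : a = -(b + c) := by linear_combination h
  have hbc : b + c ≠ 0 := neg_ne_zero.1 ha
  simp only [quadPoly]
  field_simp
  ring

theorem coeff_identity_I {a b c : ℂ} (h : a * b * c = -1) (ha : a ^ 2 - 1 ≠ 0)
    (hb : b ^ 2 - 1 ≠ 0) (hc : c ^ 2 - 1 ≠ 0) :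
    ((1 + b ^ 2) / (b ^ 2 - 1) + (1 + c ^ 2) / (c ^ 2 - 1)) * (a / (a ^ 2 - 1)) =
      2 * (b / (b ^ 2 - 1) * (c / (c ^ 2 - 1))) := by
  field_simp
  linear_combination (2 * b * c - 2 * a) * h

/-- The reciprocals of a family solve the functional equation. -/
theorem LatticeFamily.recip_identity {Φ : LatticeFamily} (hΦ : Φ.Valid) {s : Fin 3 → ℂ}
    (hs : s 0 + s 1 + s 2 = 0) (hr : ∀ i, Φ.recip i (s i) ≠ 0) :
    (Φ.recip 1 (s 1) + Φ.recip 2 (s 2)) * deriv (Φ.recip 0) (s 0) +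
      (Φ.recip 2 (s 2) + Φ.recip 0 (s 0)) * deriv (Φ.recip 1) (s 1) +
      (Φ.recip 0 (s 0) + Φ.recip 1 (s 1)) * deriv (Φ.recip 2) (s 2) = 0 := by
  cases Φ with
  | A μ ν l =>
    have hμ : μ ≠ 0 := by rintro rfl; exact hr 0 (by simp [recip, quadPoly])
    have hν : ν ≠ 0 := by rintro rfl; exact hr 1 (by simp [recip, quadPoly])
    have hl : l ≠ 0 := by rintro rfl; exact hr 2 (by simp [recip, quadPoly])
    have h : l + μ + ν = 0 := hΦ
    simp only [recip, Matrix.cons_val, deriv_quadPoly]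
    simpa using quad_identity 0 (by linear_combination h) hs hμ hν hl
  | B μ ν l =>
    have hμ : μ ≠ 0 := by rintro rfl; exact hr 0 (by simp [recip, expPoly])
    have hν : ν ≠ 0 := by rintro rfl; exact hr 1 (by simp [recip, expPoly])
    have hl : l ≠ 0 := by rintro rfl; exact hr 2 (by simp [recip, expPoly])
    have h : l + μ + ν = 0 := hΦ
    obtain rfl : l = -(μ + ν) := by linear_combination h
    have hl' := neg_ne_zero.1 hl
    simp only [recip, Matrix.cons_val, deriv_expPoly]
    refine ExpCondition.identity (r := ![1 / (2 * μ), 1 / (2 * ν), 1 / (2 * -(μ + ν))])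
      (m := ![-1 / (4 * μ), -1 / (4 * ν), -1 / (4 * -(μ + ν))])
      (n := ![-1 / (4 * μ), -1 / (4 * ν), -1 / (4 * -(μ + ν))])
      (ExpCondition.of_cyclic ?_ ?_ ?_ ?_ ?_ ?_) 2 hs
    all_goals
      simp only [Matrix.cons_val]
      field_simp
      ring
  | C μ ν l =>
    have hμ : μ ≠ 0 := by rintro rfl; exact hr 0 (by simp [recip, quadPoly])
    have hν : ν ≠ 0 := by rintro rfl; exact hr 1 (by simp [recip, quadPoly])
    have hl : l ≠ 0 := by rintro rfl; exact hr 2 (by simp [recip, quadPoly])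
    have h : l + μ + ν = 0 := hΦ
    simp only [recip, Matrix.cons_val, deriv_quadPoly]
    simpa using quad_identity 1 (by linear_combination h) hs hμ hν hl
  | D =>
    simp only [recip, Matrix.cons_val, deriv_quadPoly, quadPoly]
    obtain h : s 0 = -(s 1 + s 2) := by linear_combination hs
    rw [h]
    ring
  | E =>
    simp only [recip, Matrix.cons_val, deriv_expPoly]
    exact ExpCondition.identity (r := ![0, 0, -2]) (m := ![0, -1, -1]) (n := ![-1, 0, -1])
      (ExpCondition.of_cyclic (by simp) (by simp) (by simp) (by simp) (by simp) (by simp)) 1 hs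
  | F =>
    simp only [recip, Matrix.cons_val, deriv_expPoly]
    exact ExpCondition.identity (r := ![1, 1, -1]) (m := ![0, 0, 1]) (n := ![-1, -1, 0])
      (ExpCondition.of_cyclic (by simp) (by simp) (by norm_num; rfl) (by simp) (by simp) (by simp))
      1 hs
  | G =>
    simp only [recip, Matrix.cons_val, deriv_expPoly]
    exact ExpCondition.identity (r := ![1, 1, -1]) (m := ![-1, 0, 0]) (n := ![0, -1, 0])
      (ExpCondition.of_cyclic (by simp) (by simp) (by simp) (by simp) (by simp) (by simp)) 1 hs
  | H l =>
    have hl : 1 - l ≠ 0 := fun h => hr 2 (by simp [recip, expPoly, h])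
    simp only [recip, Matrix.cons_val, deriv_expPoly]
    refine ExpCondition.identity (r := ![1, -1, (1 + l) / (1 - l)]) (m := ![0, 1, l / (1 - l)])
      (n := ![1, 0, 1 / (1 - l)]) (ExpCondition.of_cyclic ?_ ?_ ?_ ?_ ?_ ?_) 1 hs
    all_goals
      simp only [Matrix.cons_val]
      field_simp
      try ring
  | I μ ν l =>
    have hμ : μ ^ 2 - 1 ≠ 0 := fun h => hr 0 (by simp [recip, expPoly, h])
    have hν : ν ^ 2 - 1 ≠ 0 := fun h => hr 1 (by simp [recip, expPoly, h])
    have hl : l ^ 2 - 1 ≠ 0 := fun h => hr 2 (by simp [recip, expPoly, h])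
    have h : l * μ * ν = -1 := hΦ
    simp only [recip, Matrix.cons_val, deriv_expPoly]
    refine ExpCondition.identity
      (r := ![(1 + μ ^ 2) / (μ ^ 2 - 1), (1 + ν ^ 2) / (ν ^ 2 - 1), (1 + l ^ 2) / (l ^ 2 - 1)])
      (m := ![μ / (μ ^ 2 - 1), ν / (ν ^ 2 - 1), l / (l ^ 2 - 1)])
      (n := ![μ / (μ ^ 2 - 1), ν / (ν ^ 2 - 1), l / (l ^ 2 - 1)])
      (ExpCondition.of_cyclic ?_ ?_ ?_ ?_ ?_ ?_) 1 hs
    exacts [coeff_identity_I (by linear_combination h) hμ hν hl,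
      coeff_identity_I (by linear_combination h) hν hl hμ,
      coeff_identity_I (by linear_combination h) hl hμ hν,
      coeff_identity_I (by linear_combination h) hμ hν hl,
      coeff_identity_I (by linear_combination h) hν hl hμ,
      coeff_identity_I (by linear_combination h) hl hμ hν]

end FamilyIdentity

/-! ### From the differential condition to the functional equation. -/

section Reciprocals

variable {𝕜 : Type*} [RCLike 𝕜] {f g h : 𝕜 → 𝕜} {p : 𝕜 × 𝕜}

/-- The reciprocal of the derivative of the function attached to an axis. -/
noncomputable def recipDeriv (f g h : 𝕜 → 𝕜) (i : Fin 3) (t : 𝕜) : 𝕜 :=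
  (deriv (symmTriple f g h i) t)⁻¹

theorem deriv_neg_comp_neg (h : 𝕜 → 𝕜) (t : 𝕜) : deriv (fun t => -h (-t)) t = deriv h (-t) := by
  rw [deriv.fun_neg, deriv_comp_neg, neg_neg]

theorem NondegenerateAt.symm (hp : NondegenerateAt f g h p) (i : Fin 3) :
    AnalyticAt 𝕜 (symmTriple f g h i) (symmBase p.1 p.2 i) ∧
      deriv (symmTriple f g h i) (symmBase p.1 p.2 i) ≠ 0 := by
  revert i
  refine forall_fin_three ⟨hp.f_an, hp.f_ne⟩ ⟨hp.g_an, hp.g_ne⟩ ⟨?_, ?_⟩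
  · have h1 : AnalyticAt 𝕜 h (-(-(p.1 + p.2))) := by rw [neg_neg]; exact hp.h_an
    exact (h1.comp analyticAt_id.neg).neg
  · change deriv (fun t => -h (-t)) (-(p.1 + p.2)) ≠ 0
    rw [deriv_neg_comp_neg, neg_neg]
    exact hp.h_ne

theorem NondegenerateAt.recipDeriv (hp : NondegenerateAt f g h p) (i : Fin 3) :
    AnalyticAt 𝕜 (recipDeriv f g h i) (symmBase p.1 p.2 i) ∧
      recipDeriv f g h i (symmBase p.1 p.2 i) ≠ 0 ∧
      deriv (_root_.recipDeriv f g h i) (symmBase p.1 p.2 i) =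
        -deriv (deriv (symmTriple f g h i)) (symmBase p.1 p.2 i) /
          deriv (symmTriple f g h i) (symmBase p.1 p.2 i) ^ 2 := by
  obtain ⟨h1, h2⟩ := hp.symm i
  exact ⟨h1.deriv.inv h2, inv_ne_zero h2, (h1.deriv.differentiableAt.hasDerivAt.inv h2).deriv⟩

/-- Follows from (1/f')' = -f''/f'² after clearing denominators; the reflection in the third
function makes the equation symmetric. -/
theorem dualityPDE_iff (hp : NondegenerateAt f g h p) : DualityPDE f g h p ↔
    (recipDeriv f g h 1 p.2 + recipDeriv f g h 2 (-(p.1 + p.2))) *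
        deriv (recipDeriv f g h 0) p.1 +
      (recipDeriv f g h 2 (-(p.1 + p.2)) + recipDeriv f g h 0 p.1) *
        deriv (recipDeriv f g h 1) p.2 +
      (recipDeriv f g h 0 p.1 + recipDeriv f g h 1 p.2) *
        deriv (recipDeriv f g h 2) (-(p.1 + p.2)) = 0 := by
  have e0 := (hp.recipDeriv 0).2.2
  have e1 := (hp.recipDeriv 1).2.2
  have e2 := (hp.recipDeriv 2).2.2
  change deriv (recipDeriv f g h 0) p.1 = -deriv (deriv f) p.1 / deriv f p.1 ^ 2 at e0
  change deriv (recipDeriv f g h 1) p.2 = -deriv (deriv g) p.2 / deriv g p.2 ^ 2 at e1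
  change deriv (recipDeriv f g h 2) (-(p.1 + p.2)) =
    -deriv (deriv fun t => -h (-t)) (-(p.1 + p.2)) /
      deriv (fun t => -h (-t)) (-(p.1 + p.2)) ^ 2 at e2
  have e3 : recipDeriv f g h 2 = fun t => (deriv h (-t))⁻¹ := by
    funext t
    change (deriv (fun t => -h (-t)) t)⁻¹ = _
    rw [deriv_neg_comp_neg]
  rw [funext (deriv_neg_comp_neg h), deriv_comp_neg (deriv h), neg_neg, neg_neg] at e2
  rw [e0, e1, e2, e3, DualityPDE]
  beta_reduce
  rw [neg_neg]
  change _ ↔ ((deriv g p.2)⁻¹ + (deriv h (p.1 + p.2))⁻¹) * _ +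
    ((deriv h (p.1 + p.2))⁻¹ + (deriv f p.1)⁻¹) * _ + ((deriv f p.1)⁻¹ + (deriv g p.2)⁻¹) * _ = 0
  have h1 := hp.f_ne
  have h2 := hp.g_ne
  have h3 := hp.h_ne
  field_simp
  constructor <;> intro h <;> linear_combination h

/-- Degeneracy of T thus means that the three reciprocals have sum zero. -/
theorem dualityDet_eq (hp : NondegenerateAt f g h p) : dualityDet f g h p =
    deriv f p.1 * deriv g p.2 * deriv h (p.1 + p.2) * (recipDeriv f g h 0 p.1 +
      recipDeriv f g h 1 p.2 + recipDeriv f g h 2 (-(p.1 + p.2))) := by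
  have e : recipDeriv f g h 2 (-(p.1 + p.2)) = (deriv h (p.1 + p.2))⁻¹ := by
    change (deriv (fun t => -h (-t)) _)⁻¹ = _
    rw [deriv_neg_comp_neg, neg_neg]
  rw [e, dualityDet]
  change _ = _ * ((deriv f p.1)⁻¹ + (deriv g p.2)⁻¹ + _)
  have h1 := hp.f_ne
  have h2 := hp.g_ne
  have h3 := hp.h_ne
  field_simp
  ring

theorem continuous_symmBase (i : Fin 3) : Continuous fun q : 𝕜 × 𝕜 => symmBase q.1 q.2 i := by
  revert i
  refine forall_fin_three continuous_fst continuous_snd ?_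
  exact (continuous_fst.add continuous_snd).neg

theorem eventually_symmBase {P : Fin 3 → 𝕜 → Prop}
    (hP : ∀ i, ∀ᶠ t in 𝓝 (symmBase p.1 p.2 i), P i t) :
    ∀ᶠ q : 𝕜 × 𝕜 in 𝓝 p, ∀ i, P i (symmBase q.1 q.2 i) :=
  eventually_all.2 fun i => ((continuous_symmBase i).tendsto p).eventually (hP i)

theorem symmBase_sum (x y : 𝕜) : symmBase x y 0 + symmBase x y 1 + symmBase x y 2 = 0 := by
  simp [symmBase]

theorem exists_planeSolution (hp : NondegenerateAt f g h p)
    (hE : ∀ᶠ q in 𝓝 p, DualityPDE f g h q) : ∃ r > 0, PlaneSolution (recipDeriv f g h 0)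
      (recipDeriv f g h 1) (recipDeriv f g h 2) p.1 p.2 (-(p.1 + p.2)) r := by
  have han : ∀ i, ∀ᶠ t in 𝓝 (symmBase p.1 p.2 i), AnalyticAt 𝕜 (recipDeriv f g h i) t :=
    fun i => (hp.recipDeriv i).1.eventually_analyticAt
  obtain ⟨r₀, hr₀, h0⟩ := Metric.eventually_nhds_iff_ball.1 (han 0)
  obtain ⟨r₁, hr₁, h1⟩ := Metric.eventually_nhds_iff_ball.1 (han 1)
  obtain ⟨r₂, hr₂, h2⟩ := Metric.eventually_nhds_iff_ball.1 (han 2)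
  obtain ⟨r₃, hr₃, h3⟩ := Metric.eventually_nhds_iff_ball.1 (hE.and hp.eventually)
  refine ⟨min (min r₀ r₁) (min r₂ r₃), by positivity, fun x hx => h0 x ?_, fun x hx => h1 x ?_,
    fun x hx => h2 x ?_, fun x hx y hy z hz hs => ?_⟩
  · exact Metric.ball_subset_ball ((min_le_left _ _).trans (min_le_left _ _)) hx
  · exact Metric.ball_subset_ball ((min_le_left _ _).trans (min_le_right _ _)) hx
  · exact Metric.ball_subset_ball ((min_le_right _ _).trans (min_le_left _ _)) hx
  · obtain rfl : z = -(x + y) := by linear_combination hs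
    have hle : min (min r₀ r₁) (min r₂ r₃) ≤ r₃ := (min_le_right _ _).trans (min_le_right _ _)
    have hq : (x, y) ∈ Metric.ball p r₃ := by
      rw [Metric.mem_ball, Prod.dist_eq]
      exact max_lt (lt_of_lt_of_le hx hle) (lt_of_lt_of_le hy hle)
    obtain ⟨h4, h5⟩ := h3 _ hq
    exact (dualityPDE_iff h5).1 h4

/-- If the sum of the reciprocals vanishes on the plane, then they are affine. -/
theorem eventually_second_eq_zero (hp : NondegenerateAt f g h p)
    (hD : ∀ᶠ q in 𝓝 p, dualityDet f g h q = 0) (i : Fin 3) :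
    ∀ᶠ t in 𝓝 (symmBase p.1 p.2 i), deriv (deriv (recipDeriv f g h i)) t = 0 := by
  have hsum : ∀ᶠ q in 𝓝 p, recipDeriv f g h 0 q.1 + recipDeriv f g h 1 q.2 +
      recipDeriv f g h 2 (-(q.1 + q.2)) = 0 := by
    filter_upwards [hp.eventually, hD] with q hq hD
    rw [dualityDet_eq hq] at hD
    exact (mul_eq_zero.1 hD).resolve_left (mul_ne_zero (mul_ne_zero hq.f_ne hq.g_ne) hq.h_ne)
  have key : ∀ᶠ q in 𝓝 p, deriv (recipDeriv f g h 0) q.1 = deriv (recipDeriv f g h 1) q.2 ∧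
      deriv (recipDeriv f g h 0) q.1 = deriv (recipDeriv f g h 2) (-(q.1 + q.2)) := by
    filter_upwards [hp.eventually, hsum.eventually_nhds] with q hq hs
    have a0 : AnalyticAt 𝕜 (recipDeriv f g h 0) q.1 := (hq.recipDeriv 0).1
    have a1 : AnalyticAt 𝕜 (recipDeriv f g h 1) q.2 := (hq.recipDeriv 1).1
    have a2 : AnalyticAt 𝕜 (recipDeriv f g h 2) (-(q.1 + q.2)) := (hq.recipDeriv 2).1
    constructor
    · have c : Tendsto (fun t : 𝕜 => (q.1 + t, q.2 - t)) (𝓝 0) (𝓝 q) := by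
        have : Continuous fun t : 𝕜 => (q.1 + t, q.2 - t) := by fun_prop
        simpa using this.tendsto 0
      have d := ((a0.hasDerivAt_add.add a1.hasDerivAt_sub).add_const
        (recipDeriv f g h 2 (-(q.1 + q.2)))).unique
        ((hasDerivAt_const 0 (0 : 𝕜)).congr_of_eventuallyEq ?_)
      · linear_combination d
      · filter_upwards [c.eventually hs] with t ht
        rw [show q.1 + t + (q.2 - t) = q.1 + q.2 by ring] at ht
        exact ht
    · have c : Tendsto (fun t : 𝕜 => (q.1 + t, q.2)) (𝓝 0) (𝓝 q) := by
        have : Continuous fun t : 𝕜 => (q.1 + t, q.2) := by fun_prop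
        simpa using this.tendsto 0
      have d := ((a0.hasDerivAt_add.add_const (recipDeriv f g h 1 q.2)).add
        a2.hasDerivAt_sub).unique ((hasDerivAt_const 0 (0 : 𝕜)).congr_of_eventuallyEq ?_)
      · linear_combination d
      · filter_upwards [c.eventually hs] with t ht
        rw [show -(q.1 + t + q.2) = -(q.1 + q.2) - t by ring] at ht
        exact ht
  have hconst : ∀ {k : 𝕜 → 𝕜} {t₀ b : 𝕜}, (∀ᶠ t in 𝓝 t₀, deriv k t = b) →
      ∀ᶠ t in 𝓝 t₀, deriv (deriv k) t = 0 := fun hk => by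
    filter_upwards [hk.eventually_nhds] with t ht
    exact (EventuallyEq.deriv_eq ht).trans (by simp)
  revert i
  refine forall_fin_three (hconst (b := deriv (recipDeriv f g h 1) p.2) ?_)
    (hconst (b := deriv (recipDeriv f g h 0) p.1) ?_)
    (hconst (b := deriv (recipDeriv f g h 0) p.1) ?_)
  · have c : Tendsto (fun t : 𝕜 => (t, p.2)) (𝓝 p.1) (𝓝 p) :=
      (show Continuous fun t : 𝕜 => (t, p.2) by fun_prop).tendsto p.1
    exact (c.eventually key).mono fun t ht => ht.1
  · have c : Tendsto (fun t : 𝕜 => (p.1, t)) (𝓝 p.2) (𝓝 p) :=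
      (show Continuous fun t : 𝕜 => (p.1, t) by fun_prop).tendsto p.2
    exact (c.eventually key).mono fun t ht => ht.1.symm
  · have c : Tendsto (fun t : 𝕜 => (p.1, -t - p.1)) (𝓝 (-(p.1 + p.2))) (𝓝 p) := by
      have := (show Continuous fun t : 𝕜 => (p.1, -t - p.1) by fun_prop).tendsto (-(p.1 + p.2))
      simpa using this
    refine (c.eventually key).mono fun t ht => ?_
    have := ht.2
    rw [show -(p.1 + (-t - p.1)) = t by ring] at this
    exact this.symm

theorem hasConstDeriv_of_recipDeriv (hp : NondegenerateAt f g h p) {i : Fin 3}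
    (h0 : ∀ᶠ t in 𝓝 (symmBase p.1 p.2 i), deriv (recipDeriv f g h i) t = 0) :
    HasConstDeriv (symmTriple f g h i) (symmBase p.1 p.2 i) := by
  have hd : ∀ᶠ t in 𝓝 (symmBase p.1 p.2 i), HasDerivAt (recipDeriv f g h i) 0 t := by
    filter_upwards [(hp.recipDeriv i).1.eventually_analyticAt, h0] with t h1 h2
    exact h2 ▸ h1.differentiableAt.hasDerivAt
  filter_upwards [eventually_eq_of_hasDerivAt_zero hd] with t ht
  exact inv_injective ht

theorem hasConstDeriv_of_neg {t : 𝕜} (h0 : HasConstDeriv (fun t => -h (-t)) (-t)) :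
    HasConstDeriv h t := by
  have h1 : ∀ᶠ s in 𝓝 t, deriv (fun t => -h (-t)) (-s) = deriv (fun t => -h (-t)) (-t) :=
    (continuous_neg.tendsto t).eventually h0
  filter_upwards [h1] with s hs
  rwa [deriv_neg_comp_neg, deriv_neg_comp_neg, neg_neg, neg_neg] at hs

end Reciprocals

/-! ### Lattices of the list: the differential condition and generic invertibility. -/

section Membership

variable {𝕜 : Type*} [RCLike 𝕜] [NormedAlgebra 𝕜 ℂ] {f g h : 𝕜 → 𝕜} {p : 𝕜 × 𝕜}
  {Φ : LatticeFamily}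

theorem HasDerivAt.algebraMap_comp {φ : 𝕜 → 𝕜} {φ' t : 𝕜} (h : HasDerivAt φ φ' t) :
    HasDerivAt (fun t => algebraMap 𝕜 ℂ (φ t)) (algebraMap 𝕜 ℂ φ') t :=
  (algebraMapCLM 𝕜 ℂ).hasFDerivAt.comp_hasDerivAt t h

theorem hasDerivAt_mul_algebraMap_sub (c ξ : ℂ) (t : 𝕜) :
    HasDerivAt (fun t => c * (algebraMap 𝕜 ℂ t - ξ)) c t := by
  refine (((hasDerivAt_id t).algebraMap_comp.sub_const ξ).const_mul c).congr_deriv ?_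
  simp

theorem LatticeFamily.eventually_recip_mul (hΦ : Φ.Valid) {j : Fin 3} {φ : 𝕜 → 𝕜} {t₀ : 𝕜}
    {c k ξ a : ℂ} (hk : k ≠ 0) (hφ : AnalyticAt 𝕜 φ t₀) (hφ' : deriv φ t₀ ≠ 0)
    (hV : ∀ᶠ t in 𝓝 t₀, Φ.symmValue j (c * (algebraMap 𝕜 ℂ t - ξ)) (k * algebraMap 𝕜 ℂ (φ t) + a)) :
    ∀ᶠ t in 𝓝 t₀,
      Φ.recip j (c * (algebraMap 𝕜 ℂ t - ξ)) * (k * algebraMap 𝕜 ℂ (deriv φ t)) = c := by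
  filter_upwards [hφ.eventually_analyticAt, hφ.deriv.continuousAt.eventually_ne hφ',
    hV.eventually_nhds] with t h1 h2 h3
  exact (LatticeFamily.isPrimitiveOf hΦ j).differentiate _ _ t _ _
    (hasDerivAt_mul_algebraMap_sub c ξ t)
    ((h1.differentiableAt.hasDerivAt.algebraMap_comp.const_mul k).add_const a)
    (mul_ne_zero hk (by simpa using h2)) h3

theorem LatticeFamily.exists_symmValue (hΦ : Φ.Valid) {j : Fin 3} {φ φ' : 𝕜 → 𝕜} {t₀ : 𝕜}
    {c k ξ : ℂ} (hc : c ≠ 0) (hφ : ∀ᶠ t in 𝓝 t₀, HasDerivAt φ (φ' t) t)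
    (hr : ∀ᶠ t in 𝓝 t₀,
      Φ.recip j (c * (algebraMap 𝕜 ℂ t - ξ)) * (k * algebraMap 𝕜 ℂ (φ' t)) = c) :
    ∃ a, ∀ᶠ t in 𝓝 t₀,
      Φ.symmValue j (c * (algebraMap 𝕜 ℂ t - ξ)) (k * algebraMap 𝕜 ℂ (φ t) + a) :=
  (LatticeFamily.isPrimitiveOf hΦ j).integrate _ _ (fun _ => c) _ t₀
    (Eventually.of_forall (hasDerivAt_mul_algebraMap_sub c ξ))
    (hφ.mono fun _ ht => ht.algebraMap_comp.const_mul k)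
    (hr.mono fun _ ht => ⟨left_ne_zero_of_mul (ht.symm ▸ hc), ht⟩)

theorem eventually_deriv_of_scaled {a : 𝕜 → 𝕜} {R : ℂ → ℂ} {t₀ : 𝕜} {κ c ξ : ℂ}
    (hR : Differentiable ℂ R) (ha : AnalyticAt 𝕜 a t₀)
    (h : ∀ᶠ t in 𝓝 t₀, algebraMap 𝕜 ℂ (a t) = κ * R (c * (algebraMap 𝕜 ℂ t - ξ))) :
    ∀ᶠ t in 𝓝 t₀, algebraMap 𝕜 ℂ (deriv a t) =
      κ * c * deriv R (c * (algebraMap 𝕜 ℂ t - ξ)) := by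
  filter_upwards [ha.eventually_analyticAt, h.eventually_nhds] with t h1 h2
  have d := ((hR (c * (algebraMap 𝕜 ℂ t - ξ))).hasDerivAt.comp t
    (hasDerivAt_mul_algebraMap_sub c ξ t)).const_mul κ
  refine h1.differentiableAt.hasDerivAt.algebraMap_comp.unique
    ((d.congr_of_eventuallyEq h2).congr_deriv ?_)
  ring

/-- The reciprocals of the derivatives are, up to scaling, the reciprocals of the family. -/
theorem LatticeFamily.eventually_recipDeriv (hΦ : Φ.Valid) (hp : NondegenerateAt f g h p)
    {i j : Fin 3} {c k ξ a : ℂ} (hc : c ≠ 0) (hk : k ≠ 0)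
    (hV : ∀ᶠ t in 𝓝 (symmBase p.1 p.2 i), Φ.symmValue j (c * (algebraMap 𝕜 ℂ t - ξ))
      (k * algebraMap 𝕜 ℂ (symmTriple f g h i t) + a)) :
    ∀ᶠ t in 𝓝 (symmBase p.1 p.2 i), Φ.recip j (c * (algebraMap 𝕜 ℂ t - ξ)) ≠ 0 ∧
      algebraMap 𝕜 ℂ (recipDeriv f g h i t) =
        k / c * Φ.recip j (c * (algebraMap 𝕜 ℂ t - ξ)) := by
  filter_upwards [eventually_recip_mul hΦ hk (hp.symm i).1 (hp.symm i).2 hV] with t ht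
  have h1 := left_ne_zero_of_mul (ht.symm ▸ hc)
  have h2 := right_ne_zero_of_mul (right_ne_zero_of_mul (ht.symm ▸ hc))
  refine ⟨h1, ?_⟩
  rw [recipDeriv, map_inv₀]
  field_simp
  linear_combination -ht

/-- The reciprocals of the derivatives are k/c times those of the family at scaled and shifted
arguments, still with zero sum. The functional equation is homogeneous and symmetric, so it carries
over. -/
theorem BelongsTo.eventually_dualityPDE (hp : NondegenerateAt f g h p) (hΦ : Φ.Valid)
    (hb : BelongsTo f g h p.1 p.2 Φ) : ∀ᶠ q in 𝓝 p, DualityPDE f g h q := by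
  obtain ⟨σ, c, k, ξ, a, hc, hk, hξ, hV⟩ := hb
  have hr := fun i => Φ.eventually_recipDeriv hΦ hp hc hk (hV i)
  have hd := fun i => eventually_deriv_of_scaled (Φ.differentiable_recip (σ i))
    (hp.recipDeriv i).1 ((hr i).mono fun _ ht => ht.2)
  filter_upwards [eventually_symmBase hr, eventually_symmBase hd, hp.eventually] with q h1 h2 h3
  rw [dualityPDE_iff h3]
  set s : Fin 3 → ℂ := fun i => c * (algebraMap 𝕜 ℂ (symmBase q.1 q.2 i) - ξ i) with hs
  have hs0 : s 0 + s 1 + s 2 = 0 := by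
    have := congrArg (algebraMap 𝕜 ℂ) (symmBase_sum q.1 q.2)
    simp only [map_add, map_zero] at this
    simp only [hs]
    linear_combination c * this - c * hξ
  -- The functional equation reads (Σr)(Σr') - Σrr' = 0, and each sum is invariant under
  -- permutations.
  have hsum : ∀ v : Fin 3 → ℂ, v (σ 0) + v (σ 1) + v (σ 2) = v 0 + v 1 + v 2 := fun v => by
    have := Equiv.sum_comp σ v
    rwa [Fin.sum_univ_three, Fin.sum_univ_three] at this
  have hid := Φ.recip_identity hΦ (s := fun i => s (σ.symm i))
    ((by simpa using hsum fun i => s (σ.symm i)) ▸ hs0) (fun i => by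
      have := (h1 (σ.symm i)).1
      rwa [Equiv.apply_symm_apply] at this)
  have e1 := hsum fun i => Φ.recip i (s (σ.symm i))
  have e2 := hsum fun i => deriv (Φ.recip i) (s (σ.symm i))
  have e3 := hsum fun i => Φ.recip i (s (σ.symm i)) * deriv (Φ.recip i) (s (σ.symm i))
  simp only [Equiv.symm_apply_apply] at e1 e2 e3
  apply (algebraMap 𝕜 ℂ).injective
  have r0 : algebraMap 𝕜 ℂ (recipDeriv f g h 0 q.1) = k / c * Φ.recip (σ 0) (s 0) := (h1 0).2
  have r1 : algebraMap 𝕜 ℂ (recipDeriv f g h 1 q.2) = k / c * Φ.recip (σ 1) (s 1) := (h1 1).2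
  have r2 : algebraMap 𝕜 ℂ (recipDeriv f g h 2 (-(q.1 + q.2))) = k / c * Φ.recip (σ 2) (s 2) :=
    (h1 2).2
  have d0 : algebraMap 𝕜 ℂ (deriv (recipDeriv f g h 0) q.1) =
    k / c * c * deriv (Φ.recip (σ 0)) (s 0) := h2 0
  have d1 : algebraMap 𝕜 ℂ (deriv (recipDeriv f g h 1) q.2) =
    k / c * c * deriv (Φ.recip (σ 1)) (s 1) := h2 1
  have d2 : algebraMap 𝕜 ℂ (deriv (recipDeriv f g h 2) (-(q.1 + q.2))) =
    k / c * c * deriv (Φ.recip (σ 2)) (s 2) := h2 2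
  simp only [map_add, map_mul, map_zero, r0, r1, r2, d0, d1, d2]
  linear_combination k / c * (k / c * c) * (hid + (deriv (Φ.recip (σ 0)) (s 0) +
    deriv (Φ.recip (σ 1)) (s 1) + deriv (Φ.recip (σ 2)) (s 2)) * e1 +
    (Φ.recip 0 (s (σ.symm 0)) + Φ.recip 1 (s (σ.symm 1)) + Φ.recip 2 (s (σ.symm 2))) * e2 - e3)

/-- A determinant vanishing near the point would make all reciprocals affine there, but every family
with nondegenerate parameters contains one that is not. -/
theorem BelongsTo.frequently_dualityDet_ne_zero (hp : NondegenerateAt f g h p) (hΦ : Φ.Valid)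
    (hb : BelongsTo f g h p.1 p.2 Φ) : ∃ᶠ q in 𝓝 p, dualityDet f g h q ≠ 0 := by
  obtain ⟨σ, c, k, ξ, a, hc, hk, hξ, hV⟩ := hb
  have hr := fun i => Φ.eventually_recipDeriv hΦ hp hc hk (hV i)
  have hd := fun i => eventually_deriv_of_scaled (Φ.differentiable_recip (σ i))
    (hp.recipDeriv i).1 ((hr i).mono fun _ ht => ht.2)
  have hd₂ := fun i => eventually_deriv_of_scaled (Φ.differentiable_recip (σ i)).deriv
    (hp.recipDeriv i).1.deriv (hd i)
  have hd₃ := fun i => eventually_deriv_of_scaled (Φ.differentiable_recip (σ i)).deriv.deriv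
    (hp.recipDeriv i).1.deriv.deriv (hd₂ i)
  intro hD
  simp only [not_not] at hD
  have h0 := (hr (σ.symm 0)).self_of_nhds.1
  rw [Equiv.apply_symm_apply] at h0
  obtain ⟨j, hj⟩ := Φ.exists_nonAffine hΦ h0
  obtain ⟨i, rfl⟩ := σ.surjective j
  have hz := eventually_second_eq_zero hp hD i
  have hz₃ : deriv (deriv (deriv (recipDeriv f g h i))) (symmBase p.1 p.2 i) = 0 :=
    (EventuallyEq.deriv_eq hz).trans (by simp)
  have e2 := (hd₂ i).self_of_nhds
  have e3 := (hd₃ i).self_of_nhds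
  rw [hz.self_of_nhds, map_zero] at e2
  rw [hz₃, map_zero] at e3
  exact hj _ ⟨(mul_eq_zero.1 e2.symm).resolve_left (by simp [hk, hc]),
    (mul_eq_zero.1 e3.symm).resolve_left (by simp [hk, hc])⟩

end Membership

/-! ### Lattices with the differential condition belong to the list. -/

section Classification

variable {𝕜 : Type*} [RCLike 𝕜] [NormedAlgebra 𝕜 ℂ] {f g h : 𝕜 → 𝕜} {p : 𝕜 × 𝕜}

theorem hasDerivAt_algebraMap_sub (t₀ t : 𝕜) :
    HasDerivAt (fun t => algebraMap 𝕜 ℂ t - algebraMap 𝕜 ℂ t₀) 1 t := by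
  simpa using hasDerivAt_mul_algebraMap_sub (1 : ℂ) (algebraMap 𝕜 ℂ t₀) t

theorem eventually_jet {a : 𝕜 → 𝕜} {t₀ κ : 𝕜} (ha : AnalyticAt 𝕜 a t₀)
    (hκ : ∀ᶠ t in 𝓝 t₀, deriv (deriv (deriv a)) t = κ * deriv a t) :
    ∀ᶠ t in 𝓝 t₀,
      HasDerivAt (fun t => algebraMap 𝕜 ℂ (a t)) (algebraMap 𝕜 ℂ (deriv a t)) t ∧
      HasDerivAt (fun t => algebraMap 𝕜 ℂ (deriv a t)) (algebraMap 𝕜 ℂ (deriv (deriv a) t)) t ∧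
      HasDerivAt (fun t => algebraMap 𝕜 ℂ (deriv (deriv a) t))
        (algebraMap 𝕜 ℂ κ * algebraMap 𝕜 ℂ (deriv a t)) t := by
  filter_upwards [ha.eventually_analyticAt, hκ] with t h1 h2
  refine ⟨h1.differentiableAt.hasDerivAt.algebraMap_comp,
    h1.deriv.differentiableAt.hasDerivAt.algebraMap_comp, ?_⟩
  rw [← map_mul, ← h2]
  exact h1.deriv.deriv.differentiableAt.hasDerivAt.algebraMap_comp

/-- The equation a''' = ω²a' has the first integrals a - a''/ω² and (a''/ω² ± a'/ω)e^{∓ωτ}, where τ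
= t - t₀. They are complex valued, since ω need not be real over ℝ. -/
theorem eventually_eq_expPoly {a : 𝕜 → 𝕜} {t₀ κ : 𝕜} {ω : ℂ} (ha : AnalyticAt 𝕜 a t₀)
    (hκ : ∀ᶠ t in 𝓝 t₀, deriv (deriv (deriv a)) t = κ * deriv a t) (hω : ω ≠ 0)
    (hωκ : algebraMap 𝕜 ℂ κ = ω ^ 2) :
    ∀ᶠ t in 𝓝 t₀, algebraMap 𝕜 ℂ (a t) = expPoly ω
      (algebraMap 𝕜 ℂ (a t₀) - algebraMap 𝕜 ℂ (deriv (deriv a) t₀) / ω ^ 2)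
      ((algebraMap 𝕜 ℂ (deriv (deriv a) t₀) / ω ^ 2 + algebraMap 𝕜 ℂ (deriv a t₀) / ω) / 2)
      ((algebraMap 𝕜 ℂ (deriv (deriv a) t₀) / ω ^ 2 - algebraMap 𝕜 ℂ (deriv a t₀) / ω) / 2)
      (algebraMap 𝕜 ℂ t - algebraMap 𝕜 ℂ t₀) := by
  have hj := eventually_jet ha hκ
  have c0 : ∀ᶠ t in 𝓝 t₀, HasDerivAt (fun t => algebraMap 𝕜 ℂ (a t) -
      algebraMap 𝕜 ℂ (deriv (deriv a) t) / ω ^ 2) 0 t := by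
    filter_upwards [hj] with t ht
    refine (ht.1.sub (ht.2.2.div_const (ω ^ 2))).congr_deriv ?_
    rw [hωκ]
    field_simp
    ring
  have c1 : ∀ {ω : ℂ}, ω ≠ 0 → algebraMap 𝕜 ℂ κ = ω ^ 2 → ∀ᶠ t in 𝓝 t₀, HasDerivAt (fun t =>
      (algebraMap 𝕜 ℂ (deriv (deriv a) t) / ω ^ 2 + algebraMap 𝕜 ℂ (deriv a t) / ω) *
        Complex.exp (-(ω * (algebraMap 𝕜 ℂ t - algebraMap 𝕜 ℂ t₀)))) 0 t := by
    intro ω hω hωκ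
    filter_upwards [hj] with t ht
    refine (((ht.2.2.div_const (ω ^ 2)).fun_add (ht.2.1.div_const ω)).mul
      ((hasDerivAt_algebraMap_sub t₀ t).const_mul ω).fun_neg.cexp).congr_deriv ?_
    rw [hωκ]
    field_simp
    ring
  filter_upwards [eventually_eq_of_hasDerivAt_zero c0,
    eventually_eq_of_hasDerivAt_zero (c1 hω hωκ),
    eventually_eq_of_hasDerivAt_zero (c1 (neg_ne_zero.2 hω) (by rw [neg_sq, hωκ]))]
    with t h0 h1 h2
  simp only [sub_self, mul_zero, neg_zero, Complex.exp_zero, mul_one, neg_mul, neg_neg, neg_sq,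
    div_neg] at h1 h2
  rw [Complex.exp_neg, ← div_eq_mul_inv, div_eq_iff (Complex.exp_ne_zero _)] at h1
  simp only [expPoly, Complex.exp_neg]
  have h3 := congrArg (· * (Complex.exp (ω * (algebraMap 𝕜 ℂ t - algebraMap 𝕜 ℂ t₀)))⁻¹) h2
  simp only [mul_assoc, mul_inv_cancel₀ (Complex.exp_ne_zero _), mul_one] at h3
  linear_combination h0 + h1 / 2 + h3 / 2

/-- The first integrals are now a'', a' - a''τ and a - a'τ + a''τ²/2 with τ = t - t₀. -/
theorem eventually_eq_quadPoly {a : 𝕜 → 𝕜} {t₀ : 𝕜} (ha : AnalyticAt 𝕜 a t₀)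
    (hκ : ∀ᶠ t in 𝓝 t₀, deriv (deriv (deriv a)) t = 0) :
    ∀ᶠ t in 𝓝 t₀, algebraMap 𝕜 ℂ (a t) = quadPoly (algebraMap 𝕜 ℂ (deriv (deriv a) t₀) / 2)
      (algebraMap 𝕜 ℂ (deriv a t₀)) (algebraMap 𝕜 ℂ (a t₀))
      (algebraMap 𝕜 ℂ t - algebraMap 𝕜 ℂ t₀) := by
  have hj := eventually_jet (κ := 0) ha (hκ.mono fun t ht => by rw [ht, zero_mul])
  simp only [map_zero, zero_mul] at hj
  have c1 : ∀ᶠ t in 𝓝 t₀, HasDerivAt (fun t => algebraMap 𝕜 ℂ (deriv a t) -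
      algebraMap 𝕜 ℂ (deriv (deriv a) t) * (algebraMap 𝕜 ℂ t - algebraMap 𝕜 ℂ t₀)) 0 t := by
    filter_upwards [hj] with t ht
    refine (ht.2.1.sub (ht.2.2.mul (hasDerivAt_algebraMap_sub t₀ t))).congr_deriv ?_
    ring
  have c2 : ∀ᶠ t in 𝓝 t₀, HasDerivAt (fun t => algebraMap 𝕜 ℂ (a t) -
      algebraMap 𝕜 ℂ (deriv a t) * (algebraMap 𝕜 ℂ t - algebraMap 𝕜 ℂ t₀) +
      algebraMap 𝕜 ℂ (deriv (deriv a) t) / 2 *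
        (algebraMap 𝕜 ℂ t - algebraMap 𝕜 ℂ t₀) ^ 2) 0 t := by
    filter_upwards [hj] with t ht
    have hτ := hasDerivAt_algebraMap_sub t₀ t
    refine ((ht.1.sub (ht.2.1.mul hτ)).add
      ((ht.2.2.div_const 2).mul (hτ.pow 2))).congr_deriv ?_
    norm_num
    ring
  filter_upwards [eventually_eq_of_hasDerivAt_zero c1, eventually_eq_of_hasDerivAt_zero c2,
    eventually_eq_of_hasDerivAt_zero (hj.mono fun t ht => ht.2.2)] with t h1 h2 h3
  simp only [sub_self, mul_zero, sub_zero, ne_eq, OfNat.ofNat_ne_zero, not_false_eq_true, zero_pow,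
    add_zero] at h1 h2
  simp only [quadPoly]
  rw [h3] at h1 h2
  linear_combination h2 + (algebraMap 𝕜 ℂ t - algebraMap 𝕜 ℂ t₀) * h1

theorem eventually_deriv_eq_zero {a : 𝕜 → 𝕜} {t₀ : 𝕜}
    (h : ∀ᶠ t in 𝓝 t₀, algebraMap 𝕜 ℂ (a t) = algebraMap 𝕜 ℂ (a t₀)) :
    ∀ᶠ t in 𝓝 t₀, deriv a t = 0 := by
  filter_upwards [h.eventually_nhds] with t ht
  have : a =ᶠ[𝓝 t] fun _ => a t₀ := ht.mono fun s hs => (algebraMap 𝕜 ℂ).injective hs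
  rw [this.deriv_eq]
  simp

/-- Integration turns the normal form of the reciprocals into the functions themselves; the additive
constants of the equivalence are the constants of integration. -/
theorem FamilyForm.exists_belongsTo {α : Fin 3 → ℂ → ℂ} (hα : FamilyForm α)
    (hp : NondegenerateAt f g h p)
    (hr : ∀ i, ∀ᶠ t in 𝓝 (symmBase p.1 p.2 i), algebraMap 𝕜 ℂ (recipDeriv f g h i t) =
      α i (algebraMap 𝕜 ℂ t - algebraMap 𝕜 ℂ (symmBase p.1 p.2 i))) :
    ∃ Φ : LatticeFamily, Φ.Valid ∧ BelongsTo f g h p.1 p.2 Φ := by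
  have ht : algebraMap 𝕜 ℂ (symmBase p.1 p.2 0) + algebraMap 𝕜 ℂ (symmBase p.1 p.2 1) +
      algebraMap 𝕜 ℂ (symmBase p.1 p.2 2) = 0 := by
    rw [← map_add, ← map_add, symmBase_sum, map_zero]
  obtain ⟨Φ, hΦ, σ, c, k, ξ, hc, hk, hξ, hs⟩ :=
    hα.shift (t := fun i => algebraMap 𝕜 ℂ (symmBase p.1 p.2 i)) ht
  have main : ∀ i, ∃ a, ∀ᶠ t in 𝓝 (symmBase p.1 p.2 i),
      Φ.symmValue (σ i) (c * (algebraMap 𝕜 ℂ t - ξ i))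
        (c * k * algebraMap 𝕜 ℂ (symmTriple f g h i t) + a) := by
    intro i
    obtain ⟨h1, h2⟩ := hp.symm i
    refine LatticeFamily.exists_symmValue (φ' := deriv (symmTriple f g h i)) hΦ hc
      (h1.eventually_analyticAt.mono fun t ht => ht.differentiableAt.hasDerivAt) ?_
    filter_upwards [hr i, h1.deriv.continuousAt.eventually_ne h2] with t h3 h4
    have h5 := h3.trans (hs i _)
    have h6 : algebraMap 𝕜 ℂ (deriv (symmTriple f g h i) t) ≠ 0 := by simpa using h4
    rw [recipDeriv, map_inv₀, inv_eq_iff_eq_inv] at h5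
    have h7 := left_ne_zero_of_mul (a := k * Φ.recip (σ i) (c * (algebraMap 𝕜 ℂ t - ξ i)))
      (b := 1) (by rw [mul_one]; exact fun h => h6 (by rw [h5, h, inv_zero]))
    rw [h5]
    have h8 := right_ne_zero_of_mul h7
    field_simp
  choose a ha using main
  exact ⟨Φ, hΦ, σ, c, c * k, ξ, a, hc, mul_ne_zero hc hk, hξ, ha⟩

/-- The lattices whose functions solve the functional equation belong to the list. -/
theorem exists_belongsTo (hp : NondegenerateAt f g h p) (hD : dualityDet f g h p ≠ 0)
    (hE : ∀ᶠ q in 𝓝 p, DualityPDE f g h q)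
    (hfg : ¬ (HasConstDeriv f p.1 ∧ HasConstDeriv g p.2))
    (hgh : ¬ (HasConstDeriv g p.2 ∧ HasConstDeriv h (p.1 + p.2)))
    (hhf : ¬ (HasConstDeriv h (p.1 + p.2) ∧ HasConstDeriv f p.1)) :
    ∃ Φ : LatticeFamily, Φ.Valid ∧ BelongsTo f g h p.1 p.2 Φ := by
  set a := recipDeriv f g h with ha
  set τ := symmBase p.1 p.2 with hτ
  have han : ∀ i, AnalyticAt 𝕜 (a i) (τ i) := fun i => (hp.recipDeriv i).1
  have hne : ∀ i, a i (τ i) ≠ 0 := fun i => (hp.recipDeriv i).2.1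
  have hτ0 : τ 0 + τ 1 + τ 2 = 0 := symmBase_sum _ _
  have k0 : (∀ᶠ t in 𝓝 (τ 0), deriv (a 0) t = 0) → HasConstDeriv f p.1 :=
    hasConstDeriv_of_recipDeriv hp
  have k1 : (∀ᶠ t in 𝓝 (τ 1), deriv (a 1) t = 0) → HasConstDeriv g p.2 :=
    hasConstDeriv_of_recipDeriv hp
  have k2 : (∀ᶠ t in 𝓝 (τ 2), deriv (a 2) t = 0) → HasConstDeriv h (p.1 + p.2) :=
    fun h0 => hasConstDeriv_of_neg (hasConstDeriv_of_recipDeriv hp h0)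
  have n01 : ¬ ((∀ᶠ t in 𝓝 (τ 0), deriv (a 0) t = 0) ∧ ∀ᶠ t in 𝓝 (τ 1), deriv (a 1) t = 0) :=
    fun h0 => hfg ⟨k0 h0.1, k1 h0.2⟩
  have n12 : ¬ ((∀ᶠ t in 𝓝 (τ 1), deriv (a 1) t = 0) ∧ ∀ᶠ t in 𝓝 (τ 2), deriv (a 2) t = 0) :=
    fun h0 => hgh ⟨k1 h0.1, k2 h0.2⟩
  have n20 : ¬ ((∀ᶠ t in 𝓝 (τ 2), deriv (a 2) t = 0) ∧ ∀ᶠ t in 𝓝 (τ 0), deriv (a 0) t = 0) :=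
    fun h0 => hhf ⟨k2 h0.1, k0 h0.2⟩
  have hnc : ∀ i j, i ≠ j → ¬ ((∀ᶠ t in 𝓝 (τ i), deriv (a i) t = 0) ∧
      ∀ᶠ t in 𝓝 (τ j), deriv (a j) t = 0) := by
    refine forall_fin_three (forall_fin_three ?_ ?_ ?_) (forall_fin_three ?_ ?_ ?_)
      (forall_fin_three ?_ ?_ ?_) <;> rintro hij ⟨h1, h2⟩
    exacts [hij rfl, n01 ⟨h1, h2⟩, n20 ⟨h2, h1⟩, n01 ⟨h2, h1⟩, hij rfl, n12 ⟨h1, h2⟩, n20 ⟨h1, h2⟩,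
      n12 ⟨h2, h1⟩, hij rfl]
  obtain ⟨r, hr, hP⟩ := exists_planeSolution hp hE
  obtain ⟨κ, e0, e1, e2⟩ := hP.exists_third_eq hr hτ0 n01 n12 n20
  replace hP := hP.mono (half_le_self hr.le)
  have hκ : ∀ i, ∀ᶠ t in 𝓝 (τ i), deriv (deriv (deriv (a i))) t = κ * deriv (a i) t :=
    forall_fin_three (Metric.eventually_nhds_iff_ball.2 ⟨_, half_pos hr, e0⟩)
      (Metric.eventually_nhds_iff_ball.2 ⟨_, half_pos hr, e1⟩)
      (Metric.eventually_nhds_iff_ball.2 ⟨_, half_pos hr, e2⟩)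
  set A : Fin 3 → ℂ := fun i => algebraMap 𝕜 ℂ (a i (τ i)) with hA
  set B : Fin 3 → ℂ := fun i => algebraMap 𝕜 ℂ (deriv (a i) (τ i)) with hB
  set C : Fin 3 → ℂ := fun i => algebraMap 𝕜 ℂ (deriv (deriv (a i)) (τ i)) with hC
  have hP' : ∀ i j k : Fin 3, i ≠ j → j ≠ k → i ≠ k →
      PlaneSolution (a i) (a j) (a k) (τ i) (τ j) (τ k) (r / 2) := by
    refine forall_fin_three (forall_fin_three ?_ ?_ ?_) (forall_fin_three ?_ ?_ ?_)
      (forall_fin_three ?_ ?_ ?_) <;> refine forall_fin_three ?_ ?_ ?_ <;> intro h1 h2 h3 <;>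
    first
      | exact absurd rfl h1
      | exact absurd rfl h2
      | exact absurd rfl h3
      | exact hP
      | exact hP.rotate
      | exact hP.rotate.rotate
      | exact hP.swap
      | exact hP.swap.rotate
      | exact hP.swap.rotate.rotate
  have hm : ∀ i, τ i ∈ Metric.ball (τ i) (r / 2) := fun i => Metric.mem_ball_self (half_pos hr)
  have hκ' : ∀ i, ∀ t ∈ Metric.ball (τ i) (r / 2),
    deriv (deriv (deriv (a i))) t = κ * deriv (a i) t := forall_fin_three e0 e1 e2
  have hs : ∀ i j k : Fin 3, i ≠ j → j ≠ k → i ≠ k → τ i + τ j + τ k = 0 := by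
    intro i j k hij hjk hik
    obtain ⟨π, rfl, rfl, rfl⟩ := exists_perm_fin_three hij hjk hik
    have := Equiv.sum_comp π τ
    rw [Fin.sum_univ_three, Fin.sum_univ_three] at this
    rw [this, hτ0]
  have hJ : JetCondition (algebraMap 𝕜 ℂ κ) A B C := by
    refine ⟨?_, fun i j k hij hjk hik => ?_, fun i j k hij hjk hik => ?_,
      fun i j k hij hjk hik => ?_⟩
    · simpa only [map_add, map_mul, map_zero] using
        congrArg (algebraMap 𝕜 ℂ) (hP.eq _ (hm 0) _ (hm 1) _ (hm 2) hτ0)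
    · simpa only [map_add, map_mul] using congrArg (algebraMap 𝕜 ℂ)
        ((hP' i j k hij hjk hik).second _ (hm i) _ (hm j) _ (hm k) (hs i j k hij hjk hik))
    · have := (hP' i j k hij hjk hik).third _ (hm i) _ (hm j) _ (hm k) (hs i j k hij hjk hik)
      rw [hκ' i _ (hm i)] at this
      simpa only [map_add, map_mul, map_sub] using congrArg (algebraMap 𝕜 ℂ) this
    · simpa only [map_add, map_mul] using congrArg (algebraMap 𝕜 ℂ)
        ((hP' i j k hij hjk hik).fourth (hκ' i) (hκ' j) _ (hm i) _ (hm j) _ (hm k)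
          (hs i j k hij hjk hik))
  -- κ = 0 means quadratic polynomials. Here invertibility of T enters, through the nonzero sum of
  -- the reciprocals at the base point.
  by_cases hκ0 : κ = 0
  · rw [hκ0, map_zero] at hJ
    simp only [hκ0, zero_mul] at hκ
    have hsol := fun i => eventually_eq_quadPoly (han i) (hκ i)
    refine (hJ.familyForm_quad (fun i j hij h0 => hnc i j hij ⟨?_, ?_⟩) ?_).exists_belongsTo hp hsol
    · refine eventually_deriv_eq_zero ((hsol i).mono fun t ht => ht.trans ?_)
      change quadPoly (C i / 2) (B i) _ _ = _
      rw [h0.1, h0.2.1]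
      simp [quadPoly]
    · refine eventually_deriv_eq_zero ((hsol j).mono fun t ht => ht.trans ?_)
      change quadPoly (C j / 2) (B j) _ _ = _
      rw [h0.2.2.1, h0.2.2.2]
      simp [quadPoly]
    · rw [dualityDet_eq hp] at hD
      have := right_ne_zero_of_mul hD
      simp only [hA, ← map_add]
      exact (map_ne_zero _).2 this
  · obtain ⟨ω, hω⟩ : ∃ ω : ℂ, algebraMap 𝕜 ℂ κ = ω ^ 2 :=
      ⟨_, (Complex.cpow_nat_inv_pow (algebraMap 𝕜 ℂ κ) two_ne_zero).symm⟩
    have hω0 : ω ≠ 0 := by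
      rintro rfl
      simp [hκ0] at hω
    rw [hω] at hJ
    have hsol := fun i => eventually_eq_expPoly (han i) (hκ i) hω0 hω
    refine (hJ.familyForm_exp hω0 (fun i => ?_) (fun i j hij h0 => hnc i j hij
      ⟨?_, ?_⟩)).exists_belongsTo hp hsol
    · exact (map_ne_zero _).2 (hne i)
    · refine eventually_deriv_eq_zero ((hsol i).mono fun t ht => ht.trans ?_)
      change expPoly ω (_ - C i / ω ^ 2) ((C i / ω ^ 2 + B i / ω) / 2)
        ((C i / ω ^ 2 - B i / ω) / 2) _ = _
      rw [h0.1, h0.2.1]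
      simp [expPoly]
    · refine eventually_deriv_eq_zero ((hsol j).mono fun t ht => ht.trans ?_)
      change expPoly ω (_ - C j / ω ^ 2) ((C j / ω ^ 2 + B j / ω) / 2)
        ((C j / ω ^ 2 - B j / ω) / 2) _ = _
      rw [h0.2.2.1, h0.2.2.2]
      simp [expPoly]

end Classification

/-! ### The family of the dual lattice. -/

section DualMembership

variable {𝕜 : Type*} [RCLike 𝕜] {f g h : 𝕜 → 𝕜} {p : 𝕜 × 𝕜}

theorem LatticeFamily.Valid.dual {Φ : LatticeFamily} (hΦ : Φ.Valid) : Φ.dual.Valid := by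
  cases Φ <;> exact hΦ

/-- In the symmetric form T is the cyclic rule Xᵢ = fᵢ₊₁ - fᵢ₊₂, where the three Xᵢ are X, Y, -(X +
Y). -/
theorem symmBase_dualityMap (f g h : 𝕜 → 𝕜) (q : 𝕜 × 𝕜) (i : Fin 3) :
    symmBase (dualityMap f g h q).1 (dualityMap f g h q).2 i =
      symmTriple f g h (i + 1) (symmBase q.1 q.2 (i + 1)) -
        symmTriple f g h (i + 2) (symmBase q.1 q.2 (i + 2)) := by
  revert i
  refine forall_fin_three ?_ ?_ ?_ <;> simp [symmBase, symmTriple, dualityMap]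
  all_goals ring

theorem hasDerivAt_symmTriple {F G H : 𝕜 → 𝕜} {q R : 𝕜 × 𝕜} {κ : 𝕜}
    (hF : HasDerivAt F (κ * deriv f q.1) R.1) (hG : HasDerivAt G (κ * deriv g q.2) R.2)
    (hH : HasDerivAt H (κ * deriv h (q.1 + q.2)) (R.1 + R.2)) (i : Fin 3) :
    HasDerivAt (symmTriple F G H i)
      (κ * deriv (symmTriple f g h i) (symmBase q.1 q.2 i)) (symmBase R.1 R.2 i) := by
  revert i
  refine forall_fin_three hF hG ?_
  change HasDerivAt (fun t => -H (-t)) (κ * deriv (fun t => -h (-t)) (-(q.1 + q.2)))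
    (-(R.1 + R.2))
  rw [deriv_neg_comp_neg, neg_neg]
  have h1 : HasDerivAt H (κ * deriv h (q.1 + q.2)) (-(-(R.1 + R.2))) := by rwa [neg_neg]
  exact ((h1.scomp _ (hasDerivAt_neg _)).fun_neg).congr_deriv (by simp)

theorem eventually_exists_symmBase_eq {Q : 𝕜 × 𝕜 → Prop} (hQ : ∀ᶠ q in 𝓝 p, Q q) (i : Fin 3) :
    ∀ᶠ t in 𝓝 (symmBase p.1 p.2 i), ∃ q, Q q ∧ symmBase q.1 q.2 i = t := by
  have key : ∀ {k : 𝕜 → 𝕜 × 𝕜} {t₀ : 𝕜} {i : Fin 3}, Continuous k → k t₀ = p →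
      (∀ t, symmBase (k t).1 (k t).2 i = t) →
      ∀ᶠ t in 𝓝 t₀, ∃ q, Q q ∧ symmBase q.1 q.2 i = t := fun hk h0 hi =>
    ((h0 ▸ hk.tendsto _).eventually hQ).mono fun t ht => ⟨_, ht, hi t⟩
  revert i
  refine forall_fin_three (key (k := fun t => (t, p.2)) (by fun_prop) rfl fun t => rfl)
    (key (k := fun t => (p.1, t)) (by fun_prop) rfl fun t => rfl)
    (key (k := fun t => (p.1, -t - p.1)) (by fun_prop) ?_ fun t => ?_)
  · simp [symmBase]
  · simp [symmBase]

/-- Even permutations preserve the cyclic order, odd ones reverse it. -/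
theorem perm_fin_three_cyclic (σ : Equiv.Perm (Fin 3)) :
    (∀ i, σ (i + 1) = σ i + 1 ∧ σ (i + 2) = σ i + 2) ∨
      ∀ i, σ (i + 1) = σ i + 2 ∧ σ (i + 2) = σ i + 1 := by
  revert σ
  decide

/-- The relation between a family and its dual, for permuted axes. -/
theorem LatticeFamily.exists_sign_dualRelation {Φ : LatticeFamily} (hΦ : Φ.Valid)
    (σ : Equiv.Perm (Fin 3)) : ∃ ε : ℂ, ε ≠ 0 ∧ ∀ s w : Fin 3 → ℂ, s 0 + s 1 + s 2 = 0 →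
      (∀ i, Φ.symmValue (σ i) (s i) (w i)) → (∀ i, Φ.recip (σ i) (s i) ≠ 0) → ∀ i,
      Φ.dual.recip (σ i) (ε * (w (i + 1) - w (i + 2))) *
        (Φ.recip (σ (i + 1)) (s (i + 1)) * Φ.recip (σ (i + 2)) (s (i + 2))) =
      -(Φ.recip (σ 0) (s 0) + Φ.recip (σ 1) (s 1) + Φ.recip (σ 2) (s 2)) := by
  have hsum : ∀ v : Fin 3 → ℂ, v (σ 0) + v (σ 1) + v (σ 2) = v 0 + v 1 + v 2 := fun v => by
    have := Equiv.sum_comp σ v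
    rwa [Fin.sum_univ_three, Fin.sum_univ_three] at this
  have main : ∀ s w : Fin 3 → ℂ, s 0 + s 1 + s 2 = 0 →
      (∀ i, Φ.symmValue (σ i) (s i) (w i)) → (∀ i, Φ.recip (σ i) (s i) ≠ 0) → ∀ i,
      Φ.dual.recip (σ i) (w (σ.symm (σ i + 1)) - w (σ.symm (σ i + 2))) *
        (Φ.recip (σ i + 1) (s (σ.symm (σ i + 1))) * Φ.recip (σ i + 2) (s (σ.symm (σ i + 2)))) =
      -(Φ.recip (σ 0) (s 0) + Φ.recip (σ 1) (s 1) + Φ.recip (σ 2) (s 2)) := by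
    intro s w hs hV hr i
    have hs' := hsum fun i => s (σ.symm i)
    simp only [Equiv.symm_apply_apply] at hs'
    have hr' := hsum fun i => Φ.recip i (s (σ.symm i))
    simp only [Equiv.symm_apply_apply] at hr'
    rw [hr']
    exact LatticeFamily.dualRelation hΦ (s := fun i => s (σ.symm i)) (w := fun i => w (σ.symm i))
      (hs'.symm.trans hs) (fun i => by simpa using hV (σ.symm i))
      (fun i => by simpa using hr (σ.symm i)) (σ i)
  rcases perm_fin_three_cyclic σ with hσ | hσ
  · refine ⟨1, one_ne_zero, fun s w hs hV hr i => ?_⟩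
    have := main s w hs hV hr i
    rw [← (hσ i).1, ← (hσ i).2, Equiv.symm_apply_apply, Equiv.symm_apply_apply] at this
    rw [one_mul, this]
  -- Reversing the cyclic order changes the sign of the differences wᵢ₊₁ - wᵢ₊₂.
  · refine ⟨-1, by simp, fun s w hs hV hr i => ?_⟩
    have := main s w hs hV hr i
    rw [← (hσ i).1, ← (hσ i).2, Equiv.symm_apply_apply, Equiv.symm_apply_apply] at this
    rw [neg_one_mul, neg_sub, ← this]
    ring

/-- With r i = c/(k u i) the hypothesis on R gives R = -kd/(c u i), where d is the sum of pairwise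
products of the u's. The factor -ec/(kρ) is what normalizes the derivative ρ u i/d of the dual
function. -/
theorem dual_scaling {u r : Fin 3 → ℂ} {c k ρ e R : ℂ} (hc : c ≠ 0) (hk : k ≠ 0) (hρ : ρ ≠ 0)
    (hu : ∀ i, u i ≠ 0) (hr : ∀ i, r i * (k * u i) = c)
    (hD : u 0 * u 1 + u 0 * u 2 + u 1 * u 2 ≠ 0) (i : Fin 3)
    (hR : R * (r (i + 1) * r (i + 2)) = -(r 0 + r 1 + r 2)) :
    R * (-(e * c / (k * ρ)) * (ρ / (u 0 * u 1 + u 0 * u 2 + u 1 * u 2) * u i)) = e := by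
  have hr' : ∀ i, r i = c / (k * u i) := fun i => by
    have := hu i
    rw [eq_div_iff (mul_ne_zero hk this), hr]
  have h0 := hu 0
  have h1 := hu 1
  have h2 := hu 2
  simp only [hr'] at hR
  generalize hd : u 0 * u 1 + u 0 * u 2 + u 1 * u 2 = d at hD ⊢
  revert i
  refine forall_fin_three ?_ ?_ ?_ <;> intro hR <;>
    simp only [Fin.isValue, Fin.reduceAdd] at hR <;> field_simp at hR ⊢ <;>
    linear_combination -e * hR + e * k * hd

variable [NormedAlgebra 𝕜 ℂ]

/-- The dual of a lattice of the list belongs to the dual family. -/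
theorem BelongsTo.dual {Φ : LatticeFamily} {F G H : 𝕜 → 𝕜} (hp : NondegenerateAt f g h p)
    (hΦ : Φ.Valid) (hb : BelongsTo f g h p.1 p.2 Φ) (hd : IsDualLattice f g h p.1 p.2 F G H) :
    BelongsTo F G H (dualityMap f g h p).1 (dualityMap f g h p).2 Φ.dual := by
  obtain ⟨σ, c, k, ξ, a, hc, hk, hξ, hV⟩ := hb
  obtain ⟨ρ, S, hρ, hS, hR⟩ := hd.exists_hasDerivAt hp
  obtain ⟨ε, hε, hrel⟩ := LatticeFamily.exists_sign_dualRelation hΦ σ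
  have hSt : Tendsto S (𝓝 (dualityMap f g h p)) (𝓝 p) := by
    have := hS.1.continuousAt.tendsto
    rwa [hS.2.1.self_of_nhds] at this
  have hρ' : algebraMap 𝕜 ℂ ρ ≠ 0 := (map_ne_zero _).2 hρ
  have hc' : ε * k ≠ 0 := mul_ne_zero hε hk
  have hr := fun i => LatticeFamily.eventually_recip_mul hΦ hk (hp.symm i).1 (hp.symm i).2 (hV i)
  -- The dual variables are differences of the functions, so the additive constants a i become
  -- shifts and the factor k becomes the scale of the variable. The shifts add up to zero by
  -- telescoping.
  set ξ' : Fin 3 → ℂ := fun i => -(a (i + 1) - a (i + 2)) / k with hξ'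
  have key : ∀ᶠ R in 𝓝 (dualityMap f g h p), ∀ i, ∃ d : 𝕜,
      HasDerivAt (symmTriple F G H i) d (symmBase R.1 R.2 i) ∧
      Φ.dual.recip (σ i) (ε * k * (algebraMap 𝕜 ℂ (symmBase R.1 R.2 i) - ξ' i)) *
        (-(ε * k * c / (k * algebraMap 𝕜 ℂ ρ)) * algebraMap 𝕜 ℂ d) = ε * k := by
    filter_upwards [hR, hSt.eventually (eventually_symmBase hV),
      hSt.eventually (eventually_symmBase hr)] with R hR hV hr i
    obtain ⟨hq, hD, hT, hF, hG, hH⟩ := hR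
    rw [← mul_div_assoc, mul_div_right_comm] at hF hG hH
    refine ⟨_, hasDerivAt_symmTriple hF hG hH i, ?_⟩
    set q := S R with hqdef
    have hs0 : c * (algebraMap 𝕜 ℂ (symmBase q.1 q.2 0) - ξ 0) +
        c * (algebraMap 𝕜 ℂ (symmBase q.1 q.2 1) - ξ 1) +
        c * (algebraMap 𝕜 ℂ (symmBase q.1 q.2 2) - ξ 2) = 0 := by
      have := congrArg (algebraMap 𝕜 ℂ) (symmBase_sum q.1 q.2)
      simp only [map_add, map_zero] at this
      linear_combination c * this - c * hξ
    have h1 := hrel (fun i => c * (algebraMap 𝕜 ℂ (symmBase q.1 q.2 i) - ξ i)) _ hs0 hV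
      (fun i => left_ne_zero_of_mul ((hr i).symm ▸ hc)) i
    have hu : ∀ i, algebraMap 𝕜 ℂ (deriv (symmTriple f g h i) (symmBase q.1 q.2 i)) ≠ 0 :=
      fun i => (map_ne_zero _).2 (hq.symm i).2
    have hD' : algebraMap 𝕜 ℂ (dualityDet f g h q) =
        algebraMap 𝕜 ℂ (deriv (symmTriple f g h 0) (symmBase q.1 q.2 0)) *
          algebraMap 𝕜 ℂ (deriv (symmTriple f g h 1) (symmBase q.1 q.2 1)) +
        algebraMap 𝕜 ℂ (deriv (symmTriple f g h 0) (symmBase q.1 q.2 0)) *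
          algebraMap 𝕜 ℂ (deriv (symmTriple f g h 2) (symmBase q.1 q.2 2)) +
        algebraMap 𝕜 ℂ (deriv (symmTriple f g h 1) (symmBase q.1 q.2 1)) *
          algebraMap 𝕜 ℂ (deriv (symmTriple f g h 2) (symmBase q.1 q.2 2)) := by
      simp only [← map_mul, ← map_add]
      congr 1
      have e : deriv (symmTriple f g h 2) (symmBase q.1 q.2 2) = deriv h (q.1 + q.2) := by
        change deriv (fun t => -h (-t)) (-(q.1 + q.2)) = _
        rw [deriv_neg_comp_neg, neg_neg]
      rw [e]
      rfl
    have harg : ε * k * (algebraMap 𝕜 ℂ (symmBase R.1 R.2 i) - ξ' i) =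
        ε * (k * algebraMap 𝕜 ℂ (symmTriple f g h (i + 1) (symmBase q.1 q.2 (i + 1))) + a (i + 1) -
          (k * algebraMap 𝕜 ℂ (symmTriple f g h (i + 2) (symmBase q.1 q.2 (i + 2))) +
            a (i + 2))) := by
      rw [← hT, symmBase_dualityMap, map_sub]
      simp only [hξ']
      field_simp
      ring
    rw [harg, map_mul, map_div₀, hD']
    exact dual_scaling hc hk hρ' hu hr (hD' ▸ (map_ne_zero _).2 hD) i h1
  have main : ∀ i, ∃ a', ∀ᶠ t in 𝓝 (symmBase (dualityMap f g h p).1 (dualityMap f g h p).2 i),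
      Φ.dual.symmValue (σ i) (ε * k * (algebraMap 𝕜 ℂ t - ξ' i))
        (-(ε * k * c / (k * algebraMap 𝕜 ℂ ρ)) * algebraMap 𝕜 ℂ (symmTriple F G H i t) + a') := by
    intro i
    have hev := eventually_exists_symmBase_eq key i
    refine LatticeFamily.exists_symmValue (φ' := deriv (symmTriple F G H i)) hΦ.dual hc'
      (hev.mono ?_) (hev.mono ?_)
    · rintro t ⟨R, hR, rfl⟩
      obtain ⟨d, hd, -⟩ := hR i
      exact hd.differentiableAt.hasDerivAt
    · rintro t ⟨R, hR, rfl⟩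
      obtain ⟨d, hd, he⟩ := hR i
      rwa [hd.deriv]
  choose a' ha' using main
  refine ⟨σ, ε * k, _, ξ', a', hc', ?_, ?_, ha'⟩
  · exact neg_ne_zero.2 (div_ne_zero (mul_ne_zero hc' hc) (mul_ne_zero hk hρ'))
  · simp only [hξ', Fin.isValue, Fin.reduceAdd]
    ring

end DualMembership

/-- Classification of the lattices of discrete relativistic Toda type that admit duality
transformations. The field `𝕜` is `ℝ` or `ℂ`. -/
theorem mainTheorem1 {𝕜 : Type*} [RCLike 𝕜] [NormedAlgebra 𝕜 ℂ]
    (f g h : 𝕜 → 𝕜) (x₀ y₀ : 𝕜)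
    (hf : AnalyticAt 𝕜 f x₀) (hg : AnalyticAt 𝕜 g y₀) (hh : AnalyticAt 𝕜 h (x₀ + y₀))
    (hf' : deriv f x₀ ≠ 0) (hg' : deriv g y₀ ≠ 0) (hh' : deriv h (x₀ + y₀) ≠ 0)
    (hfg : ¬ (HasConstDeriv f x₀ ∧ HasConstDeriv g y₀))
    (hgh : ¬ (HasConstDeriv g y₀ ∧ HasConstDeriv h (x₀ + y₀)))
    (hhf : ¬ (HasConstDeriv h (x₀ + y₀) ∧ HasConstDeriv f x₀)) :
    -- the lattices that admit duality transformations are those of the list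
    (AdmitsDuality f g h x₀ y₀ ↔
      DualityMapInvertible f g h x₀ y₀ ∧
        ∃ Φ : LatticeFamily, Φ.Valid ∧ BelongsTo f g h x₀ y₀ Φ) ∧
    -- for the lattices of the list the mapping is invertible at generic points
    ((∃ Φ : LatticeFamily, Φ.Valid ∧ BelongsTo f g h x₀ y₀ Φ) →
      ∃ᶠ p in 𝓝 (x₀, y₀), AdmitsDuality f g h p.1 p.2) ∧
    -- the dual lattice exists
    (AdmitsDuality f g h x₀ y₀ → ∃ F G H : 𝕜 → 𝕜, IsDualLattice f g h x₀ y₀ F G H) ∧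
    -- the dual lattice belongs to the corresponding family, with the same parameters
    (∀ Φ : LatticeFamily, Φ.Valid → BelongsTo f g h x₀ y₀ Φ →
      ∀ F G H : 𝕜 → 𝕜, IsDualLattice f g h x₀ y₀ F G H →
        BelongsTo F G H (dualityMap f g h (x₀, y₀)).1 (dualityMap f g h (x₀, y₀)).2 Φ.dual) := by
  have hp : NondegenerateAt f g h (x₀, y₀) := ⟨hf, hg, hh, hf', hg', hh'⟩
  refine ⟨⟨fun hd => ?_, ?_⟩, ?_, fun hd => ?_, fun Φ hΦ hb F G H hd => hb.dual hp hΦ hd⟩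
  · obtain ⟨hT, hE⟩ := (admitsDuality_iff hp).1 hd
    obtain ⟨S, hS⟩ := hT
    exact ⟨⟨S, hS⟩, exists_belongsTo hp (hS.hasFDerivAt hp).1 hE hfg hgh hhf⟩
  · rintro ⟨hT, Φ, hΦ, hb⟩
    exact (admitsDuality_iff hp).2 ⟨hT, hb.eventually_dualityPDE hp hΦ⟩
  · rintro ⟨Φ, hΦ, hb⟩
    have hE := hb.eventually_dualityPDE hp hΦ
    -- Where the determinant is nonzero the inverse function theorem applies, and the differential
    -- condition persists at all nearby points.
    refine (hb.frequently_dualityDet_ne_zero hp hΦ).mp ?_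
    filter_upwards [hp.eventually, hE.eventually_nhds] with q hq hEq hD
    exact (admitsDuality_iff hq).2 ⟨hq.dualityMapInvertible hD, hEq⟩
  · obtain ⟨hT, hE⟩ := (admitsDuality_iff hp).1 hd
    exact exists_isDualLattice hp hT hE
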